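/- For each integer $N\ge 1$ let $G_N$ be an $N\times N$ GOE matrix, i.e. a random real symmetric matrix whose entries on and above the diagonal are independent, with distribution $\mathrm N(0,1)$ on the diagonal and $\mathrm N(0,\tfrac12)$ (variance $\tfrac12$) off the diagonal; the matrices $G_N$, $N\ge 1$, are defined on one probability space, with an arbitrary joint law. Let $\hat{\mathbf 1}_N=N^{-1/2}(1,\dots,1)^T\in\mathbb R^N$, let $\alpha>0$, and let $\lambda_1^{(N)}\ge\lambda_2^{(N)}\ge\dots\ge\lambda_N^{(N)}$ be the eigenvalues of $$\frac{1}{\sqrt{2N}}\,G_N+\alpha\,\hat{\mathbf 1}_N\hat{\mathbf 1}_N^T .$$ Let $\rho^{\rm W}(x)=\frac{2}{\pi}(1-x^2)^{1/2}$ for $|x|\le 1$ and $\rho^{\rm W}(x)=0$ for $|x|>1$ (the Wigner semicircle density). (i) If $\alpha\le\frac12$, then almost surely: for every $\varepsilon>0$, for all sufficiently large $N$, all of the eigenvalues $\lambda_1^{(N)},\dots,\lambda_N^{(N)}$ lie in $[-1-\varepsilon,1+\varepsilon]$; and the empirical measure $\frac1N\sum_{j=1}^N\delta_{\lambda_j^{(N)}}$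 converges weakly to $\rho^{\rm W}(x)\,dx$ as $N\to\infty$. (ii) If $\alpha>\frac12$, then almost surely: $\lambda_1^{(N)}\to\alpha+\frac{1}{4\alpha}$ as $N\to\infty$; for every $\varepsilon>0$, for all sufficiently large $N$, all of the other eigenvalues $\lambda_2^{(N)},\dots,\lambda_N^{(N)}$ lie in $[-1-\varepsilon,1+\varepsilon]$; and the empirical measure $\frac1{N-1}\sum_{j=2}^N\delta_{\lambda_j^{(N)}}$ converges weakly to $\rho^{\rm W}(x)\,dx$. -/

import Mathlib

open MeasureTheory ProbabilityTheory Filter Topology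
open scoped NNReal BoundedContinuousFunction

noncomputable section

namespace RankOneGOE

/-- The random matrix `G` belongs to the (unscaled) Gaussian orthogonal ensemble: it is real
symmetric, its entries on and above the diagonal are independent, the diagonal entries are standard
normal, and the off-diagonal entries are centred normal with variance `1 / 2`.
Equivalently, its density is proportional to `exp (- Tr G ^ 2 / 2)` on symmetric matrices. -/
structure IsGOE {Ω : Type*} [MeasurableSpace Ω] (P : Measure Ω) {N : ℕ}
    (G : Ω → Matrix (Fin N) (Fin N) ℝ) : Prop where
  isSymm : ∀ ω, (G ω).IsSymm
  diag_law : ∀ i, HasLaw (fun ω => G ω i i) (gaussianReal 0 1) P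
  offDiag_law : ∀ i j, i < j → HasLaw (fun ω => G ω i j) (gaussianReal 0 (1 / 2 : ℝ≥0)) P
  indep : iIndepFun (fun (p : {p : Fin N × Fin N // p.1 ≤ p.2}) ω => G ω p.1.1 p.1.2) P

/-- The unit column vector in `ℝ ^ N` with all entries equal. -/
def unitOnes (N : ℕ) : Fin N → ℝ := fun _ => 1 / √(N : ℝ)

/-- The matrix `G / √(2 N) + α 1̂ 1̂ᵀ`. -/
def perturbed {N : ℕ} (α : ℝ) (G : Matrix (Fin N) (Fin N) ℝ) : Matrix (Fin N) (Fin N) ℝ :=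
  (1 / √(2 * (N : ℝ))) • G + α • Matrix.vecMulVec (unitOnes N) (unitOnes N)

open Classical in
/-- The eigenvalues of a real symmetric matrix `A`, with multiplicity, in decreasing order:
`eig A 0 ≥ eig A 1 ≥ ... ≥ eig A (N - 1)`. (The value is `0` for an index `j ≥ N`, or if `A` is not
symmetric; these values are never used.) -/
def eig {N : ℕ} (A : Matrix (Fin N) (Fin N) ℝ) (j : ℕ) : ℝ :=
  if h : A.IsHermitian ∧ j < N then h.1.eigenvalues₀ ⟨j, by simpa using h.2⟩ else 0

/-- The normalised Wigner semicircle density on `[-1, 1]`; it vanishes outside `[-1, 1]` since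
`Real.sqrt` is `0` at negative numbers. -/
def semicircleDensity (x : ℝ) : ℝ := 2 / Real.pi * √(1 - x ^ 2)

/-- The points `x N j`, `j ∈ I N`, have limiting normalised density `ρ` as `N → ∞`: their empirical
measures converge weakly to the measure with density `ρ`. -/
def HasLimitingDensity (x : ℕ → ℕ → ℝ) (I : ℕ → Finset ℕ) (ρ : ℝ → ℝ) : Prop :=
  ∀ f : ℝ →ᵇ ℝ, Tendsto (fun N => (∑ j ∈ I N, f (x N j)) / ((I N).card : ℝ)) atTop
    (𝓝 (∫ t, f t * ρ t))

/-- In the limit `N → ∞` the points `x N j`, `j ∈ I N`, are supported on `[a, b]`: for every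
`ε > 0` and all large `N`, all of them lie in `[a - ε, b + ε]`. -/
def AsymptoticallySupportedOn (x : ℕ → ℕ → ℝ) (I : ℕ → Finset ℕ) (a b : ℝ) : Prop :=
  ∀ ε > 0, ∀ᶠ N in atTop, ∀ j ∈ I N, x N j ∈ Set.Icc (a - ε) (b + ε)

end RankOneGOE

end

/-!
Write `W = G / √(2 N)` and `u = 1̂`. Three facts about `W` hold almost surely as `N → ∞`:

* for every polynomial `p`, both `uᵀ p(W) u` and `tr p(W) / N` tend to `∫ p ρ`, with `ρ` the
  semicircle density (`ae_tendsto_dotProduct_aeval`, `ae_tendsto_trace_aeval`);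
* `|vᵀ W v| ≤ 1 + o(1)` uniformly over unit vectors `v`;
* `vᵀ W v + α (u · v)² ≤ F + o(1)` uniformly over unit vectors `v`, where `F` is the maximum over
  `y ∈ [0, 1]` of `y + α (1 - y²)`, that is `1` if `α ≤ 1/2` and `α + 1/(4 α)` if `α > 1/2`
  (`ae_eventually_quadratic_le`).

The rest is linear algebra. A perturbation of rank one changes `tr p` by a bounded amount, so the
method of moments gives the semicircle law for `W + α u uᵀ`. Since `α u uᵀ ≥ 0`, all eigenvalues are
at least `-1 - o(1)`; all but the largest are at most `1 + o(1)`, because the plane spanned by two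
eigenvectors meets the hyperplane orthogonal to `u`; the largest is at most `F + o(1)`. For
`α > 1/2`, the bound `F` is attained: with `q = 1/(2 α) < 1` and `U` the Chebyshev polynomials of the
second kind, the vector `∑_{j ≤ K} q^j U_{j-1}(W) u` has Rayleigh quotient close to `α + 1/(4 α)`,
since the `U_j` are orthonormal for `ρ` (`eventually_lt_eig_zero`).

The first fact reduces to `uᵀ U_{k-1}(W) u → 0` for `k ≥ 2`, and follows from a bound `C / N²` for
the fourth moment (`exists_integral_chebForm_pow_four_le`), which is summable. By Gaussian
concentration (`integral_sub_integral_pow_four_le`) it is enough to bound the expectation. This is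
done by induction on `k`: Gaussian integration by parts gives a Schwinger–Dyson equation
(`integral_dotProduct_wigner_mul_chebSeq`) in which the recursion of the Chebyshev polynomials
cancels the leading terms.

The other two facts come from Slepian's inequality (`measure_exists_pos_le`), which compares the
maximum over the sphere of `vᵀ W v + d(v)` with that of `v · g / √N + d(v)`, for a standard Gaussian
vector `g` (`measure_exists_sphere_quadForm_le`). For `d(v) = α (u · v)²` the second maximum is
explicit and tends to `F`, and fourth moments again give a summable tail
(`exists_measure_sphere_le`). No independence between different `N` is needed, only the
Borel–Cantelli argument of `ae_tendsto_of_lintegral_le`.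
-/

open MeasureTheory ProbabilityTheory Filter Topology
open scoped NNReal BoundedContinuousFunction

noncomputable section
namespace RankOneGOE

open scoped Matrix Matrix.Norms.L2Operator
open Finset.HasAntidiagonal (antidiagonal)

/-! ### Standard Gaussian vectors -/

/-- The standard Gaussian measure on `ι → ℝ`. -/
abbrev stdGaussianPi (ι : Type*) [Fintype ι] : Measure (ι → ℝ) :=
  Measure.pi fun _ => gaussianReal 0 1

section Gaussian

variable {ι : Type*} [Fintype ι]

instance isGaussian_stdGaussianPi : IsGaussian (stdGaussianPi ι) := by
  have h : stdGaussianPi ι =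
      (stdGaussian (EuclideanSpace ℝ ι)).map (EuclideanSpace.equiv ι ℝ).toContinuousLinearMap := by
    rw [← map_pi_eq_stdGaussian, Measure.map_map (by fun_prop) (by fun_prop)]
    exact Measure.map_id.symm
  rw [h]
  infer_instance

lemma integral_id_stdGaussianPi : ∫ a, id a ∂(stdGaussianPi ι) = 0 := by
  have hint : Integrable (fun a : ι → ℝ => a) (stdGaussianPi ι) := IsGaussian.integrable_id
  ext i
  have h := (ContinuousLinearMap.proj (R := ℝ) (φ := fun _ : ι => ℝ) i).integral_comp_comm hint
  simp only [ContinuousLinearMap.proj_apply] at h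
  simp only [id]
  rw [← h, Pi.zero_apply]
  have h2 := (measurePreserving_eval (fun _ : ι => gaussianReal 0 1) i).map_eq
  have h3 := integral_map (μ := stdGaussianPi ι) (φ := Function.eval i) (f := fun x : ℝ => x)
    (measurable_pi_apply i).aemeasurable (by fun_prop)
  rw [h2] at h3
  simpa using h3.symm

/-- For independent standard Gaussian vectors `x`, `y`, the position `cos θ x + sin θ y` and the
velocity `-sin θ x + cos θ y` on the arc from `x` to `y` are again independent standard Gaussian
vectors. -/
lemma measurePreserving_rotation (θ : ℝ) :
    MeasurePreserving (fun p : (ι → ℝ) × (ι → ℝ) =>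
        (Real.cos θ • p.1 + Real.sin θ • p.2, -Real.sin θ • p.1 + Real.cos θ • p.2))
      ((stdGaussianPi ι).prod (stdGaussianPi ι)) ((stdGaussianPi ι).prod (stdGaussianPi ι)) := by
  refine ⟨by fun_prop, ?_⟩
  have h := IsGaussian.map_rotation_eq_self (μ := stdGaussianPi ι) integral_id_stdGaussianPi θ
  exact h

/-- Polynomial growth at infinity. Together with continuity, it provides the integrability of all the
functions of a Gaussian vector which occur below. -/
def PolyGrowth (f : (ι → ℝ) → ℝ) : Prop :=
  ∃ (C : ℝ) (m : ℕ), 0 ≤ C ∧ ∀ a, |f a| ≤ C * (1 + ‖a‖) ^ m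

lemma integrable_one_add_norm_pow (m : ℕ) :
    Integrable (fun a : ι → ℝ => (1 + ‖a‖) ^ m) (stdGaussianPi ι) := by
  have h0 : MemLp (fun a : ι → ℝ => ‖a‖) m (stdGaussianPi ι) :=
    (IsGaussian.memLp_id (stdGaussianPi ι) m (ENNReal.natCast_ne_top m)).norm
  have h : MemLp (fun a : ι → ℝ => (1 : ℝ) + ‖a‖) m (stdGaussianPi ι) :=
    MemLp.add (f := fun _ : ι → ℝ => (1 : ℝ)) (memLp_const 1) h0
  have h2 : Integrable (fun a : ι → ℝ => ‖(1 : ℝ) + ‖a‖‖ ^ m) (stdGaussianPi ι) :=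
    h.integrable_norm_pow'
  have h3 : ∀ a : ι → ℝ, ‖(1 : ℝ) + ‖a‖‖ = 1 + ‖a‖ := fun a =>
    Real.norm_of_nonneg (by positivity)
  simpa only [h3] using h2

lemma PolyGrowth.integrable {f : (ι → ℝ) → ℝ} (hf : PolyGrowth f) (hc : Continuous f) :
    Integrable f (stdGaussianPi ι) := by
  obtain ⟨C, m, -, h⟩ := hf
  exact ((integrable_one_add_norm_pow m).const_mul C).mono' hc.aestronglyMeasurable
    (ae_of_all _ h)

lemma PolyGrowth.of_le {f g : (ι → ℝ) → ℝ} (hg : PolyGrowth g) (h : ∀ a, |f a| ≤ |g a|) :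
    PolyGrowth f := by
  obtain ⟨C, m, hC, hb⟩ := hg
  exact ⟨C, m, hC, fun a => (h a).trans (hb a)⟩

lemma PolyGrowth.const (c : ℝ) : PolyGrowth (fun _ : ι → ℝ => c) :=
  ⟨|c|, 0, abs_nonneg c, fun _ => by simp⟩

lemma PolyGrowth.norm : PolyGrowth (fun a : ι → ℝ => ‖a‖) :=
  ⟨1, 1, zero_le_one, fun a => by simp⟩

lemma PolyGrowth.eval (i : ι) : PolyGrowth (fun a : ι → ℝ => a i) :=
  PolyGrowth.norm.of_le fun a => by
    rw [abs_norm]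
    exact norm_le_pi_norm a i

lemma PolyGrowth.mul {f g : (ι → ℝ) → ℝ} (hf : PolyGrowth f) (hg : PolyGrowth g) :
    PolyGrowth (fun a => f a * g a) := by
  obtain ⟨C, m, hC, h⟩ := hf
  obtain ⟨D, k, hD, h'⟩ := hg
  refine ⟨C * D, m + k, by positivity, fun a => ?_⟩
  rw [abs_mul, pow_add]
  calc |f a| * |g a| ≤ (C * (1 + ‖a‖) ^ m) * (D * (1 + ‖a‖) ^ k) := by
        gcongr
        · exact h a
        · exact h' a
    _ = _ := by ring

lemma PolyGrowth.add {f g : (ι → ℝ) → ℝ} (hf : PolyGrowth f) (hg : PolyGrowth g) :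
    PolyGrowth (fun a => f a + g a) := by
  obtain ⟨C, m, hC, h⟩ := hf
  obtain ⟨D, k, hD, h'⟩ := hg
  refine ⟨C + D, m + k, by positivity, fun a => ?_⟩
  have h1 : 1 ≤ 1 + ‖a‖ := by simp
  calc |f a + g a| ≤ |f a| + |g a| := abs_add_le _ _
    _ ≤ C * (1 + ‖a‖) ^ m + D * (1 + ‖a‖) ^ k := add_le_add (h a) (h' a)
    _ ≤ C * (1 + ‖a‖) ^ (m + k) + D * (1 + ‖a‖) ^ (m + k) := by
        gcongr <;> first | exact h1 | omega
    _ = _ := by ring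

lemma PolyGrowth.neg {f : (ι → ℝ) → ℝ} (hf : PolyGrowth f) : PolyGrowth (fun a => -f a) :=
  hf.of_le fun a => by simp

lemma PolyGrowth.sub {f g : (ι → ℝ) → ℝ} (hf : PolyGrowth f) (hg : PolyGrowth g) :
    PolyGrowth (fun a => f a - g a) := by
  simpa [sub_eq_add_neg] using hf.add hg.neg

lemma PolyGrowth.pow {f : (ι → ℝ) → ℝ} (hf : PolyGrowth f) (n : ℕ) :
    PolyGrowth (fun a => f a ^ n) := by
  induction n with
  | zero => simpa using PolyGrowth.const 1
  | succ n ih => simpa [pow_succ] using ih.mul hf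

lemma PolyGrowth.sum {κ : Type*} (s : Finset κ) {f : κ → (ι → ℝ) → ℝ}
    (hf : ∀ i ∈ s, PolyGrowth (f i)) : PolyGrowth (fun a => ∑ i ∈ s, f i a) := by
  classical
  induction s using Finset.induction_on with
  | empty => simpa using PolyGrowth.const 0
  | insert i s hi ih =>
    simp only [Finset.sum_insert hi]
    exact (hf i (by simp)).add (ih fun j hj => hf j (by simp [hj]))

/-- Resampling one coordinate of a standard Gaussian vector does not change its law. -/
lemma measurePreserving_update [DecidableEq ι] (p : ι) :
    MeasurePreserving (fun z : (ι → ℝ) × ℝ => Function.update z.1 p z.2)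
      ((stdGaussianPi ι).prod (gaussianReal 0 1)) (stdGaussianPi ι) := by
  have hm : Measurable (fun z : (ι → ℝ) × ℝ => Function.update z.1 p z.2) := by
    refine measurable_pi_lambda _ fun i => ?_
    by_cases h : i = p
    · subst h; simpa using measurable_snd
    · simp only [Function.update_of_ne h]
      exact (measurable_pi_apply i).comp measurable_fst
  refine ⟨hm, (Measure.pi_eq fun s hs => ?_).symm⟩
  rw [Measure.map_apply hm (MeasurableSet.univ_pi hs)]
  have : (fun z : (ι → ℝ) × ℝ => Function.update z.1 p z.2) ⁻¹' (Set.univ.pi s) =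
      (Set.univ.pi (Function.update s p Set.univ)) ×ˢ (s p) := by
    ext ⟨a, x⟩
    simp only [Set.mem_preimage, Set.mem_univ_pi, Set.mem_prod]
    constructor
    · intro h
      refine ⟨fun i => ?_, by simpa using h p⟩
      by_cases hi : i = p
      · subst hi; simp
      · simpa [Function.update_of_ne hi] using h i
    · rintro ⟨h, hx⟩ i
      by_cases hi : i = p
      · subst hi; simpa using hx
      · simpa [Function.update_of_ne hi] using h i
  rw [this, Measure.prod_prod, Measure.pi_pi, ← Finset.mul_prod_erase Finset.univ _ (Finset.mem_univ p),
    ← Finset.mul_prod_erase Finset.univ (fun i => gaussianReal 0 1 (s i)) (Finset.mem_univ p)]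
  simp only [Function.update_self, measure_univ, one_mul]
  rw [mul_comm]
  congr 1
  refine Finset.prod_congr rfl fun i hi => ?_
  rw [Function.update_of_ne (Finset.ne_of_mem_erase hi)]

/-- One-dimensional Gaussian integration by parts. -/
lemma integral_id_mul_gaussianReal {f f' : ℝ → ℝ} (hd : ∀ x, HasDerivAt f (f' x) x)
    (hf : Integrable f (gaussianReal 0 1)) (hf' : Integrable f' (gaussianReal 0 1))
    (hxf : Integrable (fun x => x * f x) (gaussianReal 0 1)) :
    ∫ x, x * f x ∂(gaussianReal 0 1) = ∫ x, f' x ∂(gaussianReal 0 1) := by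
  have hφ : ∀ x, HasDerivAt (gaussianPDFReal 0 1) (-x * gaussianPDFReal 0 1 x) x := by
    intro x
    rw [gaussianPDFReal_def]
    have h : HasDerivAt (fun x : ℝ => -(x - 0) ^ 2 / (2 * ((1 : ℝ≥0) : ℝ))) (-x) x := by
      have := (((hasDerivAt_id x).sub_const 0).pow 2).neg.div_const (2 * ((1 : ℝ≥0) : ℝ))
      convert! this using 1
      simp
      ring
    convert! (h.exp.const_mul ((√(2 * Real.pi * ((1 : ℝ≥0) : ℝ)))⁻¹)) using 1
    simp
    ring
  have key : ∀ {g : ℝ → ℝ}, Integrable g (gaussianReal 0 1) ↔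
      Integrable (fun x => gaussianPDFReal 0 1 x * g x) := by
    intro g
    rw [gaussianReal_of_var_ne_zero 0 one_ne_zero,
      integrable_withDensity_iff_integrable_smul' (measurable_gaussianPDF 0 1)
        (ae_of_all _ fun _ => gaussianPDF_lt_top)]
    simp [toReal_gaussianPDF]
  have h0 := integral_eq_zero_of_hasDerivAt_of_integrable
    (f := fun x => gaussianPDFReal 0 1 x * f x)
    (f' := fun x => gaussianPDFReal 0 1 x * f' x - gaussianPDFReal 0 1 x * (x * f x))
    (fun x => by
      convert! (hφ x).mul (hd x) using 1
      ring)
    ((key.1 hf').sub (key.1 hxf)) (key.1 hf)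
  rw [integral_sub (key.1 hf') (key.1 hxf), sub_eq_zero] at h0
  rw [integral_gaussianReal_eq_integral_smul one_ne_zero,
    integral_gaussianReal_eq_integral_smul one_ne_zero]
  simpa using h0.symm

/-- Gaussian integration by parts in the coordinate `p`. -/
theorem integral_eval_mul_eq_integral_deriv [DecidableEq ι] (p : ι) {f f' : (ι → ℝ) → ℝ}
    (hd : ∀ a, HasDerivAt (fun t : ℝ => f (a + t • Pi.single p 1)) (f' a) 0)
    (hf : Integrable f (stdGaussianPi ι)) (hf' : Integrable f' (stdGaussianPi ι))
    (hpf : Integrable (fun a => a p * f a) (stdGaussianPi ι)) :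
    ∫ a, a p * f a ∂(stdGaussianPi ι) = ∫ a, f' a ∂(stdGaussianPi ι) := by
  have hmp := measurePreserving_update (ι := ι) p
  have hI : ∀ {g : (ι → ℝ) → ℝ}, Integrable g (stdGaussianPi ι) →
      Integrable (fun z : (ι → ℝ) × ℝ => g (Function.update z.1 p z.2))
        ((stdGaussianPi ι).prod (gaussianReal 0 1)) := fun hg =>
    hmp.integrable_comp_of_integrable hg
  have hE : ∀ {g : (ι → ℝ) → ℝ}, Integrable g (stdGaussianPi ι) →
      ∫ a, g a ∂(stdGaussianPi ι) =
        ∫ a, ∫ x, g (Function.update a p x) ∂(gaussianReal 0 1) ∂(stdGaussianPi ι) := by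
    intro g hg
    rw [← integral_prod _ (hI hg)]
    have := integral_map (μ := (stdGaussianPi ι).prod (gaussianReal 0 1))
      (f := g) hmp.measurable.aemeasurable (by rw [hmp.map_eq]; exact hg.1)
    rw [hmp.map_eq] at this
    exact this
  rw [hE hpf, hE hf']
  refine integral_congr_ae ?_
  filter_upwards [(hI hf).prod_right_ae, (hI hf').prod_right_ae, (hI hpf).prod_right_ae]
    with a h1 h2 h3
  simp only [Function.update_self] at h3 ⊢
  refine integral_id_mul_gaussianReal (fun x => ?_) h1 h2 h3
  have h4 := hd (Function.update a p x)
  have h5 : ∀ y : ℝ, Function.update a p x + (y - x) • Pi.single p (1 : ℝ) =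
      Function.update a p y := by
    intro y
    ext i
    by_cases hi : i = p
    · subst hi; simp
    · simp [hi]
  have h6 : HasDerivAt (fun y : ℝ => y - x) 1 x := (hasDerivAt_id x).sub_const x
  have h7 := HasDerivAt.comp (h₂ := fun t : ℝ => f (Function.update a p x + t • Pi.single p 1))
    x (by simpa using h4) h6
  simpa [Function.comp_def, h5] using h7

end Gaussian

/-! ### Concentration of the fourth moment -/

section Concentration

variable {ι : Type*} [Fintype ι]

lemma hasDerivAt_linearForm_single [DecidableEq ι] (c a : ι → ℝ) (p : ι) :
    HasDerivAt (fun t : ℝ => ∑ i, c i * (a + t • (Pi.single p (1 : ℝ) : ι → ℝ)) i) (c p) 0 := by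
  have h : ∀ t : ℝ, ∑ i, c i * (a + t • (Pi.single p (1 : ℝ) : ι → ℝ)) i = ∑ i, c i * a i + t * c p := by
    intro t
    simp only [Pi.add_apply, Pi.smul_apply, smul_eq_mul, mul_add, Finset.sum_add_distrib]
    congr 1
    rw [Finset.sum_eq_single p]
    · simp; ring
    · intro i _ hi; simp [hi]
    · simp
  simp only [h]
  simpa using ((hasDerivAt_id (0 : ℝ)).mul_const (c p)).const_add (∑ i, c i * a i)

lemma polyGrowth_linearForm (c : ι → ℝ) : PolyGrowth (fun a : ι → ℝ => ∑ i, c i * a i) :=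
  PolyGrowth.sum _ fun i _ => (PolyGrowth.const (c i)).mul (PolyGrowth.eval i)

/-- The recursion for the moments of a centred Gaussian variable, by integration by parts. -/
lemma integral_linearForm_pow_succ (c : ι → ℝ) (n : ℕ) :
    ∫ a, (∑ i, c i * a i) ^ (n + 2) ∂(stdGaussianPi ι) =
      (n + 1) * (∑ i, c i ^ 2) * ∫ a, (∑ i, c i * a i) ^ n ∂(stdGaussianPi ι) := by
  classical
  have hL := polyGrowth_linearForm c
  have hc : Continuous (fun a : ι → ℝ => ∑ i, c i * a i) := by fun_prop
  have h1 : ∀ a : ι → ℝ, (∑ i, c i * a i) ^ (n + 2) =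
      ∑ p, c p * (a p * (∑ i, c i * a i) ^ (n + 1)) := by
    intro a
    rw [pow_succ', Finset.sum_mul]
    exact Finset.sum_congr rfl fun p _ => by ring
  have hint : ∀ p, Integrable (fun a : ι → ℝ => a p * (∑ i, c i * a i) ^ (n + 1))
      (stdGaussianPi ι) := fun p =>
    ((PolyGrowth.eval p).mul (hL.pow _)).integrable (by fun_prop)
  have h2 : ∀ p, ∫ a, a p * (∑ i, c i * a i) ^ (n + 1) ∂(stdGaussianPi ι) =
      ∫ a, (n + 1) * c p * (∑ i, c i * a i) ^ n ∂(stdGaussianPi ι) := by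
    intro p
    refine integral_eval_mul_eq_integral_deriv p (fun a => ?_) ((hL.pow _).integrable (by fun_prop))
      (((PolyGrowth.const _).mul (hL.pow _)).integrable (by fun_prop)) (hint p)
    have := (hasDerivAt_linearForm_single c a p).fun_pow (n + 1)
    convert! this using 1
    simp
    ring
  simp_rw [h1]
  rw [integral_finsetSum _ fun p _ => (hint p).const_mul _]
  simp_rw [integral_const_mul, h2, integral_const_mul]
  rw [Finset.mul_sum, Finset.sum_mul]
  exact Finset.sum_congr rfl fun p _ => by ring

lemma integral_linearForm_sq (c : ι → ℝ) :
    ∫ a, (∑ i, c i * a i) ^ 2 ∂(stdGaussianPi ι) = ∑ i, c i ^ 2 := by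
  simpa using integral_linearForm_pow_succ c 0

lemma integral_linearForm_pow_four (c : ι → ℝ) :
    ∫ a, (∑ i, c i * a i) ^ 4 ∂(stdGaussianPi ι) = 3 * (∑ i, c i ^ 2) ^ 2 := by
  rw [integral_linearForm_pow_succ c 2, integral_linearForm_sq]
  norm_num
  ring

lemma enorm_integral_pow_four_le {α : Type*} [MeasurableSpace α] (μ : Measure α) {g : α → ℝ}
    (hg : AEStronglyMeasurable g μ) :
    ‖∫ x, g x ∂μ‖ₑ ^ 4 ≤ μ Set.univ ^ 3 * ∫⁻ x, ‖g x‖ₑ ^ 4 ∂μ := by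
  have h1 : ‖∫ x, g x ∂μ‖ₑ ≤ ∫⁻ x, ‖g x‖ₑ ∂μ := enorm_integral_le_lintegral_enorm g
  have hpq : Real.HolderConjugate (4 / 3) 4 := by
    rw [Real.holderConjugate_iff]; norm_num
  have h2 := ENNReal.lintegral_mul_le_Lp_mul_Lq μ hpq (f := fun _ => 1) (g := fun x => ‖g x‖ₑ)
    aemeasurable_const hg.enorm
  simp only [Pi.mul_apply, one_mul, ENNReal.one_rpow, lintegral_const, one_div] at h2
  calc ‖∫ x, g x ∂μ‖ₑ ^ 4 ≤ (μ Set.univ ^ ((4 / 3 : ℝ)⁻¹) *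
        (∫⁻ x, ‖g x‖ₑ ^ (4 : ℝ) ∂μ) ^ ((4 : ℝ)⁻¹)) ^ 4 := by gcongr; exact h1.trans h2
    _ = μ Set.univ ^ 3 * ∫⁻ x, ‖g x‖ₑ ^ 4 ∂μ := by
      rw [mul_pow, ← ENNReal.rpow_natCast, ← ENNReal.rpow_mul, ← ENNReal.rpow_natCast (_ ^ _),
        ← ENNReal.rpow_mul]
      norm_num

/-- A bound `|Df(a) h| ≤ K(a) |h|` for all `h` bounds the Euclidean norm of the gradient. -/
lemma sum_sq_apply_single_le [DecidableEq ι] (L : (ι → ℝ) →L[ℝ] ℝ) {K : ℝ} (hK : 0 ≤ K)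
    (h : ∀ x, |L x| ≤ K * √(∑ i, x i ^ 2)) : ∑ i, L (Pi.single i 1) ^ 2 ≤ K ^ 2 := by
  set g : ι → ℝ := fun i => L (Pi.single i 1)
  have h1 : L g = ∑ i, g i ^ 2 := by
    conv_lhs => rw [← Finset.univ_sum_single g]
    rw [map_sum]
    refine Finset.sum_congr rfl fun i _ => ?_
    have : (Pi.single i (g i) : ι → ℝ) = g i • Pi.single i 1 := by
      rw [← Pi.single_smul]; simp
    rw [this, map_smul, smul_eq_mul, sq]
  have h2 := h g
  rw [h1, abs_of_nonneg (Finset.sum_nonneg fun i _ => sq_nonneg _)] at h2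
  set s := ∑ i, g i ^ 2 with hs
  have hs0 : 0 ≤ s := Finset.sum_nonneg fun i _ => sq_nonneg _
  have hss := Real.sq_sqrt hs0
  have h3 : √s ≤ K := by
    rcases (Real.sqrt_nonneg s).eq_or_lt with h0 | h0
    · rw [← h0]; exact hK
    · nlinarith
  nlinarith [Real.sqrt_nonneg s]

lemma lintegral_enorm_linear_pow_four_le (L : (ι → ℝ) →L[ℝ] ℝ) {K : ℝ} (hK : 0 ≤ K)
    (h : ∀ x, |L x| ≤ K * √(∑ i, x i ^ 2)) :
    ∫⁻ y, ‖L y‖ₑ ^ 4 ∂(stdGaussianPi ι) ≤ ENNReal.ofReal (3 * K ^ 4) := by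
  classical
  have h1 : ∀ y : ι → ℝ, L y = ∑ i, L (Pi.single i 1) * y i := by
    intro y
    conv_lhs => rw [← Finset.univ_sum_single y]
    rw [map_sum]
    refine Finset.sum_congr rfl fun i _ => ?_
    have : (Pi.single i (y i) : ι → ℝ) = y i • Pi.single i 1 := by
      rw [← Pi.single_smul]; simp
    rw [this, map_smul, smul_eq_mul, mul_comm]
  have h2 : ∀ y : ι → ℝ, ‖L y‖ₑ ^ 4 = ENNReal.ofReal ((∑ i, L (Pi.single i 1) * y i) ^ 4) := by
    intro y
    rw [Real.enorm_eq_ofReal_abs, ← ENNReal.ofReal_pow (abs_nonneg _), ← h1 y]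
    congr 1
    exact Even.pow_abs (by decide) _
  simp_rw [h2]
  rw [← ofReal_integral_eq_lintegral_ofReal
    (((polyGrowth_linearForm _).pow 4).integrable (by fun_prop))
    (ae_of_all _ fun y => by positivity), integral_linearForm_pow_four]
  refine ENNReal.ofReal_le_ofReal ?_
  have h3 := sum_sq_apply_single_le L hK h
  have h4 : 0 ≤ ∑ i, L (Pi.single i 1) ^ 2 := Finset.sum_nonneg fun i _ => sq_nonneg _
  nlinarith [pow_le_pow_left₀ h4 h3 2]

/-- The increment of `f` along the rotation from `x` to `y`. -/
lemma sub_eq_integral_rotation {f : (ι → ℝ) → ℝ} (hf : ContDiff ℝ 1 f) (x y : ι → ℝ) :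
    f y - f x = ∫ θ in (0 : ℝ)..(Real.pi / 2),
      fderiv ℝ f (Real.cos θ • x + Real.sin θ • y) (-Real.sin θ • x + Real.cos θ • y) := by
  have hd : ∀ θ : ℝ, HasDerivAt (fun θ : ℝ => f (Real.cos θ • x + Real.sin θ • y))
      (fderiv ℝ f (Real.cos θ • x + Real.sin θ • y) (-Real.sin θ • x + Real.cos θ • y)) θ := by
    intro θ
    have h1 := (hf.differentiable one_ne_zero (Real.cos θ • x + Real.sin θ • y)).hasFDerivAt
    have h2 : HasDerivAt (fun θ : ℝ => Real.cos θ • x + Real.sin θ • y)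
        (-Real.sin θ • x + Real.cos θ • y) θ :=
      ((Real.hasDerivAt_cos θ).smul_const x).add ((Real.hasDerivAt_sin θ).smul_const y)
    exact h1.comp_hasDerivAt θ h2
  have hc : Continuous (fun θ : ℝ =>
      fderiv ℝ f (Real.cos θ • x + Real.sin θ • y) (-Real.sin θ • x + Real.cos θ • y)) := by
    have := hf.continuous_fderiv one_ne_zero
    fun_prop
  rw [intervalIntegral.integral_eq_sub_of_hasDerivAt (fun θ _ => hd θ)
    (hc.intervalIntegrable _ _)]
  simp

/-- **Gaussian concentration of the fourth moment**: the fluctuations of `f` are controlled by the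
size of its gradient. The proof compares two independent Gaussian vectors along the rotation which
takes one to the other. -/
theorem integral_sub_integral_pow_four_le {f K : (ι → ℝ) → ℝ} (hf : ContDiff ℝ 1 f)
    (hfp : PolyGrowth f) (hK : ∀ a, 0 ≤ K a) (hKc : Continuous K) (hKp : PolyGrowth K)
    (h : ∀ a x, |fderiv ℝ f a x| ≤ K a * √(∑ i, x i ^ 2)) :
    ∫ a, (f a - ∫ b, f b ∂(stdGaussianPi ι)) ^ 4 ∂(stdGaussianPi ι) ≤
      3 * (Real.pi / 2) ^ 4 * ∫ a, K a ^ 4 ∂(stdGaussianPi ι) := by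
  set γ := stdGaussianPi ι with hγ
  have hfc := hf.continuous
  have hfi : Integrable f γ := hfp.integrable hfc
  have hf'c := hf.continuous_fderiv one_ne_zero
  set m := ∫ b, f b ∂γ with hm
  set X : ℝ → (ι → ℝ) × (ι → ℝ) → (ι → ℝ) × (ι → ℝ) := fun θ p =>
    (Real.cos θ • p.1 + Real.sin θ • p.2, -Real.sin θ • p.1 + Real.cos θ • p.2) with hX
  set D : (ι → ℝ) × (ι → ℝ) → ENNReal := fun p => ‖fderiv ℝ f p.1 p.2‖ₑ ^ 4 with hD
  have hDm : Measurable D := by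
    have : Continuous fun p : (ι → ℝ) × (ι → ℝ) => fderiv ℝ f p.1 p.2 := by fun_prop
    exact this.measurable.enorm.pow_const 4
  have hDX : Measurable (fun q : ((ι → ℝ) × (ι → ℝ)) × ℝ => D (X q.2 q.1)) :=
    hDm.comp (by fun_prop)
  have hKi : Integrable (fun a => K a ^ 4) γ := (hKp.pow 4).integrable (hKc.pow 4)
  have hK4 : ∀ a, 0 ≤ K a ^ 4 := fun a => pow_nonneg (hK a) 4
  have key : ∫⁻ a, ‖f a - m‖ₑ ^ 4 ∂γ ≤
      ENNReal.ofReal (3 * (Real.pi / 2) ^ 4 * ∫ a, K a ^ 4 ∂γ) := by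
    calc ∫⁻ a, ‖f a - m‖ₑ ^ 4 ∂γ
        ≤ ∫⁻ a, ∫⁻ b, ‖f b - f a‖ₑ ^ 4 ∂γ ∂γ := by
          refine lintegral_mono fun a => ?_
          have h1 : ‖f a - m‖ₑ = ‖∫ b, (f b - f a) ∂γ‖ₑ := by
            rw [integral_sub hfi (integrable_const _), ← enorm_neg]
            simp [hm]
          rw [h1]
          simpa using enorm_integral_pow_four_le γ (g := fun b => f b - f a)
            (by fun_prop)
      _ ≤ ∫⁻ a, ∫⁻ b, ENNReal.ofReal (Real.pi / 2) ^ 3 *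
            (∫⁻ θ in Set.Ioc 0 (Real.pi / 2), D (X θ (a, b)) ∂volume) ∂γ ∂γ := by
          refine lintegral_mono fun a => lintegral_mono fun b => ?_
          simp only
          rw [sub_eq_integral_rotation hf a b,
            intervalIntegral.integral_of_le (by positivity)]
          refine (enorm_integral_pow_four_le _ ?_).trans (le_of_eq ?_)
          · refine Continuous.aestronglyMeasurable ?_
            fun_prop
          · simp [hD, hX]
      _ = ENNReal.ofReal (Real.pi / 2) ^ 3 * ∫⁻ p,
            (∫⁻ θ in Set.Ioc 0 (Real.pi / 2), D (X θ p) ∂volume) ∂(γ.prod γ) := by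
          have hm1 : Measurable (fun p : (ι → ℝ) × (ι → ℝ) =>
              ∫⁻ θ in Set.Ioc 0 (Real.pi / 2), D (X θ p) ∂volume) := hDX.lintegral_prod_right'
          rw [← lintegral_const_mul _ hm1, lintegral_prod]
          exact (hm1.const_mul _).aemeasurable
      _ = ENNReal.ofReal (Real.pi / 2) ^ 3 * ∫⁻ θ in Set.Ioc 0 (Real.pi / 2),
            (∫⁻ p, D (X θ p) ∂(γ.prod γ)) ∂volume := by
          rw [lintegral_lintegral_swap]
          exact hDX.aemeasurable
      -- by rotation invariance the integral over `p` does not depend on `θ`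
      _ = ENNReal.ofReal (Real.pi / 2) ^ 3 * (ENNReal.ofReal (Real.pi / 2) *
            ∫⁻ p, D p ∂(γ.prod γ)) := by
          congr 1
          have : ∀ θ, ∫⁻ p, D (X θ p) ∂(γ.prod γ) = ∫⁻ p, D p ∂(γ.prod γ) := fun θ =>
            (measurePreserving_rotation θ).lintegral_comp hDm
          simp [this, mul_comm]
      _ ≤ ENNReal.ofReal (Real.pi / 2) ^ 3 * (ENNReal.ofReal (Real.pi / 2) *
            ∫⁻ a, ENNReal.ofReal (3 * K a ^ 4) ∂γ) := by
          gcongr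
          rw [lintegral_prod _ hDm.aemeasurable]
          refine lintegral_mono fun a => ?_
          exact lintegral_enorm_linear_pow_four_le (fderiv ℝ f a) (hK a) (h a)
      _ = ENNReal.ofReal (3 * (Real.pi / 2) ^ 4 * ∫ a, K a ^ 4 ∂γ) := by
          rw [← ofReal_integral_eq_lintegral_ofReal (hKi.const_mul 3)
            (ae_of_all _ fun a => mul_nonneg zero_le_three (hK4 a)), integral_const_mul, ← mul_assoc,
            ← pow_succ, ← ENNReal.ofReal_pow (by positivity),
            ← ENNReal.ofReal_mul (by positivity)]
          congr 1
          ring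
  have hi : Integrable (fun a => (f a - m) ^ 4) γ :=
    ((hfp.sub (PolyGrowth.const m)).pow 4).integrable (by fun_prop)
  have h2 : ∀ a, ‖f a - m‖ₑ ^ 4 = ENNReal.ofReal ((f a - m) ^ 4) := by
    intro a
    rw [Real.enorm_eq_ofReal_abs, ← ENNReal.ofReal_pow (abs_nonneg _)]
    congr 1
    exact Even.pow_abs (by decide) _
  simp_rw [h2] at key
  rw [← ofReal_integral_eq_lintegral_ofReal hi (ae_of_all _ fun a => by positivity)] at key
  refine (ENNReal.ofReal_le_ofReal_iff ?_).1 key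
  have : 0 ≤ ∫ a, K a ^ 4 ∂γ := integral_nonneg hK4
  positivity

end Concentration

/-! ### Gaussian comparison -/

section Comparison

set_option linter.unusedSectionVars false

variable {ι V : Type*} [Fintype ι] [Fintype V]

/-- The affine forms `a ↦ β (c_v · a + d_v)`, exponentiated. -/
def expForm (β : ℝ) (c : V → ι → ℝ) (d : V → ℝ) (v : V) (a : ι → ℝ) : ℝ :=
  Real.exp (β * (∑ p, c v p * a p + d v))

/-- The smooth approximation `exp (-∑ exp (β x_v))` of the indicator function of
`{max x_v < 0}`, evaluated at the affine forms `x_v = c_v · a + d_v`. -/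
def gumbel (β : ℝ) (c : V → ι → ℝ) (d : V → ℝ) (a : ι → ℝ) : ℝ :=
  Real.exp (-∑ v, expForm β c d v a)

variable (β : ℝ) (c : V → ι → ℝ) (d : V → ℝ)

lemma expForm_pos (v : V) (a : ι → ℝ) : 0 < expForm β c d v a := Real.exp_pos _

lemma gumbel_pos (a : ι → ℝ) : 0 < gumbel β c d a := Real.exp_pos _

lemma gumbel_le_one (a : ι → ℝ) : gumbel β c d a ≤ 1 :=
  Real.exp_le_one_iff.2 (neg_nonpos.2 (Finset.sum_nonneg fun v _ => (expForm_pos β c d v a).le))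

@[fun_prop]
lemma continuous_expForm (v : V) : Continuous (expForm β c d v) := by
  unfold expForm; fun_prop

@[fun_prop]
lemma continuous_gumbel : Continuous (gumbel β c d) := by
  unfold gumbel; fun_prop

lemma expForm_le_sum (v : V) (a : ι → ℝ) : expForm β c d v a ≤ ∑ w, expForm β c d w a :=
  Finset.single_le_sum (f := fun w => expForm β c d w a) (fun w _ => (expForm_pos β c d w a).le)
    (Finset.mem_univ v)

lemma expForm_mul_gumbel_le_one (v : V) (a : ι → ℝ) :
    expForm β c d v a * gumbel β c d a ≤ 1 := by
  have h1 := expForm_le_sum β c d v a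
  have h2 := Real.add_one_le_exp (∑ w, expForm β c d w a)
  rw [gumbel, Real.exp_neg, ← div_eq_mul_inv, div_le_one (Real.exp_pos _)]
  linarith

lemma expForm_mul_expForm_mul_gumbel_le (v w : V) (a : ι → ℝ) :
    expForm β c d v a * expForm β c d w a * gumbel β c d a ≤ 2 := by
  have h1 := expForm_le_sum β c d v a
  have h2 := expForm_le_sum β c d w a
  have h3 := expForm_pos β c d v a
  have h4 := expForm_pos β c d w a
  have h5 := Real.quadratic_le_exp_of_nonneg (h3.le.trans h1)
  rw [gumbel, Real.exp_neg, ← div_eq_mul_inv, div_le_iff₀ (Real.exp_pos _)]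
  nlinarith [mul_le_mul h1 h2 h4.le (h3.le.trans h1)]

lemma polyGrowth_expForm_mul_gumbel (v : V) :
    PolyGrowth (fun a => expForm β c d v a * gumbel β c d a) :=
  (PolyGrowth.const 1).of_le fun a => by
    rw [abs_one, abs_of_pos (mul_pos (expForm_pos β c d v a) (gumbel_pos β c d a))]
    exact expForm_mul_gumbel_le_one β c d v a

lemma polyGrowth_expForm_mul_expForm_mul_gumbel (v w : V) :
    PolyGrowth (fun a => expForm β c d v a * expForm β c d w a * gumbel β c d a) :=
  (PolyGrowth.const 2).of_le fun a => by
    rw [abs_two, abs_of_pos (mul_pos (mul_pos (expForm_pos β c d v a) (expForm_pos β c d w a))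
      (gumbel_pos β c d a))]
    exact expForm_mul_expForm_mul_gumbel_le β c d v w a

lemma hasDerivAt_expForm [DecidableEq ι] (v : V) (p : ι) (a : ι → ℝ) :
    HasDerivAt (fun t : ℝ => expForm β c d v (a + t • Pi.single p 1))
      (β * c v p * expForm β c d v a) 0 := by
  have h := (((hasDerivAt_linearForm_single (c v) a p).add_const (d v)).const_mul β).exp
  unfold expForm
  convert! h using 1
  simp
  ring

lemma hasDerivAt_gumbel [DecidableEq ι] (p : ι) (a : ι → ℝ) :
    HasDerivAt (fun t : ℝ => gumbel β c d (a + t • Pi.single p 1))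
      (-β * (∑ w, c w p * expForm β c d w a) * gumbel β c d a) 0 := by
  have h := (HasDerivAt.fun_sum (u := Finset.univ)
    fun w _ => hasDerivAt_expForm β c d w p a).neg.exp
  unfold gumbel
  convert! h using 1
  simp [Finset.mul_sum, Finset.sum_mul]
  refine Finset.sum_congr rfl fun w _ => by ring

/-- Integration by parts for `E_v e^{-∑ E_w}`, `E_v = expForm β c d v`. -/
lemma integral_eval_mul_expForm_mul_gumbel (v : V) (p : ι) :
    ∫ a, a p * (expForm β c d v a * gumbel β c d a) ∂(stdGaussianPi ι) =
      β * c v p * ∫ a, expForm β c d v a * gumbel β c d a ∂(stdGaussianPi ι) -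
      β * ∑ w, c w p * ∫ a, expForm β c d v a * expForm β c d w a * gumbel β c d a
        ∂(stdGaussianPi ι) := by
  classical
  have hE := polyGrowth_expForm_mul_gumbel β c d v
  have hEi : Integrable (fun a => expForm β c d v a * gumbel β c d a) (stdGaussianPi ι) :=
    hE.integrable (by fun_prop)
  have hEEi : ∀ w, Integrable (fun a => expForm β c d v a * expForm β c d w a * gumbel β c d a)
      (stdGaussianPi ι) := fun w =>
    (polyGrowth_expForm_mul_expForm_mul_gumbel β c d v w).integrable (by fun_prop)
  have hS : Integrable (fun a => ∑ w, c w p *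
      (expForm β c d v a * expForm β c d w a * gumbel β c d a)) (stdGaussianPi ι) :=
    integrable_finsetSum _ fun w _ => (hEEi w).const_mul _
  rw [integral_eval_mul_eq_integral_deriv p
    (f' := fun a => β * c v p * (expForm β c d v a * gumbel β c d a) -
      β * ∑ w, c w p * (expForm β c d v a * expForm β c d w a * gumbel β c d a))
    (fun a => ?_) hEi ((hEi.const_mul _).sub (hS.const_mul _))
    (((PolyGrowth.eval p).mul hE).integrable (by fun_prop)),
    integral_sub (hEi.const_mul _) (hS.const_mul _), integral_const_mul, integral_const_mul,
    integral_finsetSum _ fun w _ => (hEEi w).const_mul _]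
  · simp_rw [integral_const_mul]
  · convert! (hasDerivAt_expForm β c d v p a).mul (hasDerivAt_gumbel β c d p a) using 1
    simp [Finset.mul_sum, Finset.sum_mul, sub_eq_add_neg, mul_assoc]
    refine Finset.sum_congr rfl fun w _ => by ring

variable {c d} in
/-- Differentiating the expectation of `gumbel` along a path `c t` of coefficients whose speed is
orthogonal to the position. -/
lemma hasDerivAt_integral_gumbel {c c' : ℝ → V → ι → ℝ} {B : ℝ}
    (hc : ∀ t v p, HasDerivAt (fun t => c t v p) (c' t v p) t) (hB : ∀ t v p, |c' t v p| ≤ B)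
    (horth : ∀ t v, ∑ p, c' t v p * c t v p = 0) (t : ℝ) :
    HasDerivAt (fun t => ∫ a, gumbel β (c t) d a ∂(stdGaussianPi ι))
      (β ^ 2 * ∑ v, ∑ w, (∑ p, c' t v p * c t w p) *
        ∫ a, expForm β (c t) d v a * expForm β (c t) d w a * gumbel β (c t) d a
          ∂(stdGaussianPi ι)) t := by
  have hcs : ∀ (a : ι → ℝ) (v : V) (t : ℝ), HasDerivAt (fun t => ∑ p, c t v p * a p)
      (∑ p, c' t v p * a p) t := fun a v t =>
    HasDerivAt.fun_sum fun p _ => (hc t v p).mul_const (a p)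
  have hg : ∀ (a : ι → ℝ) (t : ℝ), HasDerivAt (fun t => gumbel β (c t) d a)
      (-β * ∑ v, ∑ p, c' t v p *
        (a p * (expForm β (c t) d v a * gumbel β (c t) d a))) t := by
    intro a t
    have h1 := (HasDerivAt.fun_sum (u := Finset.univ)
      fun v _ => (((hcs a v t).add_const (d v)).const_mul β).exp).neg.exp
    unfold gumbel expForm
    convert! h1 using 1
    simp only [Pi.neg_apply, Finset.mul_sum, ← Finset.sum_neg_distrib]
    refine Finset.sum_congr rfl fun v _ => Finset.sum_congr rfl fun p _ => by ring
  have hI : ∀ t v p, Integrable (fun a => a p * (expForm β (c t) d v a * gumbel β (c t) d a))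
      (stdGaussianPi ι) := fun t v p =>
    ((PolyGrowth.eval p).mul (polyGrowth_expForm_mul_gumbel β (c t) d v)).integrable (by fun_prop)
  have main := (hasDerivAt_integral_of_dominated_loc_of_deriv_le (μ := stdGaussianPi ι)
    (F := fun t a => gumbel β (c t) d a) (x₀ := t) (s := Set.univ)
    (F' := fun t a => -β * ∑ v, ∑ p, c' t v p *
        (a p * (expForm β (c t) d v a * gumbel β (c t) d a)))
    (bound := fun a => |β| * ∑ _v : V, ∑ p, B * |a p|) Filter.univ_mem
    (Eventually.of_forall fun t => (continuous_gumbel β (c t) d).aestronglyMeasurable)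
    (((PolyGrowth.const 1).of_le fun a => by
      rw [abs_one, abs_of_pos (gumbel_pos _ _ _ _)]
      exact gumbel_le_one _ _ _ _).integrable (by fun_prop))
    (Continuous.aestronglyMeasurable (by fun_prop))
    (ae_of_all _ fun a t _ => ?_) ?_ (ae_of_all _ fun a t _ => hg a t)).2
  · convert! main using 1
    rw [integral_const_mul, integral_finsetSum _ fun v _ => integrable_finsetSum _ fun p _ =>
      (hI t v p).const_mul _]
    have : ∀ v, ∫ a, ∑ p, c' t v p * (a p * (expForm β (c t) d v a * gumbel β (c t) d a))
        ∂(stdGaussianPi ι) = -β * ∑ w, (∑ p, c' t v p * c t w p) *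
        ∫ a, expForm β (c t) d v a * expForm β (c t) d w a * gumbel β (c t) d a
          ∂(stdGaussianPi ι) := by
      intro v
      rw [integral_finsetSum _ fun p _ => (hI t v p).const_mul _]
      simp_rw [integral_const_mul, integral_eval_mul_expForm_mul_gumbel, mul_sub,
        Finset.sum_sub_distrib]
      -- the term with the derivatives of the variances vanishes
      have h0 : ∀ J : ℝ, ∑ p, c' t v p * (β * c t v p * J) = 0 := by
        intro J
        have : ∀ p, c' t v p * (β * c t v p * J) = (β * J) * (c' t v p * c t v p) :=
          fun p => by ring
        simp_rw [this, ← Finset.mul_sum, horth, mul_zero]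
      rw [h0, zero_sub]
      simp_rw [Finset.mul_sum, Finset.sum_mul]
      rw [Finset.sum_comm, ← Finset.sum_neg_distrib]
      refine Finset.sum_congr rfl fun w _ => ?_
      rw [Finset.mul_sum, ← Finset.sum_neg_distrib]
      exact Finset.sum_congr rfl fun p _ => by ring
    simp_rw [this, Finset.mul_sum]
    refine Finset.sum_congr rfl fun v _ => Finset.sum_congr rfl fun w _ => by ring
  · rw [norm_mul, norm_neg, Real.norm_eq_abs β]
    gcongr
    refine (norm_sum_le _ _).trans (Finset.sum_le_sum fun v _ => ?_)
    refine (norm_sum_le _ _).trans (Finset.sum_le_sum fun p _ => ?_)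
    rw [Real.norm_eq_abs, abs_mul, abs_mul,
      abs_of_pos (mul_pos (expForm_pos β (c t) d v a) (gumbel_pos β (c t) d a))]
    have hB0 : 0 ≤ B := (abs_nonneg _).trans (hB t v p)
    have h1 := expForm_mul_gumbel_le_one β (c t) d v a
    calc |c' t v p| * (|a p| * (expForm β (c t) d v a * gumbel β (c t) d a))
        ≤ B * (|a p| * 1) := by
          gcongr
          · have := mul_pos (expForm_pos β (c t) d v a) (gumbel_pos β (c t) d a); positivity
          · exact hB t v p
      _ = B * |a p| := by ring
  · refine Integrable.const_mul (integrable_finsetSum _ fun v _ => integrable_finsetSum _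
      fun p _ => Integrable.const_mul ?_ _) _
    exact ((PolyGrowth.eval p).integrable (by fun_prop)).abs

/-- **Kahane's inequality** for the function `exp (-∑ exp (β x_v))`: it has a larger expectation
under the Gaussian vector with the larger covariances. -/
lemma integral_gumbel_le {L M : V → ι → ℝ} (hLM : ∀ v w, ∑ p, L v p * M w p = 0)
    (hdiag : ∀ v, ∑ p, L v p * L v p = ∑ p, M v p * M v p)
    (hcov : ∀ v w, ∑ p, M v p * M w p ≤ ∑ p, L v p * L w p) :
    ∫ a, gumbel β M d a ∂(stdGaussianPi ι) ≤ ∫ a, gumbel β L d a ∂(stdGaussianPi ι) := by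
  -- interpolation between the two vectors with constant variances
  set c : ℝ → V → ι → ℝ := fun t v p => Real.cos t * L v p + Real.sin t * M v p with hc
  set c' : ℝ → V → ι → ℝ := fun t v p => -Real.sin t * L v p + Real.cos t * M v p with hc'
  have hprod : ∀ t v w, ∑ p, c' t v p * c t w p =
      Real.sin t * Real.cos t * (∑ p, M v p * M w p - ∑ p, L v p * L w p) := by
    intro t v w
    have : ∀ p, c' t v p * c t w p =
        Real.sin t * Real.cos t * (M v p * M w p) - Real.sin t * Real.cos t * (L v p * L w p)
        - Real.sin t ^ 2 * (L v p * M w p) + Real.cos t ^ 2 * (L w p * M v p) := fun p => by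
      simp only [hc, hc']; ring
    simp_rw [this, Finset.sum_add_distrib, Finset.sum_sub_distrib, ← Finset.mul_sum, hLM]
    ring
  have hderiv := fun t => hasDerivAt_integral_gumbel (d := d) β (c := c) (c' := c')
    (B := (∑ v, ∑ p, (|L v p| + |M v p|)))
    (fun t v p => ((Real.hasDerivAt_cos t).mul_const _).add ((Real.hasDerivAt_sin t).mul_const _))
    (fun t v p => by
      have h1 : |c' t v p| ≤ |L v p| + |M v p| := by
        refine (abs_add_le _ _).trans ?_
        rw [abs_mul, abs_mul, abs_neg]
        have := Real.abs_sin_le_one t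
        have := Real.abs_cos_le_one t
        nlinarith [abs_nonneg (L v p), abs_nonneg (M v p)]
      refine h1.trans ?_
      refine le_trans ?_ (Finset.single_le_sum (f := fun v => ∑ p, (|L v p| + |M v p|))
        (fun v _ => Finset.sum_nonneg fun p _ => by positivity) (Finset.mem_univ v))
      exact Finset.single_le_sum (f := fun p => (|L v p| + |M v p|))
        (fun p _ => by positivity) (Finset.mem_univ p))
    (fun t v => by rw [hprod, hdiag]; ring) t
  have hanti : AntitoneOn (fun t => ∫ a, gumbel β (c t) d a ∂(stdGaussianPi ι))
      (Set.Icc 0 (Real.pi / 2)) := by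
    refine antitoneOn_of_deriv_nonpos (convex_Icc _ _)
      (fun t _ => (hderiv t).continuousAt.continuousWithinAt)
      (fun t _ => (hderiv t).differentiableAt.differentiableWithinAt) (fun t ht => ?_)
    rw [interior_Icc] at ht
    rw [(hderiv t).deriv]
    have hs : 0 ≤ Real.sin t := Real.sin_nonneg_of_nonneg_of_le_pi ht.1.le (by linarith [ht.2, ht.1])
    have hcos : 0 ≤ Real.cos t := Real.cos_nonneg_of_mem_Icc ⟨by linarith [ht.1, Real.pi_pos], ht.2.le⟩
    refine mul_nonpos_of_nonneg_of_nonpos (sq_nonneg β)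
      (Finset.sum_nonpos fun v _ => Finset.sum_nonpos fun w _ => ?_)
    refine mul_nonpos_of_nonpos_of_nonneg ?_ (integral_nonneg fun a => ?_)
    · rw [hprod]
      exact mul_nonpos_of_nonneg_of_nonpos (mul_nonneg hs hcos) (sub_nonpos.2 (hcov v w))
    · exact (mul_pos (mul_pos (expForm_pos _ _ _ _ _) (expForm_pos _ _ _ _ _))
        (gumbel_pos _ _ _ _)).le
  have h := hanti (Set.left_mem_Icc.2 (by positivity)) (Set.right_mem_Icc.2 (by positivity))
    (by positivity : (0 : ℝ) ≤ Real.pi / 2)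
  simpa [hc] using h

/-- The pointwise limit of `exp (-exp (n x))` as `n → ∞`. -/
def gumbelLimit (x : ℝ) : ℝ := if 0 < x then 0 else if x = 0 then Real.exp (-1) else 1

lemma tendsto_exp_neg_exp (x : ℝ) :
    Tendsto (fun n : ℕ => Real.exp (-Real.exp (n * x))) atTop (𝓝 (gumbelLimit x)) := by
  have hn : Tendsto (fun n : ℕ => (n : ℝ)) atTop atTop := tendsto_natCast_atTop_atTop
  rcases lt_trichotomy x 0 with h | h | h
  · rw [gumbelLimit, if_neg (by linarith), if_neg h.ne]
    have h1 := Real.tendsto_exp_atBot.comp (hn.atTop_mul_const_of_neg h)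
    have h2 := (Real.continuous_exp.tendsto _).comp h1.neg
    simpa [Function.comp_def] using h2
  · subst h
    simp [gumbelLimit]
  · rw [gumbelLimit, if_pos h]
    have h1 := Real.tendsto_exp_atTop.comp (hn.atTop_mul_const h)
    exact Real.tendsto_exp_atBot.comp (tendsto_neg_atTop_atBot.comp h1)

lemma tendsto_integral_gumbel (c : V → ι → ℝ) (d : V → ℝ) :
    Tendsto (fun n : ℕ => ∫ a, gumbel n c d a ∂(stdGaussianPi ι)) atTop
      (𝓝 (∫ a, ∏ v, gumbelLimit (∑ p, c v p * a p + d v) ∂(stdGaussianPi ι))) := by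
  refine tendsto_integral_of_dominated_convergence (fun _ => 1)
    (fun n => (continuous_gumbel n c d).aestronglyMeasurable) (integrable_const 1)
    (fun n => ae_of_all _ fun a => ?_) (ae_of_all _ fun a => ?_)
  · rw [Real.norm_of_nonneg (gumbel_pos _ _ _ _).le]
    exact gumbel_le_one _ _ _ _
  · have : ∀ n : ℕ, gumbel n c d a = ∏ v, Real.exp (-Real.exp (n * (∑ p, c v p * a p + d v))) := by
      intro n
      rw [gumbel, ← Finset.sum_neg_distrib, Real.exp_sum]
      rfl
    simp_rw [this]
    exact tendsto_finsetProd _ fun v _ => tendsto_exp_neg_exp _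

lemma measurable_gumbelLimit : Measurable gumbelLimit :=
  Measurable.ite measurableSet_Ioi measurable_const
    (Measurable.ite (measurableSet_singleton 0) measurable_const measurable_const)

lemma gumbelLimit_mem (x : ℝ) : gumbelLimit x ∈ Set.Icc (0 : ℝ) 1 := by
  unfold gumbelLimit
  split_ifs
  · simp
  · exact ⟨(Real.exp_pos _).le, Real.exp_le_one_iff.2 (by norm_num)⟩
  · simp

/-- **Slepian's inequality**: of two centred Gaussian vectors with the same variances, the one with
the smaller covariances has the larger maximum, also after a deterministic shift `d`. The two
vectors are given as independent linear images of one standard Gaussian vector. -/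
theorem measure_exists_pos_le {L M : V → ι → ℝ} (hLM : ∀ v w, ∑ p, L v p * M w p = 0)
    (hdiag : ∀ v, ∑ p, L v p * L v p = ∑ p, M v p * M v p)
    (hcov : ∀ v w, ∑ p, M v p * M w p ≤ ∑ p, L v p * L w p) (d : V → ℝ) :
    stdGaussianPi ι {a | ∃ v, 0 < ∑ p, L v p * a p + d v} ≤
      stdGaussianPi ι {a | ∃ v, 0 ≤ ∑ p, M v p * a p + d v} := by
  set γ := stdGaussianPi ι
  have hlim := le_of_tendsto_of_tendsto' (tendsto_integral_gumbel M d)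
    (tendsto_integral_gumbel L d) fun n => integral_gumbel_le n d hLM hdiag hcov
  have hform : ∀ (c : V → ι → ℝ) v, Continuous fun a : ι → ℝ => ∑ p, c v p * a p + d v := by
    intro c v; fun_prop
  have hG : ∀ c : V → ι → ℝ,
      Measurable fun a : ι → ℝ => ∏ v, gumbelLimit (∑ p, c v p * a p + d v) := fun c =>
    Finset.measurable_prod _ fun v _ => measurable_gumbelLimit.comp (hform c v).measurable
  have hG01 : ∀ (c : V → ι → ℝ) (a : ι → ℝ),
      ∏ v, gumbelLimit (∑ p, c v p * a p + d v) ∈ Set.Icc (0 : ℝ) 1 := fun c a =>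
    ⟨Finset.prod_nonneg fun v _ => (gumbelLimit_mem _).1,
      Finset.prod_le_one (fun v _ => (gumbelLimit_mem _).1) fun v _ => (gumbelLimit_mem _).2⟩
  have hGi : ∀ c : V → ι → ℝ,
      Integrable (fun a : ι → ℝ => ∏ v, gumbelLimit (∑ p, c v p * a p + d v)) γ := fun c =>
    (integrable_const (1 : ℝ)).mono' (hG c).aestronglyMeasurable (ae_of_all _ fun a => by
      rw [Real.norm_of_nonneg (hG01 c a).1]; exact (hG01 c a).2)
  have hS : MeasurableSet {a : ι → ℝ | ∃ v, 0 < ∑ p, L v p * a p + d v} := by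
    rw [Set.ofPred_exists]
    exact MeasurableSet.iUnion fun v => measurableSet_lt measurable_const (hform L v).measurable
  have hT : MeasurableSet {a : ι → ℝ | ∃ v, 0 ≤ ∑ p, M v p * a p + d v} := by
    rw [Set.ofPred_exists]
    exact MeasurableSet.iUnion fun v => measurableSet_le measurable_const (hform M v).measurable
  have h1 : γ.real {a | ∃ v, 0 ≤ ∑ p, M v p * a p + d v}ᶜ ≤
      ∫ a, ∏ v, gumbelLimit (∑ p, M v p * a p + d v) ∂γ := by
    rw [← integral_indicator_one hT.compl]
    refine integral_mono ((integrable_const 1).indicator hT.compl) (hGi M) fun a => ?_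
    by_cases ha : a ∈ {a : ι → ℝ | ∃ v, 0 ≤ ∑ p, M v p * a p + d v}ᶜ
    · rw [Set.indicator_of_mem ha]
      simp only [Set.mem_compl_iff, Set.mem_ofPred_eq, not_exists, not_le] at ha
      refine le_of_eq (Finset.prod_eq_one fun v _ => ?_).symm
      rw [gumbelLimit, if_neg (ha v).not_gt, if_neg (ha v).ne]
    · rw [Set.indicator_of_notMem ha]
      exact (hG01 M a).1
  have h2 : ∫ a, ∏ v, gumbelLimit (∑ p, L v p * a p + d v) ∂γ ≤
      γ.real {a | ∃ v, 0 < ∑ p, L v p * a p + d v}ᶜ := by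
    rw [← integral_indicator_one hS.compl]
    refine integral_mono (hGi L) ((integrable_const 1).indicator hS.compl) fun a => ?_
    by_cases ha : a ∈ {a : ι → ℝ | ∃ v, 0 < ∑ p, L v p * a p + d v}ᶜ
    · rw [Set.indicator_of_mem ha]
      exact (hG01 L a).2
    · rw [Set.indicator_of_notMem ha]
      simp only [Set.mem_compl_iff, not_not, Set.mem_ofPred_eq] at ha
      obtain ⟨v, hv⟩ := ha
      exact le_of_eq (Finset.prod_eq_zero (Finset.mem_univ v) (by rw [gumbelLimit, if_pos hv]))
  have h3 := h1.trans (hlim.trans h2)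
  rw [probReal_compl_eq_one_sub hT, probReal_compl_eq_one_sub hS, sub_le_sub_iff_left] at h3
  exact (ENNReal.toReal_le_toReal (measure_ne_top _ _) (measure_ne_top _ _)).1 h3

end Comparison

/-! ### Quadratic forms of Gaussian matrices on the sphere -/

section QuadraticForm

/-- A standard Gaussian vector consists of two independent standard Gaussian vectors. -/
lemma measurePreserving_sumPi (α β : Type*) [Fintype α] [Fintype β] :
    MeasurePreserving (fun a : α ⊕ β → ℝ => (fun i => a (Sum.inl i), fun j => a (Sum.inr j)))
      (stdGaussianPi (α ⊕ β)) ((stdGaussianPi α).prod (stdGaussianPi β)) := by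
  have h : MeasurePreserving (MeasurableEquiv.sumPiEquivProdPi fun _ : α ⊕ β => ℝ).symm
      ((stdGaussianPi α).prod (stdGaussianPi β)) (stdGaussianPi (α ⊕ β)) := by
    refine ⟨MeasurableEquiv.measurable _, (Measure.pi_eq fun s hs => ?_).symm⟩
    rw [Measure.map_apply (MeasurableEquiv.measurable _) (MeasurableSet.univ_pi hs)]
    have : (MeasurableEquiv.sumPiEquivProdPi fun _ : α ⊕ β => ℝ).symm ⁻¹' (Set.univ.pi s) =
        (Set.univ.pi fun i => s (Sum.inl i)) ×ˢ (Set.univ.pi fun j => s (Sum.inr j)) := by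
      ext ⟨x, y⟩
      simp [MeasurableEquiv.coe_sumPiEquivProdPi_symm, Set.mem_pi]
    rw [this, Measure.prod_prod, Measure.pi_pi, Measure.pi_pi, Fintype.prod_sum_type]
  exact h.symm

lemma gaussianReal_Ioi_zero : gaussianReal 0 1 (Set.Ioi 0) = 1 / 2 := by
  have h1 : gaussianReal 0 1 (Set.Iio 0) = gaussianReal 0 1 (Set.Ioi 0) := by
    have h := gaussianReal_map_neg (μ := 0) (v := 1)
    rw [neg_zero] at h
    conv_rhs => rw [← h]
    rw [Measure.map_apply measurable_neg measurableSet_Ioi]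
    congr 1
    ext x; simp
  have := nullSingletonClass_gaussianReal (μ := 0) (v := 1) one_ne_zero
  have h2 : gaussianReal 0 1 (Set.Iic 0) + gaussianReal 0 1 (Set.Ioi 0) = 1 := by
    rw [← measure_union (Set.Iic_disjoint_Ioi le_rfl) measurableSet_Ioi, Set.Iic_union_Ioi,
      measure_univ]
  rw [← Iio_ae_eq_Iic.measure_eq, h1, ← two_mul] at h2
  rw [ENNReal.eq_div_iff two_ne_zero ENNReal.ofNat_ne_top, h2]

variable {n : Type*} [Fintype n]

/-- The quadratic form `vᵀ A v` of the matrix with entries `a`. -/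
def quadForm (a : n × n → ℝ) (v : n → ℝ) : ℝ := ∑ p : n × n, v p.1 * v p.2 * a p

lemma continuous_quadForm (v : n → ℝ) : Continuous fun a : n × n → ℝ => quadForm a v := by
  unfold quadForm; fun_prop

lemma continuous_quadForm_right (a : n × n → ℝ) : Continuous fun v : n → ℝ => quadForm a v := by
  unfold quadForm; fun_prop

/-- Slepian's inequality for `± vᵀ A v + ξ` and `√2 g · v`, where `ξ` is an independent standard
Gaussian variable which equalises the variances; restricting to `ξ > 0` removes it again. -/
lemma measure_exists_quadForm_le {V : Type*} [Fintype V] (v : V → n → ℝ)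
    (hv : ∀ x, ∑ i, v x i ^ 2 = 1) {σ : ℝ} (hσ : σ ^ 2 = 1) (d : V → ℝ) :
    stdGaussianPi (n × n) {a | ∃ x, 0 < σ * quadForm a (v x) + d x} ≤
      2 * stdGaussianPi n {g | ∃ x, 0 ≤ ∑ i, √2 * v x i * g i + d x} := by
  set L : V → (n × n) ⊕ (Unit ⊕ n) → ℝ := fun x =>
    Sum.elim (fun p => σ * (v x p.1 * v x p.2)) (Sum.elim (fun _ => 1) fun _ => 0) with hL
  set M : V → (n × n) ⊕ (Unit ⊕ n) → ℝ := fun x =>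
    Sum.elim (fun _ => 0) (Sum.elim (fun _ => 0) fun i => √2 * v x i) with hM
  -- the covariances `⟨v, w⟩² + 1` and `2 ⟨v, w⟩` differ by `(⟨v, w⟩ - 1)²`
  have hLL : ∀ x y, ∑ p, L x p * L y p = (∑ i, v x i * v y i) ^ 2 + 1 := by
    intro x y
    simp only [hL, Fintype.sum_sum_type, Sum.elim_inl, Sum.elim_inr, mul_zero,
      Finset.sum_const_zero, add_zero, Finset.univ_unique, Finset.sum_const, Finset.card_singleton,
      one_smul, mul_one]
    congr 1
    rw [sq, Finset.sum_mul_sum, ← Fintype.sum_prod_type']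
    refine Finset.sum_congr rfl fun p _ => ?_
    linear_combination (v x p.1 * v x p.2 * v y p.1 * v y p.2) * hσ
  have hMM : ∀ x y, ∑ p, M x p * M y p = 2 * ∑ i, v x i * v y i := by
    intro x y
    simp only [hM, Fintype.sum_sum_type, Sum.elim_inl, Sum.elim_inr, mul_zero,
      Finset.sum_const_zero, zero_add, Finset.mul_sum]
    refine Finset.sum_congr rfl fun i _ => ?_
    linear_combination (v x i * v y i) * (Real.sq_sqrt zero_le_two)
  have hslep := measure_exists_pos_le (L := L) (M := M)
    (fun x y => by simp [hL, hM, Fintype.sum_sum_type])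
    (fun x => by
      rw [hLL, hMM]
      have : ∑ i, v x i * v x i = 1 := by rw [← hv x]; exact Finset.sum_congr rfl fun i _ => by ring
      rw [this]; norm_num)
    (fun x y => by
      rw [hLL, hMM]
      nlinarith [sq_nonneg (∑ i, v x i * v y i - 1)]) d
  have mp1 := measurePreserving_sumPi (n × n) (Unit ⊕ n)
  have mp2 := measurePreserving_sumPi Unit n
  -- the event for the matrix together with `ξ > 0`
  have hS : MeasurableSet {a : n × n → ℝ | ∃ x, 0 < σ * quadForm a (v x) + d x} := by
    rw [Set.ofPred_exists]
    refine MeasurableSet.iUnion fun x => measurableSet_lt measurable_const ?_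
    exact (((continuous_quadForm (v x)).const_mul σ).add_const _ |>.measurable)
  have hT : MeasurableSet {g : n → ℝ | ∃ x, 0 ≤ ∑ i, √2 * v x i * g i + d x} := by
    rw [Set.ofPred_exists]
    exact MeasurableSet.iUnion fun x => measurableSet_le measurable_const (by fun_prop)
  have hξ : MeasurableSet {b : Unit ⊕ n → ℝ | 0 < b (Sum.inl ())} :=
    measurableSet_lt measurable_const (measurable_pi_apply _)
  have hξ2 : stdGaussianPi (Unit ⊕ n) {b | 0 < b (Sum.inl ())} = 1 / 2 := by
    rw [← gaussianReal_Ioi_zero]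
    exact (measurePreserving_eval (fun _ : Unit ⊕ n => gaussianReal 0 1)
      (Sum.inl ())).measure_preimage measurableSet_Ioi.nullMeasurableSet
  have hleft : stdGaussianPi (n × n) {a | ∃ x, 0 < σ * quadForm a (v x) + d x} * (1 / 2) ≤
      stdGaussianPi ((n × n) ⊕ (Unit ⊕ n)) {a | ∃ x, 0 < ∑ p, L x p * a p + d x} := by
    rw [← hξ2, ← Measure.prod_prod, ← mp1.measure_preimage (hS.prod hξ).nullMeasurableSet]
    refine measure_mono ?_
    rintro a ⟨⟨x, hx⟩, hx'⟩
    refine ⟨x, ?_⟩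
    simp only [Set.mem_ofPred_eq] at hx'
    simp only [hL, Fintype.sum_sum_type, Sum.elim_inl, Sum.elim_inr, zero_mul,
      Finset.sum_const_zero, add_zero, Finset.univ_unique, Finset.sum_singleton, one_mul]
    have : ∑ p : n × n, σ * (v x p.1 * v x p.2) * a (Sum.inl p) =
        σ * quadForm (fun p => a (Sum.inl p)) (v x) := by
      rw [quadForm, Finset.mul_sum]
      exact Finset.sum_congr rfl fun p _ => by ring
    rw [this]
    have h3 : (default : Unit) = () := rfl
    rw [h3]
    linarith
  have hright : stdGaussianPi ((n × n) ⊕ (Unit ⊕ n)) {a | ∃ x, 0 ≤ ∑ p, M x p * a p + d x} =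
      stdGaussianPi n {g | ∃ x, 0 ≤ ∑ i, √2 * v x i * g i + d x} := by
    have mp3 := measurePreserving_snd.comp (mp2.comp (measurePreserving_snd.comp mp1))
    rw [← mp3.measure_preimage hT.nullMeasurableSet]
    congr 1
    ext a
    simp [hM, Fintype.sum_sum_type]
  rw [hright] at hslep
  have h5 := hleft.trans hslep
  calc stdGaussianPi (n × n) {a | ∃ x, 0 < σ * quadForm a (v x) + d x}
      = 2 * (stdGaussianPi (n × n) {a | ∃ x, 0 < σ * quadForm a (v x) + d x} * (1 / 2)) := by
        rw [mul_comm, mul_assoc, one_div, ENNReal.inv_mul_cancel two_ne_zero ENNReal.ofNat_ne_top,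
          mul_one]
    _ ≤ _ := by gcongr

/-- Comparison of the maxima over the unit sphere of `± vᵀ A v + d(v)` and `√2 g · v + d(v)`. The
sphere is exhausted by finite subsets of a countable dense set. -/
theorem measure_exists_sphere_quadForm_le {σ : ℝ} (hσ : σ ^ 2 = 1) {d : (n → ℝ) → ℝ}
    (hd : Continuous d) :
    stdGaussianPi (n × n) {a | ∃ v : n → ℝ, ∑ i, v i ^ 2 = 1 ∧ 0 < σ * quadForm a v + d v} ≤
      2 * stdGaussianPi n
        {g | ∃ v : n → ℝ, ∑ i, v i ^ 2 = 1 ∧ 0 ≤ ∑ i, √2 * v i * g i + d v} := by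
  by_cases hne : Nonempty {v : n → ℝ // ∑ i, v i ^ 2 = 1}
  swap
  · have : {a | ∃ v : n → ℝ, ∑ i, v i ^ 2 = 1 ∧ 0 < σ * quadForm a v + d v} = ∅ := by
      ext a
      simp only [Set.mem_ofPred_eq, Set.mem_empty_iff_false, iff_false]
      rintro ⟨v, hv, -⟩
      exact hne ⟨⟨v, hv⟩⟩
    rw [this, measure_empty]
    exact zero_le
  set D := TopologicalSpace.denseSeq {v : n → ℝ // ∑ i, v i ^ 2 = 1}
  set s : ℕ → Set (n × n → ℝ) := fun k =>
    {a | ∃ i : Fin k, 0 < σ * quadForm a (D i).1 + d (D i).1} with hs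
  have hmono : Monotone s := by
    rintro k l hkl a ⟨i, hi⟩
    exact ⟨Fin.castLE hkl i, by simpa using hi⟩
  have hU : {a | ∃ v : n → ℝ, ∑ i, v i ^ 2 = 1 ∧ 0 < σ * quadForm a v + d v} = ⋃ k, s k := by
    ext a
    simp only [Set.mem_ofPred_eq, Set.mem_iUnion, hs]
    constructor
    · rintro ⟨v, hv, h⟩
      have hc : Continuous fun w : {v : n → ℝ // ∑ i, v i ^ 2 = 1} =>
          σ * quadForm a w.1 + d w.1 :=
        (((continuous_quadForm_right a).const_mul σ).add hd).comp continuous_subtype_val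
      obtain ⟨i, hi⟩ := (TopologicalSpace.denseRange_denseSeq _).exists_mem_open
        (isOpen_lt continuous_const hc) ⟨⟨v, hv⟩, h⟩
      exact ⟨i + 1, ⟨i, Nat.lt_succ_self i⟩, hi⟩
    · rintro ⟨k, i, hi⟩
      exact ⟨_, (D i).2, hi⟩
  rw [hU]
  refine le_of_tendsto' (tendsto_measure_iUnion_atTop hmono) fun k => ?_
  refine (measure_exists_quadForm_le (fun i : Fin k => (D i).1) (fun i => (D i).2) hσ
    fun i => d (D i).1).trans ?_
  refine mul_le_mul_right (measure_mono ?_) 2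
  rintro g ⟨i, hi⟩
  exact ⟨_, (D i).2, hi⟩

end QuadraticForm

/-! ### Operator norms and Gaussian symmetric matrices -/

section OperatorNorm

set_option linter.unusedSectionVars false

variable {n : Type*} [Fintype n] [DecidableEq n]

lemma norm_toLp_sq (x : n → ℝ) : ‖WithLp.toLp 2 x‖ ^ 2 = x ⬝ᵥ x := by
  rw [EuclideanSpace.norm_sq_eq]
  simp [dotProduct, sq]

lemma dotProduct_self_nonneg' (x : n → ℝ) : 0 ≤ x ⬝ᵥ x := by
  rw [← norm_toLp_sq]; positivity

lemma mulVec_dotProduct_mulVec_le (A : Matrix n n ℝ) (x : n → ℝ) :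
    (A *ᵥ x) ⬝ᵥ (A *ᵥ x) ≤ ‖A‖ ^ 2 * (x ⬝ᵥ x) := by
  have h := Matrix.l2_opNorm_mulVec A (WithLp.toLp 2 x)
  rw [← norm_toLp_sq, ← norm_toLp_sq, ← mul_pow]
  exact pow_le_pow_left₀ (norm_nonneg _) h 2

lemma dotProduct_sq_le (x y : n → ℝ) : (x ⬝ᵥ y) ^ 2 ≤ (x ⬝ᵥ x) * (y ⬝ᵥ y) := by
  have := Finset.sum_mul_sq_le_sq_mul_sq Finset.univ x y
  simpa [dotProduct, sq] using this

lemma abs_dotProduct_mulVec_le (A : Matrix n n ℝ) {x y : n → ℝ} (hx : x ⬝ᵥ x = 1)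
    (hy : y ⬝ᵥ y = 1) : |x ⬝ᵥ A *ᵥ y| ≤ ‖A‖ := by
  have h1 := dotProduct_sq_le x (A *ᵥ y)
  have h2 := mulVec_dotProduct_mulVec_le A y
  rw [hx, one_mul] at h1
  rw [hy, mul_one] at h2
  exact abs_le_of_sq_le_sq (h1.trans h2) (norm_nonneg A)

lemma dotProduct_mulVec_comm {A : Matrix n n ℝ} (hA : A.IsSymm) (x y : n → ℝ) :
    x ⬝ᵥ A *ᵥ y = y ⬝ᵥ A *ᵥ x := by
  rw [Matrix.dotProduct_mulVec, ← Matrix.mulVec_transpose, hA.eq, dotProduct_comm]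

/-- The operator norm of a symmetric matrix is controlled by its quadratic form. -/
lemma norm_le_of_abs_dotProduct_mulVec_le {A : Matrix n n ℝ} (hA : A.IsSymm) {t : ℝ} (ht : 0 ≤ t)
    (h : ∀ x, |x ⬝ᵥ A *ᵥ x| ≤ t * (x ⬝ᵥ x)) : ‖A‖ ≤ t := by
  have hxy : ∀ x y, x ⬝ᵥ A *ᵥ y ≤ t * (x ⬝ᵥ x + y ⬝ᵥ y) / 2 := by
    intro x y
    have h1 := (abs_le.1 (h (x + y))).2
    have h2 := (abs_le.1 (h (x - y))).1
    have h3 := dotProduct_mulVec_comm hA x y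
    simp only [Matrix.mulVec_add, Matrix.mulVec_sub, add_dotProduct, sub_dotProduct,
      dotProduct_add, dotProduct_sub, dotProduct_comm y x] at h1 h2
    linarith
  have hsq : ∀ x, (A *ᵥ x) ⬝ᵥ (A *ᵥ x) ≤ t ^ 2 * (x ⬝ᵥ x) := by
    intro x
    -- polarisation at `c A x` and `x`; the optimal choice is `c = 1 / t`
    have h1 : ∀ c : ℝ, c * ((A *ᵥ x) ⬝ᵥ (A *ᵥ x)) ≤
        t * (c ^ 2 * ((A *ᵥ x) ⬝ᵥ (A *ᵥ x)) + x ⬝ᵥ x) / 2 := by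
      intro c
      have := hxy (c • A *ᵥ x) x
      simpa only [smul_dotProduct, dotProduct_smul, smul_eq_mul, ← mul_assoc, ← sq] using this
    rcases ht.eq_or_lt with rfl | ht
    · have := h1 1
      simp at this ⊢
      exact this
    · have h2 := mul_le_mul_of_nonneg_left (h1 t⁻¹) ht.le
      field_simp at h2
      nlinarith
  rw [Matrix.l2_opNorm_def]
  refine ContinuousLinearMap.opNorm_le_bound _ ht fun x => ?_
  have h2 := hsq x.ofLp
  rw [← norm_toLp_sq, ← norm_toLp_sq, ← mul_pow] at h2
  exact (pow_le_pow_iff_left₀ (norm_nonneg _) (by positivity) two_ne_zero).1 h2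

/-- By homogeneity, a quadratic form has to be bounded on unit vectors only. -/
lemma dotProduct_mulVec_le_of_unit {A : Matrix n n ℝ} {c : ℝ}
    (h : ∀ v : n → ℝ, v ⬝ᵥ v = 1 → v ⬝ᵥ A *ᵥ v ≤ c) (x : n → ℝ) :
    x ⬝ᵥ A *ᵥ x ≤ c * (x ⬝ᵥ x) := by
  rcases (dotProduct_self_nonneg' x).eq_or_lt with hx | hx
  · have : x = 0 := dotProduct_self_eq_zero.1 hx.symm
    simp [this]
  · have hs := Real.sq_sqrt hx.le
    have hs0 : 0 < √(x ⬝ᵥ x) := Real.sqrt_pos.2 hx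
    have h1 := h ((√(x ⬝ᵥ x))⁻¹ • x) (by
      simp only [smul_dotProduct, dotProduct_smul, smul_eq_mul]
      field_simp
      exact hs.symm)
    simp only [Matrix.mulVec_smul, smul_dotProduct, dotProduct_smul, smul_eq_mul] at h1
    rw [← mul_assoc, ← sq, inv_pow, hs, inv_mul_le_iff₀ hx] at h1
    linarith

end OperatorNorm

section Wigner

variable {N : ℕ}

/-- The symmetric matrix `(A + Aᵀ) / √(8 N)` built from the matrix `A` of entries `a`. If `a` is a
standard Gaussian vector, then it has the law of `G / √(2 N)` with `G` a GOE matrix. -/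
def wigner (N : ℕ) : (Fin N × Fin N → ℝ) →ₗ[ℝ] Matrix (Fin N) (Fin N) ℝ where
  toFun a := Matrix.of fun i j => (a (i, j) + a (j, i)) / √(8 * N)
  map_add' a b := by ext i j; simp; ring
  map_smul' c a := by ext i j; simp; ring

lemma wigner_apply (a : Fin N × Fin N → ℝ) (i j : Fin N) :
    wigner N a i j = (a (i, j) + a (j, i)) / √(8 * N) := rfl

lemma wigner_isSymm (a : Fin N × Fin N → ℝ) : (wigner N a).IsSymm := by
  ext i j; simp [wigner_apply, add_comm]

lemma contDiff_wigner : ContDiff ℝ 1 (fun a => wigner N a) :=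
  (LinearMap.toContinuousLinearMap (wigner N)).contDiff

@[fun_prop]
lemma continuous_wigner : Continuous (fun a => wigner N a) := contDiff_wigner.continuous

lemma sqrt_eight_mul (N : ℕ) : √(8 * (N : ℝ)) = 2 * √(2 * N) := by
  rw [show (8 : ℝ) * N = 2 ^ 2 * (2 * N) by ring, Real.sqrt_mul (by positivity),
    Real.sqrt_sq zero_le_two]

lemma dotProduct_wigner_mulVec (a : Fin N × Fin N → ℝ) (v : Fin N → ℝ) :
    v ⬝ᵥ wigner N a *ᵥ v = quadForm a v / √(2 * N) := by
  have h1 : v ⬝ᵥ wigner N a *ᵥ v = (∑ p : Fin N × Fin N, v p.1 * v p.2 * a p +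
      ∑ p : Fin N × Fin N, v p.1 * v p.2 * a p.swap) / √(8 * N) := by
    rw [← Finset.sum_add_distrib, Finset.sum_div, Fintype.sum_prod_type]
    simp only [dotProduct, Matrix.mulVec, Finset.mul_sum, wigner_apply, Prod.swap]
    exact Finset.sum_congr rfl fun i _ => Finset.sum_congr rfl fun j _ => by ring
  have h2 : ∑ p : Fin N × Fin N, v p.1 * v p.2 * a p.swap = quadForm a v := by
    rw [quadForm, ← (Equiv.prodComm (Fin N) (Fin N)).sum_comp]
    exact Finset.sum_congr rfl fun p _ => by simp [mul_comm]
  rw [h1, h2, ← quadForm, sqrt_eight_mul]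
  rcases eq_or_ne (√(2 * (N : ℝ))) 0 with h | h
  · simp [h]
  · field_simp; ring

lemma polyGrowth_norm_wigner : PolyGrowth (fun a : Fin N × Fin N → ℝ => ‖wigner N a‖) :=
  ((PolyGrowth.const ‖LinearMap.toContinuousLinearMap (wigner N)‖).mul PolyGrowth.norm).of_le
    fun a => by
      rw [abs_norm, abs_of_nonneg (by positivity)]
      exact (LinearMap.toContinuousLinearMap (wigner N)).le_opNorm a

lemma sum_sq_eq_dotProduct_self {v : Fin N → ℝ} : ∑ i, v i ^ 2 = v ⬝ᵥ v := by
  simp [dotProduct, sq]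

/-- The tail of the norm of a Gaussian symmetric matrix is controlled by the tail of the norm of a
Gaussian vector. -/
lemma measure_lt_norm_wigner_le (hN : 0 < N) {t : ℝ} (ht : 0 ≤ t) :
    stdGaussianPi (Fin N × Fin N) {a | t < ‖wigner N a‖} ≤
      4 * stdGaussianPi (Fin N) {g | t ≤ √((∑ i, g i ^ 2) / N)} := by
  have hN' : (0 : ℝ) < N := by exact_mod_cast hN
  have h2N : 0 < √(2 * (N : ℝ)) := by positivity
  have hone : ∀ σ : ℝ, σ ^ 2 = 1 → stdGaussianPi (Fin N × Fin N)
      {a | ∃ v : Fin N → ℝ, ∑ i, v i ^ 2 = 1 ∧ 0 < σ * quadForm a v + -(t * √(2 * N))} ≤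
      2 * stdGaussianPi (Fin N) {g | t ≤ √((∑ i, g i ^ 2) / N)} := by
    intro σ hσ
    refine (measure_exists_sphere_quadForm_le hσ continuous_const).trans ?_
    refine mul_le_mul_right (measure_mono ?_) 2
    rintro g ⟨v, hv, h⟩
    refine Real.le_sqrt_of_sq_le ?_
    have h1 := Finset.sum_mul_sq_le_sq_mul_sq Finset.univ v g
    rw [hv, one_mul] at h1
    have h3 : ∑ i, √2 * v i * g i = √2 * ∑ i, v i * g i := by
      rw [Finset.mul_sum]; exact Finset.sum_congr rfl fun i _ => by ring
    rw [h3, Real.sqrt_mul zero_le_two] at h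
    have h4 : t * √N ≤ ∑ i, v i * g i := by
      have : 0 ≤ √2 * (∑ i, v i * g i - t * √N) := by linarith
      have := nonneg_of_mul_nonneg_right this (by positivity)
      linarith
    rw [le_div_iff₀ hN']
    calc t ^ 2 * N = (t * √N) ^ 2 := by rw [mul_pow, Real.sq_sqrt hN'.le]
      _ ≤ (∑ i, v i * g i) ^ 2 := pow_le_pow_left₀ (by positivity) h4 2
      _ ≤ _ := h1
  have hsub : {a | t < ‖wigner N a‖} ⊆
      {a | ∃ v : Fin N → ℝ, ∑ i, v i ^ 2 = 1 ∧ 0 < 1 * quadForm a v + -(t * √(2 * N))} ∪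
      {a | ∃ v : Fin N → ℝ, ∑ i, v i ^ 2 = 1 ∧ 0 < (-1) * quadForm a v + -(t * √(2 * N))} := by
    intro a ha
    by_contra hcon
    simp only [Set.mem_union, Set.mem_ofPred_eq, not_or, not_exists, not_and, not_lt] at hcon
    refine absurd ha (not_lt.2 (norm_le_of_abs_dotProduct_mulVec_le (wigner_isSymm a) ht
      fun x => ?_))
    have hunit : ∀ v : Fin N → ℝ, v ⬝ᵥ v = 1 → |v ⬝ᵥ wigner N a *ᵥ v| ≤ t := by
      intro v hv
      rw [← sum_sq_eq_dotProduct_self] at hv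
      rw [dotProduct_wigner_mulVec, abs_div, abs_of_pos h2N, div_le_iff₀ h2N, abs_le]
      have := hcon.1 v hv
      have := hcon.2 v hv
      constructor <;> linarith
    have h1 := dotProduct_mulVec_le_of_unit (fun v hv => (abs_le.1 (hunit v hv)).2) x
    have h2 := dotProduct_mulVec_le_of_unit (A := -wigner N a) (c := t) (fun v hv => by
      rw [Matrix.neg_mulVec, dotProduct_neg]
      exact neg_le.1 (abs_le.1 (hunit v hv)).1) x
    rw [Matrix.neg_mulVec, dotProduct_neg] at h2
    exact abs_le.2 ⟨neg_le.1 h2, h1⟩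
  calc _ ≤ _ := measure_mono hsub
    _ ≤ _ := measure_union_le _ _
    _ ≤ 2 * stdGaussianPi (Fin N) {g | t ≤ √((∑ i, g i ^ 2) / N)} +
        2 * stdGaussianPi (Fin N) {g | t ≤ √((∑ i, g i ^ 2) / N)} :=
      add_le_add (hone 1 (by norm_num)) (hone (-1) (by norm_num))
    _ = _ := by rw [← add_mul]; norm_num

/-- The moments of `|g|² / N`, for `g` a standard Gaussian vector in `ℝ ^ N`, are bounded. -/
lemma integral_sum_sq_div_pow_le (hN : 0 < N) (m : ℕ) :
    ∫ g : Fin N → ℝ, ((∑ i, g i ^ 2) / N) ^ m ∂(stdGaussianPi (Fin N)) ≤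
      ∫ x : ℝ, x ^ (2 * m) ∂(gaussianReal 0 1) := by
  have hN' : (N : ℝ) ≠ 0 := by exact_mod_cast hN.ne'
  have hi : ∀ i : Fin N, Integrable (fun g : Fin N → ℝ => (N : ℝ)⁻¹ * g i ^ (2 * m))
      (stdGaussianPi (Fin N)) := fun i =>
    ((PolyGrowth.const _).mul ((PolyGrowth.eval i).pow _)).integrable (by fun_prop)
  calc ∫ g : Fin N → ℝ, ((∑ i, g i ^ 2) / N) ^ m ∂(stdGaussianPi (Fin N))
      ≤ ∫ g : Fin N → ℝ, ∑ i, (N : ℝ)⁻¹ * g i ^ (2 * m) ∂(stdGaussianPi (Fin N)) := by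
        refine integral_mono (PolyGrowth.integrable ?_ (by fun_prop))
          (integrable_finsetSum _ fun i _ => hi i) fun g => ?_
        · simp_rw [div_eq_mul_inv]
          exact ((PolyGrowth.sum _ fun i _ => (PolyGrowth.eval i).pow 2).mul
            (PolyGrowth.const _)).pow m
        · have := Real.pow_arith_mean_le_arith_mean_pow Finset.univ (fun _ : Fin N => (N : ℝ)⁻¹)
            (fun i => g i ^ 2) (fun _ _ => by positivity) (by simp [hN']) (fun _ _ => sq_nonneg _) m
          simp only [← pow_mul, ← Finset.mul_sum] at this ⊢
          rw [div_eq_inv_mul]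
          exact this
    _ = ∑ i : Fin N, (N : ℝ)⁻¹ * ∫ x : ℝ, x ^ (2 * m) ∂(gaussianReal 0 1) := by
        rw [integral_finsetSum _ fun i _ => hi i]
        refine Finset.sum_congr rfl fun i _ => ?_
        rw [integral_const_mul]
        congr 1
        have h := (measurePreserving_eval (fun _ : Fin N => gaussianReal 0 1) i)
        have h2 := integral_map (μ := stdGaussianPi (Fin N)) (f := fun x : ℝ => x ^ (2 * m))
          h.measurable.aemeasurable (by fun_prop)
        rw [h.map_eq] at h2
        exact h2.symm
    _ = _ := by simp [hN']

/-- All moments of the norm of a Gaussian symmetric matrix are bounded in the dimension. -/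
theorem exists_integral_norm_wigner_pow_le (m : ℕ) :
    ∃ C : ℝ, 0 ≤ C ∧ ∀ N : ℕ, 0 < N →
      ∫ a, ‖wigner N a‖ ^ (2 * m) ∂(stdGaussianPi (Fin N × Fin N)) ≤ C := by
  rcases Nat.eq_zero_or_pos m with rfl | hm
  · exact ⟨1, zero_le_one, fun N _ => by simp⟩
  refine ⟨4 * ∫ x : ℝ, x ^ (2 * m) ∂(gaussianReal 0 1), ?_, fun N hN => ?_⟩
  · have : 0 ≤ ∫ x : ℝ, x ^ (2 * m) ∂(gaussianReal 0 1) :=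
      integral_nonneg fun x => (even_two_mul m).pow_nonneg x
    positivity
  have hp : (0 : ℝ) < (2 * m : ℕ) := by exact_mod_cast (by omega : 0 < 2 * m)
  -- both moments as integrals of tail probabilities
  have hw := lintegral_rpow_eq_lintegral_meas_lt_mul (stdGaussianPi (Fin N × Fin N))
    (f := fun a => ‖wigner N a‖) (ae_of_all _ fun a => norm_nonneg _)
    (Continuous.aemeasurable (by fun_prop)) hp
  have hg := lintegral_rpow_eq_lintegral_meas_le_mul (stdGaussianPi (Fin N))
    (f := fun g => √((∑ i, g i ^ 2) / N)) (ae_of_all _ fun a => Real.sqrt_nonneg _)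
    (Continuous.aemeasurable (by fun_prop)) hp
  have hle : ∫⁻ a, ENNReal.ofReal (‖wigner N a‖ ^ ((2 * m : ℕ) : ℝ))
      ∂(stdGaussianPi (Fin N × Fin N)) ≤
      4 * ∫⁻ g, ENNReal.ofReal (√((∑ i, g i ^ 2) / N) ^ ((2 * m : ℕ) : ℝ))
      ∂(stdGaussianPi (Fin N)) := by
    rw [hw, hg, mul_left_comm]
    gcongr
    rw [← lintegral_const_mul' _ _ ENNReal.ofNat_ne_top]
    refine setLIntegral_mono' measurableSet_Ioi fun t ht => ?_
    rw [← mul_assoc]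
    gcongr
    exact measure_lt_norm_wigner_le hN (le_of_lt ht)
  have hsq : ∀ g : Fin N → ℝ, √((∑ i, g i ^ 2) / N) ^ ((2 * m : ℕ) : ℝ) =
      ((∑ i, g i ^ 2) / N) ^ m := by
    intro g
    rw [Real.rpow_natCast, pow_mul, Real.sq_sqrt (by positivity)]
  simp_rw [hsq, Real.rpow_natCast] at hle
  have hgi : Integrable (fun g : Fin N → ℝ => ((∑ i, g i ^ 2) / N) ^ m)
      (stdGaussianPi (Fin N)) := by
    refine PolyGrowth.integrable ?_ (by fun_prop)
    simp_rw [div_eq_mul_inv]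
    exact ((PolyGrowth.sum _ fun i _ => (PolyGrowth.eval i).pow 2).mul (PolyGrowth.const _)).pow m
  rw [← ofReal_integral_eq_lintegral_ofReal
      ((polyGrowth_norm_wigner.pow _).integrable (by fun_prop))
      (ae_of_all _ fun a => pow_nonneg (norm_nonneg _) _),
    ← ofReal_integral_eq_lintegral_ofReal hgi
      (ae_of_all _ fun g => by simp only [Pi.zero_apply]; positivity),
    show (4 : ENNReal) = ENNReal.ofReal 4 by simp, ← ENNReal.ofReal_mul zero_le_four,
    ENNReal.ofReal_le_ofReal_iff
      (mul_nonneg zero_le_four (integral_nonneg fun g => by positivity))] at hle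
  have := integral_sum_sq_div_pow_le hN m
  linarith

end Wigner

/-! ### Chebyshev polynomials of a Gaussian symmetric matrix -/

section Chebyshev

set_option linter.unusedSectionVars false

/-- The Chebyshev polynomials of the second kind with shifted index: `chebSeq x (k + 1) = U_k(x)`
and `chebSeq x 0 = 0`, so that `chebSeq (cos θ) k * sin θ = sin (k θ)`. -/
def chebSeq {R : Type*} [Ring R] (x : R) : ℕ → R
  | 0 => 0
  | 1 => 1
  | k + 2 => 2 * (x * chebSeq x (k + 1)) - chebSeq x k

section Ring

variable {R : Type*} [Ring R] (x : R)

@[simp] lemma chebSeq_zero : chebSeq x 0 = 0 := by simp [chebSeq]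
@[simp] lemma chebSeq_one : chebSeq x 1 = 1 := by simp [chebSeq]
lemma chebSeq_add_two (k : ℕ) :
    chebSeq x (k + 2) = 2 * (x * chebSeq x (k + 1)) - chebSeq x k := by
  rw [chebSeq]

lemma two_mul_mul_chebSeq (k : ℕ) :
    2 * (x * chebSeq x (k + 1)) = chebSeq x (k + 2) + chebSeq x k := by
  rw [chebSeq_add_two]; abel

lemma map_chebSeq {S : Type*} [Ring S] (f : R →+* S) (k : ℕ) :
    f (chebSeq x k) = chebSeq (f x) k := by
  induction k using Nat.twoStepInduction with
  | zero => simp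
  | one => simp
  | more k h1 h2 => simp [chebSeq_add_two, h1, h2, map_ofNat]

lemma commute_chebSeq (k : ℕ) : Commute x (chebSeq x k) := by
  induction k using Nat.twoStepInduction with
  | zero => simp
  | one => simp
  | more k h1 h2 =>
    rw [chebSeq_add_two]
    exact (((Nat.cast_commute 2 x).symm).mul_right ((Commute.refl x).mul_right h2)).sub_right h1

end Ring

variable {n : Type*} [Fintype n] [DecidableEq n]

lemma isSymm_chebSeq {A : Matrix n n ℝ} (hA : A.IsSymm) (k : ℕ) : (chebSeq A k).IsSymm := by
  induction k using Nat.twoStepInduction with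
  | zero => simp [Matrix.IsSymm]
  | one => simp [Matrix.IsSymm]
  | more k h1 h2 =>
    rw [chebSeq_add_two, two_mul]
    refine Matrix.IsSymm.sub (Matrix.IsSymm.add ?_ ?_) h1 <;>
    · rw [Matrix.IsSymm, Matrix.transpose_mul, h2.eq, hA.eq]
      exact (commute_chebSeq A (k + 1)).symm

lemma norm_one_le : ‖(1 : Matrix n n ℝ)‖ ≤ 1 :=
  norm_le_of_abs_dotProduct_mulVec_le Matrix.isSymm_one zero_le_one fun x => by
    simp [abs_of_nonneg (dotProduct_self_nonneg' x)]

lemma norm_chebSeq_le (A : Matrix n n ℝ) (k : ℕ) : ‖chebSeq A k‖ ≤ (2 * ‖A‖ + 1) ^ k := by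
  have hA := norm_nonneg A
  induction k using Nat.twoStepInduction with
  | zero => simp
  | one => simpa using norm_one_le.trans (by linarith : (1 : ℝ) ≤ 2 * ‖A‖ + 1)
  | more k h1 h2 =>
    have h3 : ‖A * chebSeq A (k + 1)‖ ≤ ‖A‖ * (2 * ‖A‖ + 1) ^ (k + 1) :=
      (norm_mul_le _ _).trans (by gcongr)
    have h4 : (2 * ‖A‖ + 1) ^ k ≤ (2 * ‖A‖ + 1) ^ (k + 1) :=
      pow_le_pow_right₀ (by linarith) (Nat.le_succ k)
    rw [chebSeq_add_two, two_mul]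
    calc _ ≤ ‖A * chebSeq A (k + 1)‖ + ‖A * chebSeq A (k + 1)‖ + ‖chebSeq A k‖ :=
          (norm_sub_le _ _).trans (by gcongr; exact norm_add_le _ _)
      _ ≤ _ := by rw [pow_succ _ (k + 1)]; nlinarith

/-- The derivative of `A ↦ U_{k-1}(A)`: the noncommutative version of the identity for the divided
differences of the Chebyshev polynomials. -/
lemma hasDerivAt_chebSeq (A H : Matrix n n ℝ) (k : ℕ) :
    HasDerivAt (fun t : ℝ => chebSeq (A + t • H) k)
      (2 * ∑ p ∈ antidiagonal k, chebSeq A p.1 * H * chebSeq A p.2) 0 := by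
  induction k using Nat.twoStepInduction with
  | zero => simpa using hasDerivAt_const (0 : ℝ) (0 : Matrix n n ℝ)
  | one =>
    simpa [Finset.Nat.sum_antidiagonal_succ] using hasDerivAt_const (0 : ℝ) (1 : Matrix n n ℝ)
  | more k h1 h2 =>
    have hA : HasDerivAt (fun t : ℝ => A + t • H) H 0 := by
      simpa using ((hasDerivAt_id (0 : ℝ)).smul_const H).const_add A
    have h3 := ((hA.mul h2).const_mul 2).sub h1
    simp only [chebSeq_add_two]
    convert! h3 using 1
    simp only [zero_smul, add_zero]
    have e1 : ∑ p ∈ antidiagonal (k + 2), chebSeq A p.1 * H * chebSeq A p.2 =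
        ∑ p ∈ antidiagonal (k + 1), chebSeq A (p.1 + 1) * H * chebSeq A p.2 := by
      rw [Finset.Nat.sum_antidiagonal_succ]
      simp
    have e2 : ∑ p ∈ antidiagonal (k + 1), chebSeq A (p.1 + 1) * H * chebSeq A p.2 =
        H * chebSeq A (k + 1) +
        ∑ p ∈ antidiagonal k, chebSeq A (p.1 + 2) * H * chebSeq A p.2 := by
      rw [Finset.Nat.sum_antidiagonal_succ]
      simp
    have e3 : ∑ p ∈ antidiagonal (k + 1), chebSeq A p.1 * H * chebSeq A p.2 =
        ∑ p ∈ antidiagonal k, chebSeq A (p.1 + 1) * H * chebSeq A p.2 := by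
      rw [Finset.Nat.sum_antidiagonal_succ]
      simp
    rw [e1, e2, e3]
    simp only [chebSeq_add_two, sub_mul, Finset.sum_sub_distrib, mul_sub, mul_add, Finset.mul_sum,
      two_mul, mul_assoc, Finset.sum_add_distrib, add_mul]
    abel

variable {N : ℕ}

lemma contDiff_chebSeq_wigner (k : ℕ) : ContDiff ℝ 1 (fun a => chebSeq (wigner N a) k) := by
  induction k using Nat.twoStepInduction with
  | zero => simpa using contDiff_const
  | one => simpa using contDiff_const
  | more k h1 h2 =>
    simp only [chebSeq_add_two]
    exact (contDiff_const.mul (contDiff_wigner.mul h2)).sub h1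

/-- The linear form `M ↦ xᵀ M y`. -/
def sandwich (x y : n → ℝ) : Matrix n n ℝ →L[ℝ] ℝ :=
  LinearMap.toContinuousLinearMap
    { toFun := fun M => x ⬝ᵥ M *ᵥ y
      map_add' := fun A B => by simp [Matrix.add_mulVec]
      map_smul' := fun c A => by simp [Matrix.smul_mulVec] }

lemma sandwich_apply (x y : n → ℝ) (M : Matrix n n ℝ) : sandwich x y M = x ⬝ᵥ M *ᵥ y := rfl

/-- The quadratic form `uᵀ U_{k-1}(W) u`. -/
def chebForm (k : ℕ) (u : Fin N → ℝ) (a : Fin N × Fin N → ℝ) : ℝ :=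
  u ⬝ᵥ chebSeq (wigner N a) k *ᵥ u

/-- The normalised trace of `U_{k-1}(W)`. -/
def chebTrace (k : ℕ) (a : Fin N × Fin N → ℝ) : ℝ := (chebSeq (wigner N a) k).trace / N

lemma contDiff_chebForm (k : ℕ) (u : Fin N → ℝ) : ContDiff ℝ 1 (chebForm k u) :=
  (sandwich u u).contDiff.comp (contDiff_chebSeq_wigner k)

@[fun_prop]
lemma continuous_chebForm (k : ℕ) (u : Fin N → ℝ) : Continuous (chebForm k u) :=
  (contDiff_chebForm k u).continuous

lemma chebTrace_eq_sum (k : ℕ) (a : Fin N × Fin N → ℝ) :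
    chebTrace k a = ∑ i, (N : ℝ)⁻¹ * chebForm k (Pi.single i 1) a := by
  simp [chebTrace, chebForm, Matrix.trace, div_eq_inv_mul, Finset.mul_sum]

@[fun_prop]
lemma continuous_chebTrace (k : ℕ) : Continuous (chebTrace (N := N) k) := by
  have : chebTrace (N := N) k = fun a => ∑ i, (N : ℝ)⁻¹ * chebForm k (Pi.single i 1) a :=
    funext fun a => chebTrace_eq_sum k a
  rw [this]
  fun_prop

lemma abs_chebForm_le (k : ℕ) {u : Fin N → ℝ} (hu : u ⬝ᵥ u = 1) (a : Fin N × Fin N → ℝ) :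
    |chebForm k u a| ≤ (2 * ‖wigner N a‖ + 1) ^ k :=
  (abs_dotProduct_mulVec_le _ hu hu).trans (norm_chebSeq_le _ _)

lemma polyGrowth_two_mul_norm_wigner_add_one_pow (k : ℕ) :
    PolyGrowth (fun a : Fin N × Fin N → ℝ => (2 * ‖wigner N a‖ + 1) ^ k) :=
  (((PolyGrowth.const 2).mul polyGrowth_norm_wigner).add (PolyGrowth.const 1)).pow k

lemma polyGrowth_chebForm (k : ℕ) {u : Fin N → ℝ} (hu : u ⬝ᵥ u = 1) :
    PolyGrowth (chebForm k u) :=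
  (polyGrowth_two_mul_norm_wigner_add_one_pow k).of_le fun a =>
    (abs_chebForm_le k hu a).trans (le_abs_self _)

lemma dotProduct_single_self (i : Fin N) :
    (Pi.single i 1 : Fin N → ℝ) ⬝ᵥ Pi.single i 1 = 1 := by simp

lemma polyGrowth_chebTrace (k : ℕ) : PolyGrowth (chebTrace (N := N) k) := by
  have : chebTrace (N := N) k = fun a => ∑ i, (N : ℝ)⁻¹ * chebForm k (Pi.single i 1) a :=
    funext fun a => chebTrace_eq_sum k a
  rw [this]
  exact PolyGrowth.sum _ fun i _ => (PolyGrowth.const _).mul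
    (polyGrowth_chebForm k (dotProduct_single_self i))

lemma exists_integral_two_mul_norm_add_one_pow_le (m : ℕ) :
    ∃ C : ℝ, 0 ≤ C ∧ ∀ N : ℕ, 0 < N →
      ∫ a, (2 * ‖wigner N a‖ + 1) ^ (2 * m) ∂(stdGaussianPi (Fin N × Fin N)) ≤ C := by
  obtain ⟨C, hC, h⟩ := exists_integral_norm_wigner_pow_le m
  refine ⟨2 ^ (2 * m) * (2 ^ (2 * m) * C + 1), by positivity, fun N hN => ?_⟩
  have hi : Integrable (fun a => ‖wigner N a‖ ^ (2 * m)) (stdGaussianPi (Fin N × Fin N)) :=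
    (polyGrowth_norm_wigner.pow _).integrable (by fun_prop)
  have hi' : Integrable (fun a => 2 ^ (2 * m) * (2 ^ (2 * m) * ‖wigner N a‖ ^ (2 * m) + 1))
      (stdGaussianPi (Fin N × Fin N)) := ((hi.const_mul _).add (integrable_const 1)).const_mul _
  calc _ ≤ ∫ a, 2 ^ (2 * m) * (2 ^ (2 * m) * ‖wigner N a‖ ^ (2 * m) + 1)
        ∂(stdGaussianPi (Fin N × Fin N)) := by
        refine integral_mono ((polyGrowth_two_mul_norm_wigner_add_one_pow _).integrable
          (by fun_prop)) hi' fun a => ?_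
        have h1 := add_pow_le (a := 2 * ‖wigner N a‖) (b := 1) (by positivity) zero_le_one (2 * m)
        refine h1.trans ?_
        rw [mul_pow, one_pow]
        gcongr
        · norm_num
        · omega
    _ ≤ _ := by
        rw [integral_const_mul, integral_add (hi.const_mul _) (integrable_const 1),
          integral_const_mul]
        simp only [integral_const, probReal_univ, smul_eq_mul, mul_one]
        gcongr
        exact h N hN

end Chebyshev

section MomentBounds

variable {N : ℕ}

lemma abs_dotProduct_wigner_mulVec_le (h : Fin N × Fin N → ℝ) (x : Fin N → ℝ) :
    |x ⬝ᵥ wigner N h *ᵥ x| ≤ √(∑ p, h p ^ 2) / √(2 * N) * (x ⬝ᵥ x) := by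
  rw [dotProduct_wigner_mulVec, abs_div, abs_of_nonneg (Real.sqrt_nonneg (2 * (N : ℝ))),
    div_mul_eq_mul_div]
  gcongr
  have h1 := Finset.sum_mul_sq_le_sq_mul_sq Finset.univ
    (fun p : Fin N × Fin N => x p.1 * x p.2) h
  have h2 : ∑ p : Fin N × Fin N, (x p.1 * x p.2) ^ 2 = (x ⬝ᵥ x) ^ 2 := by
    rw [dotProduct, sq, Finset.sum_mul_sum, ← Fintype.sum_prod_type']
    exact Finset.sum_congr rfl fun p _ => by ring
  rw [h2] at h1
  refine abs_le_of_sq_le_sq ?_ (mul_nonneg (Real.sqrt_nonneg _) (dotProduct_self_nonneg' x))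
  rw [mul_pow, Real.sq_sqrt (Finset.sum_nonneg fun p _ => sq_nonneg _), mul_comm]
  exact h1

lemma norm_wigner_le (h : Fin N × Fin N → ℝ) :
    ‖wigner N h‖ ≤ √(∑ p, h p ^ 2) / √(2 * N) :=
  norm_le_of_abs_dotProduct_mulVec_le (wigner_isSymm h) (by positivity)
    (abs_dotProduct_wigner_mulVec_le h)

lemma fderiv_chebForm (k : ℕ) (u : Fin N → ℝ) (a h : Fin N × Fin N → ℝ) :
    fderiv ℝ (chebForm k u) a h = u ⬝ᵥ (2 * ∑ p ∈ antidiagonal k,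
      chebSeq (wigner N a) p.1 * wigner N h * chebSeq (wigner N a) p.2) *ᵥ u := by
  have h1 : HasDerivAt (fun t : ℝ => a + t • h) h 0 := by
    simpa using ((hasDerivAt_id (0 : ℝ)).smul_const h).const_add a
  have h2 := ((contDiff_chebForm k u).differentiable one_ne_zero (a + (0 : ℝ) • h)).hasFDerivAt
    |>.comp_hasDerivAt 0 h1
  have h3 := (sandwich u u).hasFDerivAt.comp_hasDerivAt 0
    (hasDerivAt_chebSeq (wigner N a) (wigner N h) k)
  have h4 : (chebForm k u) ∘ (fun t : ℝ => a + t • h) =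
      (sandwich u u) ∘ fun t : ℝ => chebSeq (wigner N a + t • wigner N h) k := by
    ext t
    simp [chebForm, sandwich_apply]
  rw [h4] at h2
  have h5 := h2.unique h3
  simpa [sandwich_apply] using h5

lemma abs_fderiv_chebForm_le (k : ℕ) {u : Fin N → ℝ} (hu : u ⬝ᵥ u = 1)
    (a h : Fin N × Fin N → ℝ) :
    |fderiv ℝ (chebForm k u) a h| ≤
      2 * (k + 1) / √(2 * N) * (2 * ‖wigner N a‖ + 1) ^ k * √(∑ p, h p ^ 2) := by
  rw [fderiv_chebForm]
  refine (abs_dotProduct_mulVec_le _ hu hu).trans ?_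
  have h1 : ∀ p ∈ antidiagonal k,
      ‖chebSeq (wigner N a) p.1 * wigner N h * chebSeq (wigner N a) p.2‖ ≤
      (2 * ‖wigner N a‖ + 1) ^ k * (√(∑ p, h p ^ 2) / √(2 * N)) := by
    intro p hp
    rw [Finset.HasAntidiagonal.mem_antidiagonal] at hp
    calc _ ≤ ‖chebSeq (wigner N a) p.1‖ * ‖wigner N h‖ * ‖chebSeq (wigner N a) p.2‖ :=
          (norm_mul_le _ _).trans (by gcongr; exact norm_mul_le _ _)
      _ ≤ (2 * ‖wigner N a‖ + 1) ^ p.1 * (√(∑ p, h p ^ 2) / √(2 * N)) *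
          (2 * ‖wigner N a‖ + 1) ^ p.2 := by
          gcongr
          · exact norm_chebSeq_le _ _
          · exact norm_wigner_le h
          · exact norm_chebSeq_le _ _
      _ = _ := by rw [← hp, pow_add]; ring
  have h2 : ‖∑ p ∈ antidiagonal k,
      chebSeq (wigner N a) p.1 * wigner N h * chebSeq (wigner N a) p.2‖ ≤
      (k + 1) * ((2 * ‖wigner N a‖ + 1) ^ k * (√(∑ p, h p ^ 2) / √(2 * N))) := by
    refine (norm_sum_le_of_le _ h1).trans (le_of_eq ?_)
    rw [Finset.sum_const, Finset.Nat.card_antidiagonal, nsmul_eq_mul]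
    push_cast; ring
  rw [two_mul]
  refine (norm_add_le _ _).trans ((add_le_add h2 h2).trans (le_of_eq ?_))
  ring

/-- The fluctuations of `uᵀ U_{k-1}(W) u` are of order `N ^ (-1/2)`: its gradient is of this order,
up to a power of the norm of `W`, all of whose moments are bounded. -/
lemma exists_integral_chebForm_sub_pow_four_le (k : ℕ) : ∃ C : ℝ, 0 ≤ C ∧ ∀ N : ℕ, 0 < N →
    ∀ u : Fin N → ℝ, u ⬝ᵥ u = 1 →
      ∫ a, (chebForm k u a - ∫ b, chebForm k u b ∂(stdGaussianPi (Fin N × Fin N))) ^ 4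
        ∂(stdGaussianPi (Fin N × Fin N)) ≤ C / N ^ 2 := by
  obtain ⟨C, hC, h⟩ := exists_integral_two_mul_norm_add_one_pow_le (2 * k)
  refine ⟨3 * (Real.pi / 2) ^ 4 * ((2 * (k + 1)) ^ 4 / 4 * C), by positivity,
    fun N hN u hu => ?_⟩
  have hN' : (0 : ℝ) < N := by exact_mod_cast hN
  refine (integral_sub_integral_pow_four_le (contDiff_chebForm k u) (polyGrowth_chebForm k hu)
    (K := fun a => 2 * (k + 1) / √(2 * N) * (2 * ‖wigner N a‖ + 1) ^ k)
    (fun a => by positivity) (by fun_prop)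
    ((PolyGrowth.const _).mul (polyGrowth_two_mul_norm_wigner_add_one_pow k))
    (abs_fderiv_chebForm_le k hu)).trans ?_
  have h1 : √(2 * (N : ℝ)) ^ 4 = 4 * N ^ 2 := by
    rw [show 4 = 2 * 2 from rfl, pow_mul, Real.sq_sqrt (by positivity)]; ring
  simp_rw [mul_pow (_ / _), ← pow_mul, div_pow, h1, integral_const_mul]
  have h2 := h N hN
  rw [show 2 * (2 * k) = k * 4 by ring] at h2
  rw [mul_div_assoc]
  gcongr
  calc _ ≤ (2 * ((k : ℝ) + 1)) ^ 4 / (4 * N ^ 2) * C := by gcongr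
    _ = _ := by field_simp

/-! #### The Schwinger–Dyson equation -/

lemma wigner_single (i j : Fin N) : wigner N (Pi.single (i, j) 1) =
    (√(8 * N))⁻¹ • (Matrix.single i j 1 + Matrix.single j i 1) := by
  ext k l
  simp only [wigner_apply, Pi.single_apply, Prod.mk.injEq, Matrix.smul_apply, Matrix.add_apply,
    Matrix.single_apply, smul_eq_mul, div_eq_inv_mul, eq_comm (a := k), eq_comm (a := l),
    and_comm (a := j = k)]

lemma mul_wigner_single_mulVec (V : Matrix (Fin N) (Fin N) ℝ) (x : Fin N → ℝ) (i j l : Fin N) :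
    ((V * wigner N (Pi.single (i, j) 1)) *ᵥ x) l =
      (√(8 * N))⁻¹ * (V l i * x j + V l j * x i) := by
  have h : ∀ i j : Fin N, Matrix.single i j (1 : ℝ) *ᵥ x = x j • Pi.single i 1 := by
    intro i j
    ext l
    simp [Matrix.single_mulVec, Function.update_apply, Pi.single_apply]
  rw [wigner_single, Matrix.mul_smul, Matrix.smul_mulVec, mul_add, Matrix.add_mulVec,
    ← Matrix.mulVec_mulVec, ← Matrix.mulVec_mulVec, h, h, Matrix.mulVec_smul, Matrix.mulVec_smul,
    Matrix.mulVec_single_one, Matrix.mulVec_single_one]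
  simp only [Pi.smul_apply, Pi.add_apply, smul_eq_mul, Matrix.col_apply]
  ring

/-- Summation over all the entries of the Gaussian matrix: one of the two ways of contracting the
indices produces the trace of `V`. -/
lemma sum_mul_wigner_single_mulVec {V : Matrix (Fin N) (Fin N) ℝ} (hV : V.IsSymm)
    (u x : Fin N → ℝ) :
    ∑ p : Fin N × Fin N, (u p.1 * ((V * wigner N (Pi.single p 1)) *ᵥ x) p.2 +
      u p.2 * ((V * wigner N (Pi.single p 1)) *ᵥ x) p.1) =
    (√(8 * N))⁻¹ * (2 * (u ⬝ᵥ V *ᵥ x + V.trace * (u ⬝ᵥ x))) := by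
  simp_rw [Fintype.sum_prod_type, mul_wigner_single_mulVec, hV.apply]
  have h1 : u ⬝ᵥ V *ᵥ x = ∑ i, ∑ j, u i * V i j * x j := by
    simp only [dotProduct, Matrix.mulVec, Finset.mul_sum, mul_assoc]
  have h2 : u ⬝ᵥ V *ᵥ x = ∑ i, ∑ j, u j * V i j * x i := by
    rw [h1, Finset.sum_comm]
    simp_rw [hV.apply]
  have h3 : V.trace * (u ⬝ᵥ x) = ∑ i, ∑ j, V j j * u i * x i := by
    rw [Matrix.trace, dotProduct, mul_comm, Finset.sum_mul_sum]
    exact Finset.sum_congr rfl fun i _ => Finset.sum_congr rfl fun j _ => by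
      simp only [Matrix.diag_apply]; ring
  have h4 : V.trace * (u ⬝ᵥ x) = ∑ i, ∑ j, V i i * u j * x j := by rw [h3, Finset.sum_comm]
  have h5 : 2 * (u ⬝ᵥ V *ᵥ x + V.trace * (u ⬝ᵥ x)) =
      (∑ i, ∑ j, u i * V i j * x j) + (∑ i, ∑ j, u j * V i j * x i) +
      (∑ i, ∑ j, V j j * u i * x i) + ∑ i, ∑ j, V i i * u j * x j := by
    rw [← h1, ← h2, ← h3, ← h4]; ring
  rw [h5, ← Finset.sum_add_distrib, ← Finset.sum_add_distrib, ← Finset.sum_add_distrib,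
    Finset.mul_sum]
  refine Finset.sum_congr rfl fun i _ => ?_
  rw [← Finset.sum_add_distrib, ← Finset.sum_add_distrib, ← Finset.sum_add_distrib,
    Finset.mul_sum]
  exact Finset.sum_congr rfl fun j _ => by ring

lemma PolyGrowth.dotProduct_mulVec {n : Type*} [Fintype n] [DecidableEq n] {ι : Type*} [Fintype ι]
    {M : (ι → ℝ) → Matrix n n ℝ} (hM : PolyGrowth fun a => ‖M a‖) (x y : n → ℝ) :
    PolyGrowth fun a => x ⬝ᵥ M a *ᵥ y :=
  ((PolyGrowth.const ‖sandwich x y‖).mul hM).of_le fun a => by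
    rw [← sandwich_apply, abs_of_nonneg (by positivity : 0 ≤ ‖sandwich x y‖ * ‖M a‖)]
    exact (sandwich x y).le_opNorm _

lemma PolyGrowth.norm_mul {n : Type*} [Fintype n] [DecidableEq n] {ι : Type*} [Fintype ι]
    {M M' : (ι → ℝ) → Matrix n n ℝ} (hM : PolyGrowth fun a => ‖M a‖)
    (hM' : PolyGrowth fun a => ‖M' a‖) : PolyGrowth fun a => ‖M a * M' a‖ :=
  (hM.mul hM').of_le fun a => by
    rw [abs_norm, abs_of_nonneg (by positivity : 0 ≤ ‖M a‖ * ‖M' a‖)]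
    exact _root_.norm_mul_le _ _

lemma PolyGrowth.norm_const_matrix {n : Type*} [Fintype n] [DecidableEq n] {ι : Type*} [Fintype ι]
    (M : Matrix n n ℝ) : PolyGrowth fun _ : ι → ℝ => ‖M‖ := PolyGrowth.const _

lemma PolyGrowth.norm_chebSeq_wigner (k : ℕ) :
    PolyGrowth fun a : Fin N × Fin N → ℝ => ‖chebSeq (wigner N a) k‖ :=
  (polyGrowth_two_mul_norm_wigner_add_one_pow k).of_le fun a => by
    rw [abs_norm]; exact (norm_chebSeq_le _ _).trans (le_abs_self _)

@[fun_prop]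
lemma continuous_chebSeq_wigner (k : ℕ) : Continuous fun a => chebSeq (wigner N a) k :=
  (contDiff_chebSeq_wigner k).continuous

lemma continuous_dotProduct_mulVec {n : Type*} [Fintype n] [DecidableEq n] {ι : Type*}
    {M : (ι → ℝ) → Matrix n n ℝ} (hM : Continuous M) (x y : n → ℝ) :
    Continuous fun a => x ⬝ᵥ M a *ᵥ y :=
  (sandwich x y).continuous.comp hM

lemma integrable_dotProduct_chebSeq_mul_mulVec (p q : ℕ) (x y : Fin N → ℝ) :
    Integrable (fun a => x ⬝ᵥ (chebSeq (wigner N a) p * chebSeq (wigner N a) q) *ᵥ y)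
      (stdGaussianPi (Fin N × Fin N)) :=
  ((PolyGrowth.norm_chebSeq_wigner p).norm_mul (PolyGrowth.norm_chebSeq_wigner q)
    |>.dotProduct_mulVec x y).integrable (continuous_dotProduct_mulVec (by fun_prop) x y)

/-- The Schwinger–Dyson equation, obtained by expanding one factor `W` into its entries and integrating
by parts in each of them. -/
lemma integral_dotProduct_wigner_mul_chebSeq (hN : 0 < N) (k : ℕ) {u : Fin N → ℝ}
    (hu : u ⬝ᵥ u = 1) :
    ∫ a, u ⬝ᵥ (2 * (wigner N a * chebSeq (wigner N a) k)) *ᵥ u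
      ∂(stdGaussianPi (Fin N × Fin N)) =
    ∑ p ∈ antidiagonal k, ((N : ℝ)⁻¹ * ∫ a, u ⬝ᵥ (chebSeq (wigner N a) p.1 *
        chebSeq (wigner N a) p.2) *ᵥ u ∂(stdGaussianPi (Fin N × Fin N)) +
      ∫ a, chebTrace p.1 a * chebForm p.2 u a ∂(stdGaussianPi (Fin N × Fin N))) := by
  have hN' : (N : ℝ) ≠ 0 := by exact_mod_cast hN.ne'
  set γ := stdGaussianPi (Fin N × Fin N) with hγ
  set c : ℝ := (√(8 * N))⁻¹ with hc
  have hc2 : c * c = (8 * (N : ℝ))⁻¹ := by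
    rw [hc, ← mul_inv, Real.mul_self_sqrt (by positivity)]
  set e : Fin N → Fin N → ℝ := fun j => Pi.single j 1 with he
  have hent : ∀ (M : Matrix (Fin N) (Fin N) ℝ) (x : Fin N → ℝ) j, (M *ᵥ x) j = e j ⬝ᵥ M *ᵥ x := by
    intro M x j; simp [he]
  -- the coefficient of the entry `a p` in `uᵀ W U_{k-1}(W) u`, and its partial derivative
  set f : Fin N × Fin N → (Fin N × Fin N → ℝ) → ℝ := fun p a =>
    u p.1 * (e p.2 ⬝ᵥ chebSeq (wigner N a) k *ᵥ u) +
    u p.2 * (e p.1 ⬝ᵥ chebSeq (wigner N a) k *ᵥ u) with hf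
  set D : Fin N × Fin N → (Fin N × Fin N → ℝ) → Matrix (Fin N) (Fin N) ℝ := fun p a =>
    ∑ r ∈ antidiagonal k,
      chebSeq (wigner N a) r.1 * wigner N (Pi.single p 1) * chebSeq (wigner N a) r.2 with hD
  set f' : Fin N × Fin N → (Fin N × Fin N → ℝ) → ℝ := fun p a =>
    u p.1 * (e p.2 ⬝ᵥ (2 * D p a) *ᵥ u) + u p.2 * (e p.1 ⬝ᵥ (2 * D p a) *ᵥ u) with hf'
  have hVk := PolyGrowth.norm_chebSeq_wigner (N := N) k
  have hVc : Continuous fun a => chebSeq (wigner N a) k := continuous_chebSeq_wigner k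
  have hDg : ∀ p, PolyGrowth fun a => ‖2 * D p a‖ := by
    intro p
    refine (PolyGrowth.norm_const_matrix 2).norm_mul ?_
    have := PolyGrowth.sum (antidiagonal k) fun r _ =>
      ((PolyGrowth.norm_chebSeq_wigner r.1).norm_mul (PolyGrowth.norm_const_matrix
        (wigner N (Pi.single p 1)))).norm_mul (PolyGrowth.norm_chebSeq_wigner r.2)
    refine this.of_le fun a => ?_
    rw [abs_norm, abs_of_nonneg (Finset.sum_nonneg fun r _ => norm_nonneg _)]
    exact norm_sum_le _ _
  have hDc : ∀ p, Continuous fun a => 2 * D p a := by intro p; fun_prop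
  have hfg : ∀ p, PolyGrowth (f p) := fun p =>
    ((PolyGrowth.const _).mul (hVk.dotProduct_mulVec _ _)).add
      ((PolyGrowth.const _).mul (hVk.dotProduct_mulVec _ _))
  have hfc : ∀ p, Continuous (f p) := fun p =>
    (continuous_const.mul (continuous_dotProduct_mulVec hVc _ _)).add
      (continuous_const.mul (continuous_dotProduct_mulVec hVc _ _))
  have hf'g : ∀ p, PolyGrowth (f' p) := fun p =>
    ((PolyGrowth.const _).mul ((hDg p).dotProduct_mulVec _ _)).add
      ((PolyGrowth.const _).mul ((hDg p).dotProduct_mulVec _ _))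
  have hf'c : ∀ p, Continuous (f' p) := fun p =>
    (continuous_const.mul (continuous_dotProduct_mulVec (hDc p) _ _)).add
      (continuous_const.mul (continuous_dotProduct_mulVec (hDc p) _ _))
  have hfd : ∀ p a, HasDerivAt (fun t : ℝ => f p (a + t • Pi.single p 1)) (f' p a) 0 := by
    intro p a
    have h1 : ∀ x : Fin N → ℝ, HasDerivAt
        (fun t : ℝ => x ⬝ᵥ chebSeq (wigner N (a + t • Pi.single p 1)) k *ᵥ u)
        (x ⬝ᵥ (2 * D p a) *ᵥ u) 0 := by
      intro x
      have := (sandwich x u).hasFDerivAt.comp_hasDerivAt 0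
        (hasDerivAt_chebSeq (wigner N a) (wigner N (Pi.single p 1)) k)
      simpa [Function.comp_def, sandwich_apply, hD] using this
    exact ((h1 _).const_mul _).add ((h1 _).const_mul _)
  have hpf : ∀ p, Integrable (fun a => a p * f p a) γ := fun p =>
    ((PolyGrowth.eval p).mul (hfg p)).integrable ((continuous_apply p).mul (hfc p))
  have hstein : ∀ p, ∫ a, a p * f p a ∂γ = ∫ a, f' p a ∂γ := fun p =>
    integral_eval_mul_eq_integral_deriv p (hfd p) ((hfg p).integrable (hfc p))
      ((hf'g p).integrable (hf'c p)) (hpf p)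
  have hleft : ∀ a, u ⬝ᵥ (2 * (wigner N a * chebSeq (wigner N a) k)) *ᵥ u =
      2 * c * ∑ p, a p * f p a := by
    intro a
    have h1 : u ⬝ᵥ (wigner N a * chebSeq (wigner N a) k) *ᵥ u =
        ∑ i, ∑ j, u i * (a (i, j) + a (j, i)) * c * (e j ⬝ᵥ chebSeq (wigner N a) k *ᵥ u) := by
      rw [← Matrix.mulVec_mulVec]
      simp_rw [← hent]
      rw [dotProduct]
      refine Finset.sum_congr rfl fun i _ => ?_
      rw [Matrix.mulVec, dotProduct, Finset.mul_sum]
      refine Finset.sum_congr rfl fun j _ => ?_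
      rw [wigner_apply, div_eq_mul_inv]
      ring
    have h2 : ∑ p, a p * f p a =
        ∑ i, ∑ j, u i * (a (i, j) + a (j, i)) * (e j ⬝ᵥ chebSeq (wigner N a) k *ᵥ u) := by
      have h3 : ∑ i, ∑ j, a (i, j) * u j * (e i ⬝ᵥ chebSeq (wigner N a) k *ᵥ u) =
          ∑ i, ∑ j, u i * a (j, i) * (e j ⬝ᵥ chebSeq (wigner N a) k *ᵥ u) := by
        rw [Finset.sum_comm]
        exact Finset.sum_congr rfl fun i _ => Finset.sum_congr rfl fun j _ => by ring
      rw [Fintype.sum_prod_type]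
      simp only [hf, mul_add, add_mul, Finset.sum_add_distrib, ← mul_assoc] at h3 ⊢
      rw [h3]
      congr 1
      exact Finset.sum_congr rfl fun i _ => Finset.sum_congr rfl fun j _ => by ring
    rw [two_mul, Matrix.add_mulVec, dotProduct_add, h1, h2, ← two_mul, mul_assoc]
    congr 1
    simp_rw [Finset.mul_sum]
    exact Finset.sum_congr rfl fun i _ => Finset.sum_congr rfl fun j _ => by ring
  have hright : ∀ a, 2 * c * ∑ p, f' p a = ∑ p ∈ antidiagonal k,
      ((N : ℝ)⁻¹ * (u ⬝ᵥ (chebSeq (wigner N a) p.1 * chebSeq (wigner N a) p.2) *ᵥ u) +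
        chebTrace p.1 a * chebForm p.2 u a) := by
    intro a
    have h1 : ∑ p, f' p a = 2 * ∑ r ∈ antidiagonal k, ∑ p : Fin N × Fin N,
        (u p.1 * ((chebSeq (wigner N a) r.1 * wigner N (Pi.single p 1)) *ᵥ
            (chebSeq (wigner N a) r.2 *ᵥ u)) p.2 +
          u p.2 * ((chebSeq (wigner N a) r.1 * wigner N (Pi.single p 1)) *ᵥ
            (chebSeq (wigner N a) r.2 *ᵥ u)) p.1) := by
      rw [Finset.sum_comm, Finset.mul_sum]
      refine Finset.sum_congr rfl fun p _ => ?_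
      simp only [hf']
      rw [← hent (2 * D p a) u p.2, ← hent (2 * D p a) u p.1]
      simp only [hD, two_mul, Matrix.add_mulVec, Pi.add_apply, Matrix.mulVec_mulVec]
      have h2 : ∀ j, ((∑ r ∈ antidiagonal k, chebSeq (wigner N a) r.1 *
          wigner N (Pi.single p 1) * chebSeq (wigner N a) r.2) *ᵥ u) j =
          ∑ r ∈ antidiagonal k, ((chebSeq (wigner N a) r.1 *
          wigner N (Pi.single p 1) * chebSeq (wigner N a) r.2) *ᵥ u) j := by
        intro j
        rw [Matrix.sum_mulVec, Finset.sum_apply]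
      rw [h2, h2, Finset.sum_add_distrib, ← Finset.mul_sum, ← Finset.mul_sum]
      ring
    simp_rw [h1, sum_mul_wigner_single_mulVec (isSymm_chebSeq (wigner_isSymm a) _), ← hc,
      Matrix.mulVec_mulVec]
    rw [Finset.mul_sum, Finset.mul_sum]
    refine Finset.sum_congr rfl fun r _ => ?_
    rw [chebTrace, chebForm]
    have h3 : 8 * (N : ℝ) * (c * c) = 1 := by
      rw [hc2]; exact mul_inv_cancel₀ (by positivity)
    field_simp
    linear_combination (u ⬝ᵥ (chebSeq (wigner N a) r.1 * chebSeq (wigner N a) r.2) *ᵥ u +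
      (chebSeq (wigner N a) r.1).trace * (u ⬝ᵥ chebSeq (wigner N a) r.2 *ᵥ u)) * h3
  simp_rw [hleft]
  rw [integral_const_mul, integral_finsetSum _ fun p _ => hpf p]
  simp_rw [hstein]
  rw [← integral_finsetSum _ fun p _ => (hf'g p).integrable (hf'c p), ← integral_const_mul]
  simp_rw [hright]
  have hi1 : ∀ p : ℕ × ℕ, Integrable (fun a => (N : ℝ)⁻¹ *
      (u ⬝ᵥ (chebSeq (wigner N a) p.1 * chebSeq (wigner N a) p.2) *ᵥ u)) γ := fun p =>
    (integrable_dotProduct_chebSeq_mul_mulVec p.1 p.2 u u).const_mul _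
  have hi2 : ∀ p : ℕ × ℕ, Integrable (fun a => chebTrace p.1 a * chebForm p.2 u a) γ := fun p =>
    ((polyGrowth_chebTrace p.1).mul (polyGrowth_chebForm p.2 hu)).integrable (by fun_prop)
  have hi3 : ∀ p : ℕ × ℕ, Integrable (fun a => (N : ℝ)⁻¹ *
      (u ⬝ᵥ (chebSeq (wigner N a) p.1 * chebSeq (wigner N a) p.2) *ᵥ u) +
      chebTrace p.1 a * chebForm p.2 u a) γ := fun p => (hi1 p).add (hi2 p)
  rw [integral_finsetSum _ fun p _ => hi3 p]
  refine Finset.sum_congr rfl fun p _ => ?_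
  rw [integral_add (hi1 p) (hi2 p), integral_const_mul]

end MomentBounds

section LimitOfChebForm

variable {N : ℕ}

lemma integral_chebTrace_pow_four_le (hN : 0 < N) {k : ℕ} {B : ℝ}
    (h : ∀ u : Fin N → ℝ, u ⬝ᵥ u = 1 →
      ∫ a, chebForm k u a ^ 4 ∂(stdGaussianPi (Fin N × Fin N)) ≤ B) :
    ∫ a, chebTrace k a ^ 4 ∂(stdGaussianPi (Fin N × Fin N)) ≤ B := by
  have hN' : (N : ℝ) ≠ 0 := by exact_mod_cast hN.ne'
  have hi : ∀ i : Fin N, Integrable (fun a => (N : ℝ)⁻¹ * chebForm k (Pi.single i 1) a ^ 4)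
      (stdGaussianPi (Fin N × Fin N)) := fun i =>
    ((PolyGrowth.const _).mul ((polyGrowth_chebForm k (dotProduct_single_self i)).pow 4)).integrable
      (by fun_prop)
  calc ∫ a, chebTrace k a ^ 4 ∂(stdGaussianPi (Fin N × Fin N))
      ≤ ∫ a, ∑ i, (N : ℝ)⁻¹ * chebForm k (Pi.single i 1) a ^ 4
          ∂(stdGaussianPi (Fin N × Fin N)) := by
        refine integral_mono (((polyGrowth_chebTrace k).pow 4).integrable (by fun_prop))
          (integrable_finsetSum _ fun i _ => hi i) fun a => ?_
        simp only [chebTrace_eq_sum]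
        exact Real.pow_arith_mean_le_arith_mean_pow_of_even Finset.univ (fun _ => (N : ℝ)⁻¹)
          (fun i => chebForm k (Pi.single i 1) a) (fun _ _ => by positivity) (by simp [hN'])
          (by decide)
    _ = ∑ i : Fin N, (N : ℝ)⁻¹ * ∫ a, chebForm k (Pi.single i 1) a ^ 4
          ∂(stdGaussianPi (Fin N × Fin N)) := by
        rw [integral_finsetSum _ fun i _ => hi i]
        simp_rw [integral_const_mul]
    _ ≤ ∑ _i : Fin N, (N : ℝ)⁻¹ * B := by
        gcongr with i
        exact h _ (dotProduct_single_self i)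
    _ = B := by simp [hN']

lemma exists_integral_chebForm_sq_le (k : ℕ) : ∃ C : ℝ, 0 ≤ C ∧ ∀ N : ℕ, 0 < N →
    ∀ u : Fin N → ℝ, u ⬝ᵥ u = 1 →
      ∫ a, chebForm k u a ^ 2 ∂(stdGaussianPi (Fin N × Fin N)) ≤ C := by
  obtain ⟨C, hC, h⟩ := exists_integral_two_mul_norm_add_one_pow_le k
  refine ⟨C, hC, fun N hN u hu => le_trans (integral_mono
    (((polyGrowth_chebForm k hu).pow 2).integrable (by fun_prop))
    ((polyGrowth_two_mul_norm_wigner_add_one_pow _).integrable (by fun_prop)) fun a => ?_) (h N hN)⟩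
  simp only
  rw [mul_comm 2 k, pow_mul]
  exact sq_le_sq' (by linarith [(abs_le.1 (abs_chebForm_le k hu a)).1])
    (abs_le.1 (abs_chebForm_le k hu a)).2

lemma exists_abs_integral_chebSeq_mul_le (p q : ℕ) : ∃ C : ℝ, 0 ≤ C ∧ ∀ N : ℕ, 0 < N →
    ∀ u : Fin N → ℝ, u ⬝ᵥ u = 1 →
      |∫ a, u ⬝ᵥ (chebSeq (wigner N a) p * chebSeq (wigner N a) q) *ᵥ u
        ∂(stdGaussianPi (Fin N × Fin N))| ≤ C := by
  obtain ⟨C, hC, h⟩ := exists_integral_two_mul_norm_add_one_pow_le (p + q)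
  refine ⟨C, hC, fun N hN u hu => le_trans (abs_integral_le_integral_abs) (le_trans (integral_mono
    (integrable_dotProduct_chebSeq_mul_mulVec p q u u).abs
    ((polyGrowth_two_mul_norm_wigner_add_one_pow _).integrable (by fun_prop)) fun a => ?_) (h N hN))⟩
  have h0 : 1 ≤ 2 * ‖wigner N a‖ + 1 := by linarith [norm_nonneg (wigner N a)]
  calc _ ≤ ‖chebSeq (wigner N a) p * chebSeq (wigner N a) q‖ := abs_dotProduct_mulVec_le _ hu hu
    _ ≤ (2 * ‖wigner N a‖ + 1) ^ p * (2 * ‖wigner N a‖ + 1) ^ q :=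
      (norm_mul_le _ _).trans (mul_le_mul (norm_chebSeq_le _ _) (norm_chebSeq_le _ _)
        (norm_nonneg _) (by positivity))
    _ ≤ _ := by
      rw [← pow_add]
      exact pow_le_pow_right₀ h0 (by omega)

/-- The quadratic form `X_k = uᵀ U_{k-1}(W) u`, `k ≥ 2`, is of order `N ^ (-1/2)`. With `t_p` the
normalised trace of `U_{p-1}(W)`, the Schwinger–Dyson equation reads
`E X_{m+2} + E X_m = ∑_{p + q = m + 1} E (t_p X_q) + O(1 / N)`. As `t_1 = 1`, the pair `(1, m)`
contributes exactly `E X_m`; the other pairs have `p = 0`, hence vanish, or `2 ≤ p < m + 2`, where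
`t_p` is small by induction. -/
theorem exists_integral_chebForm_pow_four_le (k : ℕ) (hk : 2 ≤ k) : ∃ C : ℝ, 0 ≤ C ∧
    ∀ N : ℕ, 0 < N → ∀ u : Fin N → ℝ, u ⬝ᵥ u = 1 →
      ∫ a, chebForm k u a ^ 4 ∂(stdGaussianPi (Fin N × Fin N)) ≤ C / N ^ 2 := by
  induction k using Nat.strong_induction_on with
  | _ k ih =>
  obtain ⟨m, rfl⟩ : ∃ m, k = m + 2 := ⟨k - 2, by omega⟩
  -- the contribution of the pair `p` to the Schwinger–Dyson equation, apart from the main term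
  have hpair : ∀ p ∈ antidiagonal (m + 1), ∃ C : ℝ, 0 ≤ C ∧ ∀ N : ℕ, 0 < N →
      ∀ u : Fin N → ℝ, u ⬝ᵥ u = 1 →
      |∫ a, chebTrace p.1 a * chebForm p.2 u a ∂(stdGaussianPi (Fin N × Fin N)) -
        if p = (1, m) then ∫ a, chebForm m u a ∂(stdGaussianPi (Fin N × Fin N)) else 0| ≤
      C / √N := by
    rintro ⟨p, q⟩ hpq
    rw [Finset.HasAntidiagonal.mem_antidiagonal] at hpq
    simp only at hpq ⊢
    rcases p with _ | _ | p
    · exact ⟨0, le_rfl, fun N hN u hu => by simp [chebTrace]⟩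
    · obtain rfl : q = m := by omega
      refine ⟨0, le_rfl, fun N hN u hu => ?_⟩
      have hN' : (N : ℝ) ≠ 0 := by exact_mod_cast hN.ne'
      simp [chebTrace, hN']
    · obtain ⟨C, hC, h⟩ := ih (p + 2) (by omega) (by omega)
      obtain ⟨D, hD, h'⟩ := exists_integral_chebForm_sq_le q
      refine ⟨1 + C + D, by positivity, fun N hN u hu => ?_⟩
      have hN' : (0 : ℝ) < N := by exact_mod_cast hN
      have hs : 0 < √(N : ℝ) := Real.sqrt_pos.2 hN'
      have hs2 : √(N : ℝ) ^ 2 = N := Real.sq_sqrt hN'.le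
      rw [if_neg (by simp), sub_zero]
      have ht := integral_chebTrace_pow_four_le hN (h N hN)
      have hx := h' N hN u hu
      have hti : Integrable (fun a => chebTrace (p + 2) a ^ 4) (stdGaussianPi (Fin N × Fin N)) :=
        ((polyGrowth_chebTrace _).pow 4).integrable (by fun_prop)
      have hxi : Integrable (fun a => chebForm q u a ^ 2) (stdGaussianPi (Fin N × Fin N)) :=
        ((polyGrowth_chebForm q hu).pow 2).integrable (by fun_prop)
      -- `|t x| ≤ √N t² + x² / √N` and `N t² ≤ 1 + N² t⁴`
      have hb : ∀ a, |chebTrace (p + 2) a * chebForm q u a| ≤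
          (√N)⁻¹ * (1 + N ^ 2 * chebTrace (p + 2) a ^ 4 + chebForm q u a ^ 2) := by
        intro a
        set t := chebTrace (p + 2) a
        set x := chebForm q u a
        rw [inv_mul_eq_div, le_div_iff₀ hs, ← abs_of_pos hs, ← abs_mul]
        have h1 : (√N * t) ^ 2 = N * t ^ 2 := by rw [mul_pow, hs2]
        rw [abs_le]
        constructor <;>
          nlinarith [sq_nonneg (√N * t - x), sq_nonneg (√N * t + x), sq_nonneg (N * t ^ 2 - 1),
            mul_nonneg hN'.le (sq_nonneg t), sq_nonneg x]
      calc _ ≤ ∫ a, |chebTrace (p + 2) a * chebForm q u a| ∂(stdGaussianPi (Fin N × Fin N)) :=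
            abs_integral_le_integral_abs
        _ ≤ ∫ a, (√N)⁻¹ * (1 + N ^ 2 * chebTrace (p + 2) a ^ 4 + chebForm q u a ^ 2)
              ∂(stdGaussianPi (Fin N × Fin N)) := by
            refine integral_mono ?_ ?_ hb
            · exact (((polyGrowth_chebTrace _).mul (polyGrowth_chebForm q hu)).integrable
                (by fun_prop)).abs
            · exact (((integrable_const 1).add (hti.const_mul _)).add hxi).const_mul _
        _ = (√N)⁻¹ * (1 + N ^ 2 * ∫ a, chebTrace (p + 2) a ^ 4 ∂(stdGaussianPi (Fin N × Fin N)) +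
              ∫ a, chebForm q u a ^ 2 ∂(stdGaussianPi (Fin N × Fin N))) := by
            have e1 : Integrable (fun a => 1 + (N : ℝ) ^ 2 * chebTrace (p + 2) a ^ 4)
                (stdGaussianPi (Fin N × Fin N)) := (integrable_const 1).add (hti.const_mul _)
            rw [integral_const_mul, integral_add e1 hxi,
              integral_add (integrable_const 1) (hti.const_mul _), integral_const_mul]
            simp
        _ ≤ (√N)⁻¹ * (1 + N ^ 2 * (C / N ^ 2) + D) := by gcongr
        _ = _ := by field_simp
  have hpair2 : ∀ p ∈ antidiagonal (m + 1), ∃ C : ℝ, 0 ≤ C ∧ ∀ N : ℕ, 0 < N →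
      ∀ u : Fin N → ℝ, u ⬝ᵥ u = 1 →
      |(N : ℝ)⁻¹ * ∫ a, u ⬝ᵥ (chebSeq (wigner N a) p.1 * chebSeq (wigner N a) p.2) *ᵥ u
          ∂(stdGaussianPi (Fin N × Fin N)) +
        ∫ a, chebTrace p.1 a * chebForm p.2 u a ∂(stdGaussianPi (Fin N × Fin N)) -
        if p = (1, m) then ∫ a, chebForm m u a ∂(stdGaussianPi (Fin N × Fin N)) else 0| ≤
      C / √N := by
    intro p hp
    obtain ⟨C, hC, h⟩ := hpair p hp
    obtain ⟨D, hD, h'⟩ := exists_abs_integral_chebSeq_mul_le p.1 p.2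
    refine ⟨D + C, by positivity, fun N hN u hu => ?_⟩
    have hN' : (0 : ℝ) < N := by exact_mod_cast hN
    have hN1 : (1 : ℝ) ≤ N := by exact_mod_cast hN
    rw [add_sub_assoc, add_div]
    refine (abs_add_le _ _).trans (add_le_add ?_ (h N hN u hu))
    rw [abs_mul, abs_of_pos (inv_pos.2 hN'), inv_mul_eq_div]
    have h1 : √(N : ℝ) ≤ N := by
      rw [Real.sqrt_le_left hN'.le]; nlinarith
    exact div_le_div₀ hD (h' N hN u hu) (Real.sqrt_pos.2 hN') h1
  choose! C hC hCb using hpair2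
  obtain ⟨E, hE, hEb⟩ := exists_integral_chebForm_sub_pow_four_le (m + 2)
  have hS : 0 ≤ ∑ p ∈ antidiagonal (m + 1), C p := Finset.sum_nonneg hC
  refine ⟨8 * (E + (∑ p ∈ antidiagonal (m + 1), C p) ^ 4), by positivity, fun N hN u hu => ?_⟩
  have hN' : (0 : ℝ) < N := by exact_mod_cast hN
  set γ := stdGaussianPi (Fin N × Fin N)
  set μ := ∫ b, chebForm (m + 2) u b ∂γ with hμ
  have hi : ∀ j, Integrable (chebForm j u) γ := fun j =>
    (polyGrowth_chebForm j hu).integrable (by fun_prop)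
  have hmean : |μ| ≤ (∑ p ∈ antidiagonal (m + 1), C p) / √N := by
    have h1 := integral_dotProduct_wigner_mul_chebSeq hN (m + 1) hu
    have h2 : ∀ a, u ⬝ᵥ (2 * (wigner N a * chebSeq (wigner N a) (m + 1))) *ᵥ u =
        chebForm (m + 2) u a + chebForm m u a := by
      intro a
      rw [two_mul_mul_chebSeq, Matrix.add_mulVec, dotProduct_add]; rfl
    simp_rw [h2] at h1
    rw [integral_add (hi _) (hi _)] at h1
    have h3 : ∑ p ∈ antidiagonal (m + 1), (if p = (1, m) then
        ∫ a, chebForm m u a ∂γ else 0) = ∫ a, chebForm m u a ∂γ := by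
      rw [Finset.sum_ite_eq', if_pos]
      rw [Finset.HasAntidiagonal.mem_antidiagonal]; ring
    rw [← eq_sub_iff_add_eq] at h1
    rw [← h3, ← Finset.sum_sub_distrib] at h1
    rw [hμ, h1, Finset.sum_div]
    exact (Finset.abs_sum_le_sum_abs _ _).trans
      (Finset.sum_le_sum fun p hp => hCb p hp N hN u hu)
  have hmean4 : μ ^ 4 ≤ (∑ p ∈ antidiagonal (m + 1), C p) ^ 4 / N ^ 2 := by
    have h1 := pow_le_pow_left₀ (abs_nonneg μ) hmean 4
    rw [Even.pow_abs (by decide), div_pow] at h1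
    have h2 : √(N : ℝ) ^ 4 = N ^ 2 := by
      rw [show 4 = 2 * 2 from rfl, pow_mul, Real.sq_sqrt hN'.le]
    rwa [h2] at h1
  have hsi : Integrable (fun a => (chebForm (m + 2) u a - μ) ^ 4) γ :=
    (((polyGrowth_chebForm _ hu).sub (PolyGrowth.const μ)).pow 4).integrable (by fun_prop)
  calc ∫ a, chebForm (m + 2) u a ^ 4 ∂γ
      ≤ ∫ a, 8 * ((chebForm (m + 2) u a - μ) ^ 4 + μ ^ 4) ∂γ := by
        refine integral_mono (((polyGrowth_chebForm _ hu).pow 4).integrable (by fun_prop))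
          ((hsi.add (integrable_const _)).const_mul 8) fun a => ?_
        simp only
        set y := chebForm (m + 2) u a - μ with hy
        have : chebForm (m + 2) u a = y + μ := by rw [hy]; ring
        rw [this]
        nlinarith [sq_nonneg (y ^ 2 - μ ^ 2), sq_nonneg (y - μ), mul_nonneg (sq_nonneg (y - μ)) (add_nonneg (sq_nonneg y) (sq_nonneg μ)), mul_nonneg (sq_nonneg (y - μ)) (sq_nonneg (y + μ))]
    _ = 8 * (∫ a, (chebForm (m + 2) u a - μ) ^ 4 ∂γ + μ ^ 4) := by
        rw [integral_const_mul, integral_add hsi (integrable_const _)]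
        simp
    _ ≤ 8 * (E / N ^ 2 + (∑ p ∈ antidiagonal (m + 1), C p) ^ 4 / N ^ 2) := by
        gcongr
        exact hEb N hN u hu
    _ = _ := by ring

end LimitOfChebForm

/-! ### Ordered eigenvalues of symmetric matrices and rank-one perturbations -/

section Eigenvalues

variable {N : ℕ} {A : Matrix (Fin N) (Fin N) ℝ}

/-- A real symmetric matrix has an orthonormal eigenbasis compatible with the decreasing order of
its eigenvalues. -/
lemma exists_eigenbasis (hA : A.IsSymm) : ∃ v : Fin N → Fin N → ℝ,
    (∀ i, A *ᵥ v i = eig A i • v i) ∧ (∀ i j, v i ⬝ᵥ v j = if i = j then 1 else 0) := by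
  classical
  have hH : A.IsHermitian := by rwa [Matrix.IsHermitian, Matrix.conjTranspose_eq_transpose_of_trivial]
  have hc : Fintype.card (Fin N) = N := Fintype.card_fin N
  let e : Fin (Fintype.card (Fin N)) ≃ Fin N := Fintype.equivOfCardEq (Fintype.card_fin _)
  refine ⟨fun i => (hH.eigenvectorBasis (e (Fin.cast hc.symm i))).ofLp, fun i => ?_,
    fun i j => ?_⟩
  · rw [hH.mulVec_eigenvectorBasis, eig, dif_pos ⟨hH, i.2⟩, Matrix.IsHermitian.eigenvalues]
    congr 2
    exact e.symm_apply_apply _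
  · have h := orthonormal_iff_ite.1 hH.eigenvectorBasis.orthonormal
      (e (Fin.cast hc.symm i)) (e (Fin.cast hc.symm j))
    rw [PiLp.inner_apply] at h
    simp only [EmbeddingLike.apply_eq_iff_eq, Fin.cast_inj] at h
    rw [← h, dotProduct]
    exact Finset.sum_congr rfl fun k _ => by simp [mul_comm]

lemma eig_le_eig_zero (hA : A.IsSymm) {j : ℕ} (hj : j < N) : eig A j ≤ eig A 0 := by
  classical
  have hH : A.IsHermitian := by rwa [Matrix.IsHermitian, Matrix.conjTranspose_eq_transpose_of_trivial]
  rw [eig, dif_pos ⟨hH, hj⟩, eig, dif_pos ⟨hH, by omega⟩]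
  exact hH.eigenvalues₀_antitone (Fin.mk_le_mk.2 (Nat.zero_le _))

/-- The trace of a matrix in an orthonormal basis. -/
lemma trace_eq_sum_dotProduct {v : Fin N → Fin N → ℝ}
    (hv : ∀ i j, v i ⬝ᵥ v j = if i = j then 1 else 0) (M : Matrix (Fin N) (Fin N) ℝ) :
    M.trace = ∑ i, v i ⬝ᵥ M *ᵥ v i := by
  set V : Matrix (Fin N) (Fin N) ℝ := Matrix.of v
  have h1 : V * Vᵀ = 1 := by
    ext i j
    rw [Matrix.mul_apply', Matrix.one_apply]
    exact hv i j
  have h2 : Vᵀ * V = 1 := mul_eq_one_comm.1 h1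
  have h3 : (V * M * Vᵀ).trace = M.trace := by
    rw [Matrix.trace_mul_comm, ← mul_assoc, h2, one_mul]
  rw [← h3, Matrix.trace]
  refine Finset.sum_congr rfl fun i _ => ?_
  rw [Matrix.diag_apply, mul_assoc, Matrix.mul_apply']
  rfl

/-- Parseval's identity. -/
lemma dotProduct_self_eq_sum {v : Fin N → Fin N → ℝ}
    (hv : ∀ i j, v i ⬝ᵥ v j = if i = j then 1 else 0) (x : Fin N → ℝ) :
    x ⬝ᵥ x = ∑ i, (v i ⬝ᵥ x) ^ 2 := by
  have h := trace_eq_sum_dotProduct hv (Matrix.vecMulVec x x)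
  rw [Matrix.trace_vecMulVec] at h
  rw [h]
  refine Finset.sum_congr rfl fun i _ => ?_
  rw [Matrix.vecMulVec_mulVec, dotProduct_smul, dotProduct_comm x, sq]
  simp

/-- The quadratic form of `A` in an eigenbasis. -/
lemma dotProduct_mulVec_eq_sum (hA : A.IsSymm) {v : Fin N → Fin N → ℝ}
    (hv : ∀ i j, v i ⬝ᵥ v j = if i = j then 1 else 0) (he : ∀ i, A *ᵥ v i = eig A i • v i)
    (x : Fin N → ℝ) : x ⬝ᵥ A *ᵥ x = ∑ i : Fin N, eig A i * (v i ⬝ᵥ x) ^ 2 := by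
  have h := trace_eq_sum_dotProduct hv (Matrix.vecMulVec (A *ᵥ x) x)
  rw [Matrix.trace_vecMulVec, dotProduct_comm] at h
  rw [h]
  refine Finset.sum_congr rfl fun i _ => ?_
  rw [Matrix.vecMulVec_mulVec, dotProduct_smul, dotProduct_mulVec_comm hA, he, dotProduct_smul,
    dotProduct_comm x]
  simp; ring

/-- The Rayleigh bound for the largest eigenvalue. -/
lemma dotProduct_mulVec_le_eig_zero (hA : A.IsSymm) (x : Fin N → ℝ) :
    x ⬝ᵥ A *ᵥ x ≤ eig A 0 * (x ⬝ᵥ x) := by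
  obtain ⟨v, he, hv⟩ := exists_eigenbasis hA
  rw [dotProduct_mulVec_eq_sum hA hv he, dotProduct_self_eq_sum hv, Finset.mul_sum]
  exact Finset.sum_le_sum fun i _ =>
    mul_le_mul_of_nonneg_right (eig_le_eig_zero hA i.2) (sq_nonneg _)

/-- An eigenvalue is the value of the quadratic form at a unit vector. -/
lemma exists_eig_eq_dotProduct (hA : A.IsSymm) {j : ℕ} (hj : j < N) :
    ∃ v : Fin N → ℝ, v ⬝ᵥ v = 1 ∧ v ⬝ᵥ A *ᵥ v = eig A j := by
  obtain ⟨v, he, hv⟩ := exists_eigenbasis hA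
  refine ⟨v ⟨j, hj⟩, by simp [hv], ?_⟩
  rw [he, dotProduct_smul, hv]
  simp

lemma isSymm_add_vecMulVec (hA : A.IsSymm) (α : ℝ) (u : Fin N → ℝ) :
    (A + α • Matrix.vecMulVec u u).IsSymm := by
  refine hA.add (Matrix.IsSymm.smul ?_ _)
  rw [Matrix.IsSymm, Matrix.transpose_vecMulVec]

lemma dotProduct_add_vecMulVec_mulVec (α : ℝ) (u x y : Fin N → ℝ) :
    x ⬝ᵥ (A + α • Matrix.vecMulVec u u) *ᵥ y = x ⬝ᵥ A *ᵥ y + α * (u ⬝ᵥ x) * (u ⬝ᵥ y) := by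
  rw [Matrix.add_mulVec, dotProduct_add, Matrix.smul_mulVec, dotProduct_smul,
    Matrix.vecMulVec_mulVec, dotProduct_smul, dotProduct_comm x u]
  simp; ring

/-- All eigenvalues but the largest of a rank-one perturbation of `A` are bounded by the quadratic
form of `A`: the plane spanned by two eigenvectors meets the hyperplane orthogonal to `u`. -/
lemma eig_add_vecMulVec_le (hA : A.IsSymm) {c : ℝ} (hc : ∀ x, x ⬝ᵥ A *ᵥ x ≤ c * (x ⬝ᵥ x))
    (α : ℝ) (u : Fin N → ℝ) {j : ℕ} (hj0 : j ≠ 0) (hj : j < N) :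
    eig (A + α • Matrix.vecMulVec u u) j ≤ c := by
  have hB := isSymm_add_vecMulVec hA α u
  set B := A + α • Matrix.vecMulVec u u with hBdef
  obtain ⟨v, he, hv⟩ := exists_eigenbasis hB
  set w := v ⟨j, hj⟩ with hw
  set z := v ⟨0, by omega⟩ with hz
  have hww : w ⬝ᵥ w = 1 := by simp [hw, hv]
  have hzz : z ⬝ᵥ z = 1 := by simp [hz, hv]
  have hwz : w ⬝ᵥ z = 0 := by simp [hw, hz, hv, hj0]
  have hzw : z ⬝ᵥ w = 0 := by rw [dotProduct_comm, hwz]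
  have hBw : B *ᵥ w = eig B j • w := he _
  have hBz : B *ᵥ z = eig B 0 • z := he _
  have key : ∀ s t : ℝ, s * (u ⬝ᵥ z) + t * (u ⬝ᵥ w) = 0 → 0 < s ^ 2 + t ^ 2 → eig B j ≤ c := by
    intro s t hst hpos
    have h1 := hc (s • z + t • w)
    -- the vector is orthogonal to `u`, so the perturbation does not contribute
    have h2 : (s • z + t • w) ⬝ᵥ B *ᵥ (s • z + t • w) =
        (s • z + t • w) ⬝ᵥ A *ᵥ (s • z + t • w) := by
      rw [hBdef, dotProduct_add_vecMulVec_mulVec, dotProduct_add, dotProduct_smul, dotProduct_smul]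
      simp [hst]
    rw [← h2] at h1
    simp only [Matrix.mulVec_add, Matrix.mulVec_smul, hBw, hBz, add_dotProduct, dotProduct_add,
      smul_dotProduct, dotProduct_smul, smul_eq_mul, hww, hzz, hwz, hzw] at h1
    have h3 := eig_le_eig_zero hB hj
    have h4 : eig B j * (s ^ 2 + t ^ 2) ≤ c * (s ^ 2 + t ^ 2) := by nlinarith [sq_nonneg s]
    exact le_of_mul_le_mul_right h4 hpos
  rcases eq_or_ne (u ⬝ᵥ w) 0 with h0 | h0
  · exact key 0 1 (by simp [h0]) (by norm_num)
  · exact key (u ⬝ᵥ w) (-(u ⬝ᵥ z)) (by ring) (by positivity)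

open Polynomial in
lemma aeval_mulVec_of_mulVec_eq_smul {x : Fin N → ℝ} {μ : ℝ} (h : A *ᵥ x = μ • x) (p : ℝ[X]) :
    (aeval A p) *ᵥ x = p.eval μ • x := by
  induction p using Polynomial.induction_on' with
  | add p q hp hq => simp [Matrix.add_mulVec, hp, hq, add_smul]
  | monomial k c =>
    have hk : ∀ k : ℕ, (A ^ k) *ᵥ x = μ ^ k • x := by
      intro k
      induction k with
      | zero => simp
      | succ k ih =>
        rw [pow_succ, ← Matrix.mulVec_mulVec, h, Matrix.mulVec_smul, ih, smul_smul, pow_succ,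
          mul_comm]
    rw [aeval_monomial, eval_monomial, ← Algebra.smul_def, Matrix.smul_mulVec, hk, smul_smul]

open Polynomial in
/-- Linear statistics of the eigenvalues with a polynomial test function are traces. -/
lemma sum_eval_eig (hA : A.IsSymm) (p : ℝ[X]) :
    ∑ j ∈ Finset.range N, p.eval (eig A j) = (aeval A p).trace := by
  obtain ⟨v, he, hv⟩ := exists_eigenbasis hA
  rw [trace_eq_sum_dotProduct hv, ← Fin.sum_univ_eq_sum_range (fun j => p.eval (eig A j))]
  refine Finset.sum_congr rfl fun i _ => ?_
  rw [aeval_mulVec_of_mulVec_eq_smul (he i), dotProduct_smul, hv]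
  simp

/-- A rank-one perturbation changes the trace of a power by a bounded amount. -/
lemma exists_abs_trace_mul_pow_sub_le (R α : ℝ) (k : ℕ) :
    ∃ C : ℝ, ∀ (N : ℕ) (A M : Matrix (Fin N) (Fin N) ℝ) (u : Fin N → ℝ), u ⬝ᵥ u = 1 → ‖A‖ ≤ R →
      ‖A + α • Matrix.vecMulVec u u‖ ≤ R →
      |(M * ((A + α • Matrix.vecMulVec u u) ^ k - A ^ k)).trace| ≤ ‖M‖ * C := by
  induction k with
  | zero => exact ⟨0, by simp⟩
  | succ k ih =>
    obtain ⟨C, hC⟩ := ih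
    refine ⟨R * |C| + |α| * R ^ k, fun N A M u hu hA hB => ?_⟩
    have hR : 0 ≤ R := (norm_nonneg A).trans hA
    set B := A + α • Matrix.vecMulVec u u with hBdef
    have h1 : M * (B ^ (k + 1) - A ^ (k + 1)) =
        (M * B) * (B ^ k - A ^ k) + α • (Matrix.vecMulVec (M *ᵥ u) u * A ^ k) := by
      have : B - A = α • Matrix.vecMulVec u u := by simp [hBdef]
      have h2 : α • (Matrix.vecMulVec (M *ᵥ u) u * A ^ k) = M * (B - A) * A ^ k := by
        rw [this, ← Matrix.mul_vecMulVec, Matrix.mul_smul, Matrix.smul_mul]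
      rw [h2, pow_succ', pow_succ']
      noncomm_ring
    have h3 : (Matrix.vecMulVec (M *ᵥ u) u * A ^ k).trace = u ⬝ᵥ (A ^ k * M) *ᵥ u := by
      rw [Matrix.trace_mul_comm, Matrix.mul_vecMulVec, Matrix.trace_vecMulVec, dotProduct_comm,
        Matrix.mulVec_mulVec]
    rw [h1, Matrix.trace_add, Matrix.trace_smul, h3]
    have h4 : |(M * B * (B ^ k - A ^ k)).trace| ≤ ‖M‖ * R * |C| :=
      (hC N A (M * B) u hu hA hB).trans ((mul_le_mul_of_nonneg_left (le_abs_self C)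
        (norm_nonneg _)).trans (mul_le_mul_of_nonneg_right ((norm_mul_le _ _).trans (by gcongr))
        (abs_nonneg C)))
    have h5 : |u ⬝ᵥ (A ^ k * M) *ᵥ u| ≤ R ^ k * ‖M‖ := by
      refine (abs_dotProduct_mulVec_le _ hu hu).trans ((norm_mul_le _ _).trans ?_)
      gcongr
      rcases Nat.eq_zero_or_pos k with rfl | hk
      · simpa using norm_one_le
      · exact (norm_pow_le' A hk).trans (pow_le_pow_left₀ (norm_nonneg A) hA k)
    calc _ ≤ |(M * B * (B ^ k - A ^ k)).trace| + |α| * |u ⬝ᵥ (A ^ k * M) *ᵥ u| := by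
          rw [← abs_mul]; exact abs_add_le _ _
      _ ≤ ‖M‖ * R * |C| + |α| * (R ^ k * ‖M‖) := by gcongr
      _ = _ := by ring

open Polynomial in
/-- A rank-one perturbation changes the trace of a polynomial by a bounded amount, uniformly in the
dimension. -/
lemma exists_abs_trace_aeval_sub_le (R α : ℝ) (p : ℝ[X]) :
    ∃ C : ℝ, ∀ (N : ℕ) (A : Matrix (Fin N) (Fin N) ℝ) (u : Fin N → ℝ), u ⬝ᵥ u = 1 → ‖A‖ ≤ R →
      ‖A + α • Matrix.vecMulVec u u‖ ≤ R →
      |(aeval (A + α • Matrix.vecMulVec u u) p).trace - (aeval A p).trace| ≤ C := by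
  induction p using Polynomial.induction_on' with
  | add p q hp hq =>
    obtain ⟨C, hC⟩ := hp
    obtain ⟨D, hD⟩ := hq
    refine ⟨C + D, fun N A u hu hA hB => ?_⟩
    simp only [map_add, Matrix.trace_add]
    rw [add_sub_add_comm]
    exact (abs_add_le _ _).trans (add_le_add (hC N A u hu hA hB) (hD N A u hu hA hB))
  | monomial k c =>
    obtain ⟨C, hC⟩ := exists_abs_trace_mul_pow_sub_le R α k
    refine ⟨|c| * |C|, fun N A u hu hA hB => ?_⟩
    have h := hC N A 1 u hu hA hB
    rw [one_mul, Matrix.trace_sub] at h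
    simp only [aeval_monomial, ← Algebra.smul_def, Matrix.trace_smul, smul_eq_mul]
    rw [← mul_sub, abs_mul]
    refine mul_le_mul_of_nonneg_left (h.trans ?_) (abs_nonneg c)
    calc ‖(1 : Matrix (Fin N) (Fin N) ℝ)‖ * C ≤ 1 * |C| :=
          mul_le_mul_of_nonneg norm_one_le (le_abs_self C) (norm_nonneg _) (abs_nonneg C)
      _ = |C| := one_mul _

end Eigenvalues

/-! ### The semicircle law and Chebyshev polynomials -/

section Semicircle

open Polynomial

lemma chebSeq_cos_mul_sin (θ : ℝ) (k : ℕ) :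
    chebSeq (Real.cos θ) k * Real.sin θ = Real.sin (k * θ) := by
  induction k using Nat.twoStepInduction with
  | zero => simp
  | one => simp
  | more k h1 h2 =>
    rw [chebSeq_add_two, sub_mul, h1, mul_assoc, mul_assoc, h2]
    have e1 : ((k + 2 : ℕ) : ℝ) * θ = ((k + 1 : ℕ) : ℝ) * θ + θ := by push_cast; ring
    have e2 : (k : ℝ) * θ = ((k + 1 : ℕ) : ℝ) * θ - θ := by push_cast; ring
    rw [e1, e2, Real.sin_add, Real.sin_sub]
    ring

lemma eval_chebSeq (x : ℝ) (k : ℕ) : (chebSeq (X : ℝ[X]) k).eval x = chebSeq x k := by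
  have h := map_chebSeq (X : ℝ[X]) (evalRingHom x) k
  simpa using h

lemma aeval_chebSeq {n : Type*} [Fintype n] [DecidableEq n] (A : Matrix n n ℝ) (k : ℕ) :
    aeval A (chebSeq (X : ℝ[X]) k) = chebSeq A k := by
  have h := map_chebSeq (X : ℝ[X]) (aeval A : ℝ[X] →ₐ[ℝ] Matrix n n ℝ).toRingHom k
  simpa using h

lemma semicircleDensity_eq_zero {t : ℝ} (ht : t ∉ Set.Icc (-1) 1) : semicircleDensity t = 0 := by
  have : 1 - t ^ 2 ≤ 0 := by
    rw [Set.mem_Icc, not_and_or, not_le, not_le] at ht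
    rcases ht with h | h <;> nlinarith
  simp [semicircleDensity, Real.sqrt_eq_zero_of_nonpos this]

/-- The substitution `t = cos θ` in an integral against the semicircle density. -/
lemma integral_mul_semicircleDensity (f : ℝ → ℝ) :
    ∫ t, f t * semicircleDensity t =
      ∫ θ in 0..Real.pi, f (Real.cos θ) * (2 / Real.pi * Real.sin θ ^ 2) := by
  have h1 : ∫ t, f t * semicircleDensity t = ∫ t in (-1)..1, f t * semicircleDensity t := by
    rw [intervalIntegral.integral_of_le (by norm_num), ← integral_Icc_eq_integral_Ioc,
      setIntegral_eq_integral_of_forall_compl_eq_zero]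
    intro t ht
    rw [semicircleDensity_eq_zero ht, mul_zero]
  have h2 := Chebyshev.integral_measureT_eq_integral_cos
    (f := fun t => f t * (2 / Real.pi * (1 - t ^ 2)))
  rw [Chebyshev.integral_measureT] at h2
  rw [h1]
  simp only [Real.sin_sq]
  rw [← h2]
  refine intervalIntegral.integral_congr fun t ht => ?_
  rw [Set.uIcc_of_le (by norm_num)] at ht
  have h0 : 0 ≤ 1 - t ^ 2 := by nlinarith [ht.1, ht.2]
  simp only [semicircleDensity]
  rw [mul_assoc, mul_assoc]
  congr 2
  rw [Real.sqrt_inv]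
  rcases h0.eq_or_lt with h | h
  · simp [← h]
  · rw [← div_eq_mul_inv, Real.div_sqrt]

lemma integral_cos_nat_mul (k : ℕ) (hk : k ≠ 0) : ∫ θ in 0..Real.pi, Real.cos (k * θ) = 0 := by
  have hk' : (k : ℝ) ≠ 0 := by exact_mod_cast hk
  rw [intervalIntegral.integral_comp_mul_left _ hk', integral_cos]
  simp [Real.sin_nat_mul_pi]

/-- The Chebyshev polynomials of the second kind are orthonormal for the semicircle law. -/
theorem integral_chebSeq_mul_chebSeq {i j : ℕ} (hi : i ≠ 0) (hj : j ≠ 0) :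
    ∫ t, (chebSeq t i * chebSeq t j) * semicircleDensity t = if i = j then 1 else 0 := by
  wlog hij : i ≤ j generalizing i j
  · simp_rw [mul_comm (chebSeq _ i), eq_comm (a := i)]
    exact this hj hi (by omega)
  obtain ⟨d, rfl⟩ := Nat.exists_eq_add_of_le hij
  rw [integral_mul_semicircleDensity]
  have h1 : ∀ θ : ℝ, chebSeq (Real.cos θ) i * chebSeq (Real.cos θ) (i + d) *
      (2 / Real.pi * Real.sin θ ^ 2) = Real.pi⁻¹ * (Real.cos ((d : ℕ) * θ) -
        Real.cos ((i + (i + d) : ℕ) * θ)) := by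
    intro θ
    have h2 := chebSeq_cos_mul_sin θ i
    have h3 := chebSeq_cos_mul_sin θ (i + d)
    have e1 : (d : ℕ) * θ = ((i + d : ℕ) : ℝ) * θ - i * θ := by push_cast; ring
    have e2 : ((i + (i + d) : ℕ) : ℝ) * θ = ((i + d : ℕ) : ℝ) * θ + i * θ := by push_cast; ring
    rw [e1, e2, Real.cos_sub, Real.cos_add, ← h2, ← h3]
    ring
  simp_rw [h1]
  rw [intervalIntegral.integral_const_mul, intervalIntegral.integral_sub
    (Continuous.intervalIntegrable (by fun_prop) _ _)
    (Continuous.intervalIntegrable (by fun_prop) _ _), integral_cos_nat_mul (i + (i + d)) (by omega)]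
  rcases Nat.eq_zero_or_pos d with rfl | hd
  · simp [Real.pi_ne_zero]
  · rw [integral_cos_nat_mul d hd.ne', if_neg (by omega)]
    simp

lemma continuous_semicircleDensity : Continuous semicircleDensity := by
  unfold semicircleDensity; fun_prop

lemma semicircleDensity_nonneg (t : ℝ) : 0 ≤ semicircleDensity t := by
  unfold semicircleDensity; positivity

lemma integrable_mul_semicircleDensity {f : ℝ → ℝ} (hf : Continuous f) :
    Integrable (fun t => f t * semicircleDensity t) := by
  refine Continuous.integrable_of_hasCompactSupport (hf.mul continuous_semicircleDensity) ?_
  refine HasCompactSupport.intro (isCompact_Icc (a := (-1 : ℝ)) (b := 1)) fun t ht => ?_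
  rw [semicircleDensity_eq_zero ht, mul_zero]

lemma integral_semicircleDensity : ∫ t, semicircleDensity t = 1 := by
  simpa using integral_chebSeq_mul_chebSeq one_ne_zero one_ne_zero

/-- Linear functionals on polynomials that converge on the Chebyshev polynomials to the integrals
against the semicircle law do so on all polynomials. -/
theorem tendsto_of_tendsto_chebSeq {ι : Type*} {l : Filter ι} (L : ι → ℝ[X] →ₗ[ℝ] ℝ)
    (h : ∀ k, k ≠ 0 → Tendsto (fun i => L i (chebSeq X k)) l (𝓝 (if k = 1 then 1 else 0)))
    (p : ℝ[X]) : Tendsto (fun i => L i p) l (𝓝 (∫ t, p.eval t * semicircleDensity t)) := by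
  have hC : ∀ k, Tendsto (fun i => L i (chebSeq X k)) l
      (𝓝 (∫ t, (chebSeq (X : ℝ[X]) k).eval t * semicircleDensity t)) := by
    intro k
    rcases eq_or_ne k 0 with rfl | hk
    · simp [tendsto_const_nhds]
    · convert! h k hk using 2
      simpa [eval_chebSeq] using integral_chebSeq_mul_chebSeq hk one_ne_zero
  let S : Submodule ℝ ℝ[X] :=
    { carrier := {p | Tendsto (fun i => L i p) l (𝓝 (∫ t, p.eval t * semicircleDensity t))}
      zero_mem' := by simp [tendsto_const_nhds]
      add_mem' := fun {p q} hp hq => by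
        simp only [Set.mem_ofPred_eq, map_add, eval_add, add_mul] at hp hq ⊢
        rw [integral_add (integrable_mul_semicircleDensity (by fun_prop))
          (integrable_mul_semicircleDensity (by fun_prop))]
        exact hp.add hq
      smul_mem' := fun c p hp => by
        simp only [Set.mem_ofPred_eq, map_smul, eval_smul, smul_eq_mul, mul_assoc] at hp ⊢
        rw [integral_const_mul]
        exact hp.const_mul c }
  let T : Submodule ℝ ℝ[X] := Submodule.span ℝ (Set.range (chebSeq (X : ℝ[X])))
  have hTS : T ≤ S := Submodule.span_le.2 (by rintro _ ⟨k, rfl⟩; exact hC k)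
  -- the span of the Chebyshev polynomials is stable under multiplication by `X`, hence everything
  have hX : ∀ q ∈ T, X * q ∈ T := by
    intro q hq
    induction hq using Submodule.span_induction with
    | mem x hx =>
      obtain ⟨k, rfl⟩ := hx
      rcases k with _ | k
      · simp
      · have e : X * chebSeq (X : ℝ[X]) (k + 1) =
            (2⁻¹ : ℝ) • (chebSeq (X : ℝ[X]) (k + 2) + chebSeq (X : ℝ[X]) k) := by
          rw [← two_mul_mul_chebSeq, ← map_ofNat C 2, ← smul_eq_C_mul, smul_smul]
          norm_num
        rw [e]
        exact T.smul_mem _ (T.add_mem (Submodule.subset_span ⟨_, rfl⟩)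
          (Submodule.subset_span ⟨_, rfl⟩))
    | zero => simp
    | add x y _ _ hx hy => rw [mul_add]; exact T.add_mem hx hy
    | smul c x _ hx => rw [mul_smul_comm]; exact T.smul_mem _ hx
  have hpow : ∀ k : ℕ, (X : ℝ[X]) ^ k ∈ T := by
    intro k
    induction k with
    | zero => exact Submodule.subset_span ⟨1, by simp⟩
    | succ k ih => rw [pow_succ']; exact hX _ ih
  have : p ∈ S := hTS (by
    rw [p.as_sum_range_C_mul_X_pow]
    refine Submodule.sum_mem _ fun k _ => ?_
    rw [← smul_eq_C_mul]
    exact T.smul_mem _ (hpow k))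
  exact this

end Semicircle

/-! ### The entries of a GOE matrix as linear images of a standard Gaussian vector -/

section Transfer

variable {ι : Type*} [Fintype ι]

lemma integral_linearForm (c : ι → ℝ) :
    ∫ a, ∑ i, c i * a i ∂(stdGaussianPi ι) = 0 := by
  have hi : ∀ i, Integrable (fun a : ι → ℝ => c i * a i) (stdGaussianPi ι) := fun i =>
    ((PolyGrowth.const _).mul (PolyGrowth.eval i)).integrable (by fun_prop)
  rw [integral_finsetSum _ fun i _ => hi i]
  refine Finset.sum_eq_zero fun i _ => ?_
  rw [integral_const_mul]
  have h2 := (measurePreserving_eval (fun _ : ι => gaussianReal 0 1) i).map_eq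
  have h3 := integral_map (μ := stdGaussianPi ι) (φ := Function.eval i) (f := fun x : ℝ => x)
    (measurable_pi_apply i).aemeasurable (by fun_prop)
  rw [h2, integral_id_gaussianReal] at h3
  rw [show (∫ a, a i ∂(stdGaussianPi ι)) = 0 from h3.symm, mul_zero]

lemma integral_linearForm_mul_linearForm (c d : ι → ℝ) :
    ∫ a, (∑ i, c i * a i) * (∑ i, d i * a i) ∂(stdGaussianPi ι) = ∑ i, c i * d i := by
  have h1 : ∀ a : ι → ℝ, (∑ i, c i * a i) * (∑ i, d i * a i) =
      4⁻¹ * ((∑ i, (c i + d i) * a i) ^ 2 - (∑ i, (c i - d i) * a i) ^ 2) := by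
    intro a
    simp only [add_mul, sub_mul, Finset.sum_add_distrib, Finset.sum_sub_distrib]
    ring
  simp_rw [h1]
  have hi : ∀ c : ι → ℝ, Integrable (fun a : ι → ℝ => (∑ i, c i * a i) ^ 2) (stdGaussianPi ι) :=
    fun c => ((polyGrowth_linearForm c).pow 2).integrable (by fun_prop)
  rw [integral_const_mul, integral_sub (hi fun i => c i + d i) (hi fun i => c i - d i),
    integral_linearForm_sq (fun i => c i + d i), integral_linearForm_sq (fun i => c i - d i),
    ← Finset.sum_sub_distrib, Finset.mul_sum]
  exact Finset.sum_congr rfl fun i _ => by ring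

/-- A linear map to `κ → ℝ` whose coefficient vectors are pairwise orthogonal sends the standard
Gaussian measure to a product of Gaussian measures. -/
lemma map_linearForms_stdGaussianPi {κ : Type*} [Fintype κ] (c : κ → ι → ℝ)
    (hc : ∀ k l, k ≠ l → ∑ i, c k i * c l i = 0) :
    (stdGaussianPi ι).map (fun a k => ∑ i, c k i * a i) =
      Measure.pi fun k => gaussianReal 0 (∑ i, c k i ^ 2).toNNReal := by
  have hg : HasGaussianLaw (fun a k => ∑ i, c k i * a i) (stdGaussianPi ι) := by
    let L : (ι → ℝ) →L[ℝ] (κ → ℝ) := ContinuousLinearMap.pi fun k =>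
      ∑ i, c k i • ContinuousLinearMap.proj (R := ℝ) (φ := fun _ : ι => ℝ) i
    have h := (IsGaussian.hasGaussianLaw_id (μ := stdGaussianPi ι)).map L
    convert! h using 1
    ext a k
    simp [L]
  have hm : ∀ k, Measurable (fun a : ι → ℝ => ∑ i, c k i * a i) := fun k => by fun_prop
  have hL : ∀ k, MemLp (fun a : ι → ℝ => ∑ i, c k i * a i) 2 (stdGaussianPi ι) := fun k =>
    (hg.eval k).memLp_two
  have hind := hg.iIndepFun_of_covariance_eq_zero fun k l hkl => by
    rw [covariance_eq_sub (hL k) (hL l), integral_linearForm, zero_mul, sub_zero]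
    exact (integral_linearForm_mul_linearForm _ _).trans (hc k l hkl)
  rw [hind.map_fun_eq_pi_map fun k => (hm k).aemeasurable]
  congr 1
  ext1 k
  rw [(hg.eval k).map_eq_gaussianReal, variance_of_integral_eq_zero (hm k).aemeasurable
    (integral_linearForm _), integral_linearForm, integral_linearForm_sq]

variable {N : ℕ}

/-- The coefficients of the linear form `a ↦ (a p + a p.swap) / 2`. -/
def symCoeff (p q : Fin N × Fin N) : ℝ := ((if q = p then 1 else 0) + if q = p.swap then 1 else 0) / 2

lemma sum_symCoeff_mul (p : Fin N × Fin N) (a : Fin N × Fin N → ℝ) :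
    ∑ q, symCoeff p q * a q = (a p + a p.swap) / 2 := by
  simp only [symCoeff, add_div, add_mul, Finset.sum_add_distrib]
  simp [ite_div, ite_mul]
  ring

/-- The joint law of the entries of a GOE matrix is the law of the symmetric part of a square
matrix with independent standard Gaussian entries. -/
theorem IsGOE.map_entries_eq {Ω : Type*} [MeasurableSpace Ω] {P : Measure Ω}
    [IsProbabilityMeasure P] {G : Ω → Matrix (Fin N) (Fin N) ℝ} (hG : IsGOE P G) :
    P.map (fun ω (p : Fin N × Fin N) => G ω p.1 p.2) =
      (stdGaussianPi (Fin N × Fin N)).map fun a p => (a p + a p.swap) / 2 := by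
  classical
  -- both sides are the image under `M` of the law of the entries on and above the diagonal
  let I := {p : Fin N × Fin N // p.1 ≤ p.2}
  let M : (I → ℝ) → (Fin N × Fin N → ℝ) := fun y p =>
    if h : p.1 ≤ p.2 then y ⟨p, h⟩ else y ⟨p.swap, (not_le.1 h).le⟩
  have hM : Measurable M := by
    refine measurable_pi_lambda _ fun p => ?_
    by_cases h : p.1 ≤ p.2 <;> simp only [M, h, dite_true, dite_false] <;>
      exact measurable_pi_apply _
  have hentry : ∀ p : I, AEMeasurable (fun ω => G ω p.1.1 p.1.2) P := by
    rintro ⟨⟨i, j⟩, hij⟩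
    rcases (show i ≤ j from hij).eq_or_lt with rfl | h
    · exact (hG.diag_law i).aemeasurable
    · exact (hG.offDiag_law i j h).aemeasurable
  have hlaw : P.map (fun ω (p : I) => G ω p.1.1 p.1.2) =
      (stdGaussianPi (Fin N × Fin N)).map (fun a (p : I) => ∑ q, symCoeff p.1 q * a q) := by
    rw [hG.indep.map_fun_eq_pi_map hentry, map_linearForms_stdGaussianPi]
    · congr 1
      ext1 p
      obtain ⟨⟨i, j⟩, hij⟩ := p
      have hs : ∑ q, symCoeff (i, j) q ^ 2 = (symCoeff (i, j) (i, j) + symCoeff (i, j) (j, i)) / 2 := by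
        simp_rw [sq, sum_symCoeff_mul]
        rfl
      rw [hs]
      rcases (show i ≤ j from hij).eq_or_lt with rfl | h
      · rw [(hG.diag_law i).map_eq]
        simp [symCoeff]
      · rw [(hG.offDiag_law i j h).map_eq]
        congr 1
        have e : (symCoeff (i, j) (i, j) + symCoeff (i, j) (j, i)) / 2 = ((1 / 2 : ℝ≥0) : ℝ) := by
          norm_num [symCoeff, h.ne, h.ne']
        rw [e, Real.toNNReal_coe]
    · rintro ⟨⟨i, j⟩, hij⟩ ⟨⟨k, l⟩, hkl⟩ hne
      rw [sum_symCoeff_mul]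
      have h1 : ¬(i = k ∧ j = l) := fun h => hne (by simp [h.1, h.2])
      have h2 : ¬(i = l ∧ j = k) := fun h => h1 (by
        have h3 : i ≤ j := hij
        have h4 : k ≤ l := hkl
        rw [← h.1, ← h.2] at h4
        have := le_antisymm h3 h4
        exact ⟨by rw [← h.2, this], by rw [← h.1, this]⟩)
      have h3 : ¬(j = k ∧ i = l) := fun h => h2 h.symm
      have h4 : ¬(j = l ∧ i = k) := fun h => h1 h.symm
      simp [symCoeff, h1, h2, h3, h4]
  have hl : P.map (fun ω (p : Fin N × Fin N) => G ω p.1 p.2) =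
      (P.map (fun ω (p : I) => G ω p.1.1 p.1.2)).map M := by
    rw [AEMeasurable.map_map_of_aemeasurable hM.aemeasurable (aemeasurable_pi_lambda _ hentry)]
    congr 1
    ext ω p
    by_cases h : p.1 ≤ p.2
    · simp [M, h]
    · simp only [Function.comp, M, h, dite_false, Prod.fst_swap, Prod.snd_swap]
      exact (hG.isSymm ω).apply _ _
  have hr : (stdGaussianPi (Fin N × Fin N)).map (fun a p => (a p + a p.swap) / 2) =
      ((stdGaussianPi (Fin N × Fin N)).map
        (fun a (p : I) => ∑ q, symCoeff p.1 q * a q)).map M := by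
    rw [Measure.map_map hM (by fun_prop)]
    congr 1
    ext a p
    by_cases h : p.1 ≤ p.2
    · simp [M, h, sum_symCoeff_mul]
    · simp [M, h, sum_symCoeff_mul, add_comm]
  rw [hl, hlaw, hr]

lemma wigner_symmetrize (a : Fin N × Fin N → ℝ) :
    wigner N (fun p => (a p + a p.swap) / 2) = wigner N a := by
  ext i j
  simp only [wigner_apply, Prod.swap]
  ring

lemma wigner_entries {A : Matrix (Fin N) (Fin N) ℝ} (hA : A.IsSymm) :
    wigner N (fun p => A p.1 p.2) = (1 / √(2 * (N : ℝ))) • A := by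
  ext i j
  rw [wigner_apply, hA.apply i j, sqrt_eight_mul, Matrix.smul_apply, smul_eq_mul]
  rcases eq_or_ne (√(2 * (N : ℝ))) 0 with h | h
  · simp [h]
  · field_simp; ring

lemma IsGOE.aemeasurable_entries {Ω : Type*} [MeasurableSpace Ω] {P : Measure Ω}
    {G : Ω → Matrix (Fin N) (Fin N) ℝ} (hG : IsGOE P G) :
    AEMeasurable (fun ω (p : Fin N × Fin N) => G ω p.1 p.2) P := by
  refine aemeasurable_pi_lambda _ fun p => ?_
  rcases lt_trichotomy p.1 p.2 with h | h | h
  · exact (hG.offDiag_law _ _ h).aemeasurable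
  · rw [h]; exact (hG.diag_law _).aemeasurable
  · simp_rw [← (hG.isSymm _).apply p.1 p.2]
    exact (hG.offDiag_law _ _ h).aemeasurable

/-- Expectations of functions of `G / √(2 N)`, for a GOE matrix `G`, can be computed with
`wigner N`. -/
theorem IsGOE.lintegral_comp_entries {Ω : Type*} [MeasurableSpace Ω] {P : Measure Ω}
    [IsProbabilityMeasure P] {G : Ω → Matrix (Fin N) (Fin N) ℝ} (hG : IsGOE P G)
    (Ψ : Matrix (Fin N) (Fin N) ℝ → ENNReal) (hΨ : Measurable fun a => Ψ (wigner N a)) :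
    ∫⁻ ω, Ψ ((1 / √(2 * (N : ℝ))) • G ω) ∂P =
      ∫⁻ a, Ψ (wigner N a) ∂(stdGaussianPi (Fin N × Fin N)) := by
  simp_rw [← wigner_entries (hG.isSymm _)]
  rw [← lintegral_map' (f := fun a => Ψ (wigner N a)) hΨ.aemeasurable hG.aemeasurable_entries,
    hG.map_entries_eq, lintegral_map hΨ (by fun_prop)]
  simp_rw [wigner_symmetrize]

end Transfer

/-! ### Tail bounds and almost sure limits -/

section Tails

variable {N : ℕ}

lemma integral_sum_sq_div (hN : 0 < N) :
    ∫ g : Fin N → ℝ, (∑ i, g i ^ 2) / N ∂(stdGaussianPi (Fin N)) = 1 := by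
  have hN' : (N : ℝ) ≠ 0 := by exact_mod_cast hN.ne'
  have h1 : ∀ i : Fin N, ∫ g : Fin N → ℝ, g i ^ 2 ∂(stdGaussianPi (Fin N)) = 1 := fun i => by
    have := integral_linearForm_sq (Pi.single i 1 : Fin N → ℝ)
    simpa [Pi.single_apply] using this
  rw [integral_div, integral_finsetSum _ fun i _ =>
    ((PolyGrowth.eval i).pow 2).integrable (by fun_prop)]
  simp [h1, hN']

/-- Concentration of `|g|² / N`, for `g` a standard Gaussian vector in `ℝ ^ N`. -/
lemma exists_integral_sum_sq_div_sub_one_pow_four_le : ∃ C : ℝ, 0 ≤ C ∧ ∀ N : ℕ, 0 < N →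
    ∫ g : Fin N → ℝ, ((∑ i, g i ^ 2) / N - 1) ^ 4 ∂(stdGaussianPi (Fin N)) ≤ C / N ^ 2 := by
  have hM : 0 ≤ ∫ x : ℝ, x ^ (2 * 2) ∂(gaussianReal 0 1) :=
    integral_nonneg fun x => (even_two_mul 2).pow_nonneg x
  refine ⟨3 * (Real.pi / 2) ^ 4 * (16 * ∫ x : ℝ, x ^ (2 * 2) ∂(gaussianReal 0 1)),
    by positivity, fun N hN => ?_⟩
  have hN' : (0 : ℝ) < N := by exact_mod_cast hN
  have hf : ContDiff ℝ 1 (fun g : Fin N → ℝ => (∑ i, g i ^ 2) / N) := by fun_prop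
  have hfp : PolyGrowth (fun g : Fin N → ℝ => (∑ i, g i ^ 2) / N) := by
    simp_rw [div_eq_mul_inv]
    exact (PolyGrowth.sum _ fun i _ => (PolyGrowth.eval i).pow 2).mul (PolyGrowth.const _)
  have hKp : PolyGrowth (fun g : Fin N → ℝ => 2 / N * √(∑ i, g i ^ 2)) := by
    refine (((PolyGrowth.const (2 / N)).mul (((PolyGrowth.sum Finset.univ
      fun i _ => (PolyGrowth.eval i).pow 2)).add (PolyGrowth.const 1)))).of_le fun g => ?_
    have h0 : 0 ≤ ∑ i, g i ^ 2 := by positivity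
    rw [abs_of_nonneg (by positivity), abs_of_nonneg (by positivity)]
    gcongr
    rw [Real.sqrt_le_left (by positivity)]
    nlinarith
  have h := integral_sub_integral_pow_four_le (K := fun g : Fin N → ℝ => 2 / N * √(∑ i, g i ^ 2))
    hf hfp (fun g => by positivity) (by fun_prop) hKp fun g x => by
      have hd : HasFDerivAt (fun g : Fin N → ℝ => (∑ i, g i ^ 2) / N)
          ((N : ℝ)⁻¹ • ∑ i, (2 * g i) • ContinuousLinearMap.proj (R := ℝ) (φ := fun _ : Fin N => ℝ) i)
          g := by
        simp_rw [div_eq_inv_mul]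
        refine (HasFDerivAt.fun_sum fun i _ => ?_).const_mul _
        have := ((ContinuousLinearMap.proj (R := ℝ) (φ := fun _ : Fin N => ℝ) i).hasFDerivAt
          (x := g)).pow 2
        simpa using this
      rw [hd.fderiv]
      have e : ((N : ℝ)⁻¹ • ∑ i, (2 * g i) • ContinuousLinearMap.proj (R := ℝ)
          (φ := fun _ : Fin N => ℝ) i) x = 2 / N * ∑ i, g i * x i := by
        simp [mul_assoc, ← Finset.mul_sum]
        ring
      rw [e, abs_mul, abs_of_pos (by positivity), mul_assoc, ← Real.sqrt_mul (by positivity)]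
      gcongr
      exact Real.abs_le_sqrt (Finset.sum_mul_sq_le_sq_mul_sq Finset.univ g x)
  rw [integral_sum_sq_div hN] at h
  refine h.trans ?_
  have h2 : ∀ g : Fin N → ℝ, (2 / N * √(∑ i, g i ^ 2)) ^ 4 =
      16 / N ^ 2 * ((∑ i, g i ^ 2) / N) ^ 2 := by
    intro g
    rw [mul_pow, show √(∑ i, g i ^ 2) ^ 4 = (√(∑ i, g i ^ 2) ^ 2) ^ 2 by ring,
      Real.sq_sqrt (by positivity)]
    field_simp
    norm_num
    ring
  simp_rw [h2]
  rw [integral_const_mul, mul_div_assoc]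
  gcongr
  have := integral_sum_sq_div_pow_le hN 2
  calc _ ≤ 16 / (N : ℝ) ^ 2 * ∫ x : ℝ, x ^ (2 * 2) ∂(gaussianReal 0 1) := by gcongr
    _ = _ := by ring

lemma measure_le_pow_four_le {α : Type*} [MeasurableSpace α] {μ : Measure α} {f : α → ℝ}
    (hf : Integrable (fun x => f x ^ 4) μ) {δ B : ℝ} (hδ : 0 < δ) (hB : ∫ x, f x ^ 4 ∂μ ≤ B) :
    μ {x | δ ≤ |f x|} ≤ ENNReal.ofReal (B / δ ^ 4) := by
  have h0 : 0 ≤ᵐ[μ] fun x => f x ^ 4 := ae_of_all _ fun x => by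
    simp only [Pi.zero_apply]; positivity
  have h1 : {x | δ ≤ |f x|} ⊆ {x | ENNReal.ofReal (δ ^ 4) ≤ ENNReal.ofReal (f x ^ 4)} := by
    intro x hx
    refine ENNReal.ofReal_le_ofReal ?_
    have := pow_le_pow_left₀ hδ.le hx 4
    rwa [Even.pow_abs (by decide)] at this
  refine (measure_mono h1).trans ?_
  rw [ENNReal.ofReal_div_of_pos (by positivity)]
  refine (meas_ge_le_lintegral_div hf.aestronglyMeasurable.aemeasurable.ennreal_ofReal
    (by positivity) ENNReal.ofReal_ne_top).trans ?_
  gcongr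
  rw [← ofReal_integral_eq_lintegral_ofReal hf h0]
  exact ENNReal.ofReal_le_ofReal hB

/-- Upper tail of the supremum over the sphere of the quadratic form of a Gaussian symmetric matrix
perturbed by `β u uᵀ`. By comparison, the threshold is the maximum of
`v ↦ v · g / √N + β (u · v)²`, which is asymptotically the maximum over `y ∈ [0, 1]` of
`y + β (1 - y²)`, where `y` is the length of the component of `v` orthogonal to `u`. -/
theorem exists_measure_sphere_le {β F c : ℝ} (hF : ∀ y, 0 ≤ y → y ≤ 1 → y + β * (1 - y ^ 2) ≤ F)
    (hFc : F < c) {σ : ℝ} (hσ : σ ^ 2 = 1) : ∃ C : ℝ, 0 ≤ C ∧ ∀ N : ℕ, 0 < N →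
      ∀ u : Fin N → ℝ, u ⬝ᵥ u = 1 → stdGaussianPi (Fin N × Fin N)
        {a | ∃ v : Fin N → ℝ, v ⬝ᵥ v = 1 ∧ c < σ * (v ⬝ᵥ wigner N a *ᵥ v) + β * (u ⬝ᵥ v) ^ 2} ≤
      ENNReal.ofReal (C / N ^ 2) := by
  obtain ⟨C, hC, h⟩ := exists_integral_sum_sq_div_sub_one_pow_four_le
  set δ : ℝ := (c - F) / 3 with hδdef
  have hδ : 0 < δ := by rw [hδdef]; linarith
  refine ⟨2 * (C / δ ^ 4 + 3 / δ ^ 4), by positivity, fun N hN u hu => ?_⟩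
  have hN' : (0 : ℝ) < N := by exact_mod_cast hN
  have hs : 0 < √(N : ℝ) := Real.sqrt_pos.2 hN'
  have h2N : 0 < √(2 * (N : ℝ)) := by positivity
  have hset : {a | ∃ v : Fin N → ℝ, v ⬝ᵥ v = 1 ∧
      c < σ * (v ⬝ᵥ wigner N a *ᵥ v) + β * (u ⬝ᵥ v) ^ 2} =
      {a | ∃ v : Fin N → ℝ, ∑ i, v i ^ 2 = 1 ∧
        0 < σ * quadForm a v + √(2 * N) * (β * (u ⬝ᵥ v) ^ 2 - c)} := by
    ext a
    simp only [Set.mem_ofPred_eq, sum_sq_eq_dotProduct_self, dotProduct_wigner_mulVec]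
    refine exists_congr fun v => and_congr_right fun _ => ?_
    have e : σ * quadForm a v + √(2 * N) * (β * (u ⬝ᵥ v) ^ 2 - c) =
        √(2 * N) * (σ * (quadForm a v / √(2 * N)) + β * (u ⬝ᵥ v) ^ 2 - c) := by
      field_simp
      ring
    rw [e, mul_pos_iff_of_pos_left h2N, sub_pos]
  have hsub : {g : Fin N → ℝ | ∃ v : Fin N → ℝ, ∑ i, v i ^ 2 = 1 ∧
      0 ≤ ∑ i, √2 * v i * g i + √(2 * N) * (β * (u ⬝ᵥ v) ^ 2 - c)} ⊆
      {g | δ ≤ |(∑ i, g i ^ 2) / N - 1|} ∪ {g | δ ≤ |(√N)⁻¹ * ∑ i, u i * g i|} := by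
    rintro g ⟨v, hv, h0⟩
    by_contra hcon
    simp only [Set.mem_union, Set.mem_ofPred_eq, not_or, not_le] at hcon
    obtain ⟨hg1, hg2⟩ := hcon
    rw [sum_sq_eq_dotProduct_self] at hv
    have e1 : ∑ i, √2 * v i * g i = √2 * (v ⬝ᵥ g) := by
      rw [dotProduct, Finset.mul_sum]; exact Finset.sum_congr rfl fun i _ => by ring
    rw [e1, Real.sqrt_mul zero_le_two, mul_assoc, ← mul_add] at h0
    have h1 := nonneg_of_mul_nonneg_right h0 (by positivity : (0 : ℝ) < √2)
    -- decompose `v = s u + w` with `w` orthogonal to `u` and of length `y`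
    set s := u ⬝ᵥ v with hsdef
    set w := v - s • u with hwdef
    set y := √(1 - s ^ 2) with hydef
    have hs1 : s ^ 2 ≤ 1 := by
      have := dotProduct_sq_le u v
      rwa [hu, hv, one_mul] at this
    have hy0 : 0 ≤ y := Real.sqrt_nonneg _
    have hy2 : y ^ 2 = 1 - s ^ 2 := Real.sq_sqrt (by linarith)
    have hy1 : y ≤ 1 := by nlinarith [sq_nonneg s]
    have hww : w ⬝ᵥ w = y ^ 2 := by
      rw [hy2, hwdef]
      simp only [sub_dotProduct, dotProduct_sub, smul_dotProduct, dotProduct_smul, smul_eq_mul,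
        hu, hv, dotProduct_comm v u, ← hsdef]
      ring
    have hvg : v ⬝ᵥ g = w ⬝ᵥ g + s * (u ⬝ᵥ g) := by
      rw [hwdef, sub_dotProduct, smul_dotProduct, smul_eq_mul]; ring
    have hgg : g ⬝ᵥ g ≤ N * (1 + δ) ^ 2 := by
      have h3 := (abs_lt.1 hg1).2
      rw [sub_lt_iff_lt_add, div_lt_iff₀ hN', sum_sq_eq_dotProduct_self] at h3
      nlinarith [mul_pos hN' hδ, mul_pos hN' (mul_pos hδ hδ)]
    have hwg : w ⬝ᵥ g ≤ √N * (y * (1 + δ)) := by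
      refine abs_le_of_sq_le_sq' ?_ (by positivity) |>.2
      calc _ ≤ (w ⬝ᵥ w) * (g ⬝ᵥ g) := dotProduct_sq_le w g
        _ ≤ y ^ 2 * (N * (1 + δ) ^ 2) := by rw [hww]; gcongr
        _ = _ := by rw [mul_pow, Real.sq_sqrt hN'.le]; ring
    have hug : s * (u ⬝ᵥ g) ≤ √N * δ := by
      have h3 : |u ⬝ᵥ g| ≤ √N * δ := by
        have h4 : |(√(N : ℝ))⁻¹ * (u ⬝ᵥ g)| < δ := hg2
        rw [abs_mul, abs_of_pos (inv_pos.2 hs), inv_mul_lt_iff₀ hs] at h4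
        exact h4.le
      have h5 : |s| ≤ 1 := (sq_le_one_iff_abs_le_one s).1 hs1
      calc _ ≤ |s * (u ⬝ᵥ g)| := le_abs_self _
        _ = |s| * |u ⬝ᵥ g| := abs_mul _ _
        _ ≤ 1 * (√N * δ) := by gcongr
        _ = _ := one_mul _
    have h6 := hF y hy0 hy1
    have h7 : 0 ≤ √(N : ℝ) * (y * (1 + δ) + δ + β * s ^ 2 - c) := by
      rw [hvg] at h1
      linarith
    have h8 := nonneg_of_mul_nonneg_right h7 hs
    have h9 : s ^ 2 = 1 - y ^ 2 := by linarith
    rw [h9] at h8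
    have h10 : y * δ ≤ δ := mul_le_of_le_one_left hδ.le hy1
    have h11 : c - F = 3 * δ := by rw [hδdef]; ring
    linarith
  rw [hset]
  refine (measure_exists_sphere_quadForm_le hσ (by fun_prop)).trans ?_
  have hp1 := measure_le_pow_four_le (μ := stdGaussianPi (Fin N))
    (f := fun g : Fin N → ℝ => (∑ i, g i ^ 2) / N - 1) (by
      refine PolyGrowth.integrable ?_ (by fun_prop)
      simp_rw [div_eq_mul_inv]
      exact (((PolyGrowth.sum _ fun i _ => (PolyGrowth.eval i).pow 2).mul
        (PolyGrowth.const _)).sub (PolyGrowth.const 1)).pow 4) hδ (h N hN)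
  have hp2 := measure_le_pow_four_le (μ := stdGaussianPi (Fin N))
    (f := fun g : Fin N → ℝ => (√N)⁻¹ * ∑ i, u i * g i) (B := 3 / N ^ 2) (by
      refine PolyGrowth.integrable ?_ (by fun_prop)
      exact ((PolyGrowth.const _).mul (polyGrowth_linearForm u)).pow 4) hδ (by
      simp_rw [mul_pow]
      rw [integral_const_mul, integral_linearForm_pow_four, sum_sq_eq_dotProduct_self, hu,
        show (√(N : ℝ))⁻¹ ^ 4 = ((√(N : ℝ) ^ 2) ^ 2)⁻¹ by rw [inv_pow]; ring,
        Real.sq_sqrt hN'.le]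
      apply le_of_eq
      ring)
  calc _ ≤ 2 * (ENNReal.ofReal (C / N ^ 2 / δ ^ 4) + ENNReal.ofReal (3 / N ^ 2 / δ ^ 4)) := by
        refine mul_le_mul_right ?_ 2
        exact (measure_mono hsub).trans ((measure_union_le _ _).trans (add_le_add hp1 hp2))
    _ = _ := by
        rw [← ENNReal.ofReal_add (by positivity) (by positivity),
          show (2 : ENNReal) = ENNReal.ofReal 2 by simp, ← ENNReal.ofReal_mul zero_le_two]
        congr 1
        field_simp

lemma tsum_ofReal_div_sq_ne_top (C : ℝ) :
    ∑' N : ℕ, ENNReal.ofReal (C / (N : ℝ) ^ 2) ≠ ⊤ := by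
  have hs : Summable fun N : ℕ => C / (N : ℝ) ^ 2 := by
    simp_rw [div_eq_mul_inv]
    exact (Real.summable_nat_pow_inv.2 one_lt_two).mul_left C
  exact hs.tsum_ofReal_ne_top

variable {Ω : Type*} [MeasurableSpace Ω] {P : Measure Ω} [IsProbabilityMeasure P]
  {G : ∀ N : ℕ, Ω → Matrix (Fin N) (Fin N) ℝ}

/-- A sequence of statistics of `G N / √(2 N)` whose expectations are `O(N⁻²)` tends to zero almost
surely. -/
lemma ae_tendsto_of_lintegral_le (hG : ∀ N, IsGOE P (G N))
    (Ψ : ∀ N : ℕ, Matrix (Fin N) (Fin N) ℝ → ENNReal)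
    (hΨ : ∀ N, Measurable fun a => Ψ N (wigner N a)) {C : ℝ}
    (h : ∀ N, 0 < N → ∫⁻ a, Ψ N (wigner N a) ∂(stdGaussianPi (Fin N × Fin N)) ≤
      ENNReal.ofReal (C / N ^ 2)) :
    ∀ᵐ ω ∂P, Tendsto (fun N => Ψ N ((1 / √(2 * (N : ℝ))) • G N ω)) atTop (𝓝 0) := by
  have hm : ∀ N, AEMeasurable (fun ω => Ψ N ((1 / √(2 * (N : ℝ))) • G N ω)) P := by
    intro N
    simp_rw [← wigner_entries ((hG N).isSymm _)]
    exact (hΨ N).comp_aemeasurable (hG N).aemeasurable_entries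
  have hsum : ∑' N : ℕ, ∫⁻ ω, Ψ (N + 1) ((1 / √(2 * ((N + 1 : ℕ) : ℝ))) • G (N + 1) ω) ∂P ≠ ⊤ := by
    refine ne_top_of_le_ne_top (tsum_ofReal_div_sq_ne_top C) ?_
    refine le_trans (ENNReal.tsum_le_tsum fun N => ?_)
      (ENNReal.tsum_comp_le_tsum_of_injective (add_left_injective 1) _)
    rw [(hG (N + 1)).lintegral_comp_entries _ (hΨ _)]
    exact h (N + 1) (Nat.succ_pos N)
  rw [← lintegral_tsum fun N => hm (N + 1)] at hsum
  filter_upwards [ae_lt_top' (AEMeasurable.tsum fun N => hm (N + 1)) hsum] with ω hω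
  rw [← tendsto_add_atTop_iff_nat 1]
  exact ENNReal.tendsto_atTop_zero_of_tsum_ne_top hω.ne

end Tails

/-! ### Deterministic consequences: limiting density and the outlier -/

section Deterministic

open Polynomial

lemma norm_vecMulVec_self_le {N : ℕ} {u : Fin N → ℝ} (hu : u ⬝ᵥ u = 1) :
    ‖Matrix.vecMulVec u u‖ ≤ 1 := by
  refine norm_le_of_abs_dotProduct_mulVec_le
    (by rw [Matrix.IsSymm, Matrix.transpose_vecMulVec]) zero_le_one fun x => ?_
  have h := dotProduct_sq_le u x
  rw [hu, one_mul] at h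
  have e : x ⬝ᵥ Matrix.vecMulVec u u *ᵥ x = (u ⬝ᵥ x) ^ 2 := by
    rw [Matrix.vecMulVec_mulVec, dotProduct_smul, dotProduct_comm x u, sq]
    simp
  rw [e, one_mul, abs_of_nonneg (sq_nonneg _)]
  exact h

lemma norm_add_vecMulVec_le {N : ℕ} (A : Matrix (Fin N) (Fin N) ℝ) (α : ℝ) {u : Fin N → ℝ}
    (hu : u ⬝ᵥ u = 1) : ‖A + α • Matrix.vecMulVec u u‖ ≤ ‖A‖ + |α| := by
  refine (norm_add_le _ _).trans ?_
  rw [norm_smul, Real.norm_eq_abs]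
  have := mul_le_mul_of_nonneg_left (norm_vecMulVec_self_le hu) (abs_nonneg α)
  linarith

lemma abs_eig_le_norm {N : ℕ} {A : Matrix (Fin N) (Fin N) ℝ} (hA : A.IsSymm) {j : ℕ} (hj : j < N) :
    |eig A j| ≤ ‖A‖ := by
  obtain ⟨v, hv, h⟩ := exists_eig_eq_dotProduct hA hj
  rw [← h]
  exact abs_dotProduct_mulVec_le A hv hv

/-- The method of moments: convergence of the normalised traces of polynomials of bounded
symmetric matrices gives weak convergence of the empirical measures of the eigenvalues. -/
theorem hasLimitingDensity_of_tendsto_trace {B : ∀ N : ℕ, Matrix (Fin N) (Fin N) ℝ}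
    (hB : ∀ N, (B N).IsSymm) {R : ℝ} (hR : 1 ≤ R) (hBR : ∀ᶠ N in atTop, ‖B N‖ ≤ R)
    (hT : ∀ p : ℝ[X], Tendsto (fun N => (aeval (B N) p).trace / N) atTop
      (𝓝 (∫ t, p.eval t * semicircleDensity t))) :
    HasLimitingDensity (fun N => eig (B N)) (fun N => Finset.range N) semicircleDensity := by
  intro f
  rw [Metric.tendsto_atTop']
  intro ε hε
  -- Weierstrass approximation on an interval that contains all eigenvalues and `[-1, 1]`
  obtain ⟨p, hp⟩ := exists_polynomial_near_of_continuousOn (-R) R f f.continuous.continuousOn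
    (ε / 4) (by positivity)
  have hint : |(∫ t, p.eval t * semicircleDensity t) - ∫ t, f t * semicircleDensity t| ≤ ε / 4 := by
    rw [← integral_sub (integrable_mul_semicircleDensity (by fun_prop))
      (integrable_mul_semicircleDensity f.continuous)]
    have hi : Integrable (fun t => ε / 4 * semicircleDensity t) :=
      integrable_mul_semicircleDensity (f := fun _ => ε / 4) continuous_const
    calc _ ≤ ∫ t, |p.eval t * semicircleDensity t - f t * semicircleDensity t| :=
          abs_integral_le_integral_abs
      _ ≤ ∫ t, ε / 4 * semicircleDensity t := by
          refine integral_mono (((integrable_mul_semicircleDensity (by fun_prop)).sub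
            (integrable_mul_semicircleDensity f.continuous)).abs) hi fun t => ?_
          by_cases ht : t ∈ Set.Icc (-1 : ℝ) 1
          · simp only
            rw [← sub_mul, abs_mul, abs_of_nonneg (semicircleDensity_nonneg t)]
            exact mul_le_mul_of_nonneg_right
              (hp t ⟨by linarith [ht.1], by linarith [ht.2]⟩).le (semicircleDensity_nonneg t)
          · simp [semicircleDensity_eq_zero ht]
      _ = ε / 4 := by rw [integral_const_mul, integral_semicircleDensity, mul_one]
  have hTp := Metric.tendsto_atTop'.1 (hT p) (ε / 4) (by positivity)
  obtain ⟨n₁, h₁⟩ := hTp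
  obtain ⟨n₂, h₂⟩ := eventually_atTop.1 hBR
  refine ⟨max (max n₁ n₂) 0, fun N hN => ?_⟩
  have hN0 : 0 < N := (le_max_right _ _).trans_lt hN
  have hN' : (0 : ℝ) < N := by exact_mod_cast hN0
  have hN1 := h₁ N (((le_max_left _ _).trans (le_max_left _ _)).trans_lt hN)
  have hN2 := h₂ N (((le_max_right _ _).trans (le_max_left _ _)).trans hN.le)
  rw [← sum_eval_eig (hB N), Real.dist_eq] at hN1
  rw [Real.dist_eq, Finset.card_range]
  have hsum : |(∑ j ∈ Finset.range N, f (eig (B N) j)) / (N : ℝ) -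
      (∑ j ∈ Finset.range N, p.eval (eig (B N) j)) / N| ≤ ε / 4 := by
    rw [← sub_div, ← Finset.sum_sub_distrib, abs_div, abs_of_pos hN', div_le_iff₀ hN']
    calc _ ≤ ∑ j ∈ Finset.range N, |f (eig (B N) j) - p.eval (eig (B N) j)| :=
          Finset.abs_sum_le_sum_abs _ _
      _ ≤ ∑ j ∈ Finset.range N, ε / 4 := by
          refine Finset.sum_le_sum fun j hj => ?_
          rw [abs_sub_comm]
          exact (hp _ (abs_le.1 ((abs_eig_le_norm (hB N) (Finset.mem_range.1 hj)).trans hN2))).le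
      _ = _ := by simp [mul_comm]
  have h3 := abs_sub_le ((∑ j ∈ Finset.range N, f (eig (B N) j)) / (N : ℝ))
    ((∑ j ∈ Finset.range N, p.eval (eig (B N) j)) / N) (∫ t, f t * semicircleDensity t)
  have h4 := abs_sub_le ((∑ j ∈ Finset.range N, p.eval (eig (B N) j)) / (N : ℝ))
    (∫ t, p.eval t * semicircleDensity t) (∫ t, f t * semicircleDensity t)
  linarith

/-- Discarding one point does not change the limiting density. -/
lemma HasLimitingDensity.Ico_one {x : ℕ → ℕ → ℝ} {ρ : ℝ → ℝ}
    (h : HasLimitingDensity x (fun N => Finset.range N) ρ) :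
    HasLimitingDensity x (fun N => Finset.Ico 1 N) ρ := by
  intro f
  have h1 := h f
  have h2 : Tendsto (fun N : ℕ => ((N - 1 : ℕ) : ℝ)⁻¹) atTop (𝓝 0) :=
    tendsto_inv_atTop_nhds_zero_nat.comp (tendsto_sub_atTop_nat 1)
  have h3 : Tendsto (fun N => f (x N 0) * ((N - 1 : ℕ) : ℝ)⁻¹) atTop (𝓝 0) := by
    refine squeeze_zero_norm (a := fun N : ℕ => ‖f‖ * ((N - 1 : ℕ) : ℝ)⁻¹) (fun N => ?_)
      (by simpa using h2.const_mul ‖f‖)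
    rw [norm_mul, Real.norm_of_nonneg (r := ((N - 1 : ℕ) : ℝ)⁻¹) (by positivity)]
    gcongr
    exact f.norm_coe_le_norm _
  have h4 := (h1.mul (h2.const_add 1)).sub h3
  simp only [add_zero, mul_one, sub_zero] at h4
  refine h4.congr' ?_
  filter_upwards [eventually_ge_atTop 2] with N hN
  have hN1 : ((N - 1 : ℕ) : ℝ) = N - 1 := by push_cast [Nat.cast_sub (by omega : 1 ≤ N)]; ring
  have hN' : (2 : ℝ) ≤ N := by exact_mod_cast hN
  have hN2 : (N : ℝ) - 1 ≠ 0 := by linarith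
  have hN3 : (N : ℝ) ≠ 0 := by linarith
  simp only [Finset.card_range, Nat.card_Ico]
  rw [hN1, Finset.range_eq_Ico, Finset.sum_eq_sum_Ico_succ_bot (by omega : 0 < N)]
  field_simp
  ring

variable {W : ∀ N : ℕ, Matrix (Fin N) (Fin N) ℝ} {u : ∀ N : ℕ, Fin N → ℝ}

/-- The limiting density of the eigenvalues is not changed by a perturbation of rank one. -/
theorem hasLimitingDensity_add_vecMulVec (hW : ∀ N, (W N).IsSymm)
    (hu : ∀ N, 0 < N → u N ⬝ᵥ u N = 1) (hWR : ∀ᶠ N in atTop, ‖W N‖ ≤ 2)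
    (hT : ∀ p : ℝ[X], Tendsto (fun N => (aeval (W N) p).trace / N) atTop
      (𝓝 (∫ t, p.eval t * semicircleDensity t))) (α : ℝ) :
    HasLimitingDensity (fun N => eig (W N + α • Matrix.vecMulVec (u N) (u N)))
      (fun N => Finset.range N) semicircleDensity := by
  have hBR : ∀ᶠ N in atTop, ‖W N + α • Matrix.vecMulVec (u N) (u N)‖ ≤ 2 + |α| := by
    filter_upwards [hWR, eventually_gt_atTop 0] with N h1 hN
    exact (norm_add_vecMulVec_le _ _ (hu N hN)).trans (by gcongr)
  have h0 := abs_nonneg α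
  refine hasLimitingDensity_of_tendsto_trace (fun N => isSymm_add_vecMulVec (hW N) α (u N))
    (by linarith) hBR fun p => ?_
  obtain ⟨C, hC⟩ := exists_abs_trace_aeval_sub_le (2 + |α|) α p
  have hd : Tendsto (fun N : ℕ => ((aeval (W N + α • Matrix.vecMulVec (u N) (u N)) p).trace -
      (aeval (W N) p).trace) / N) atTop (𝓝 0) := by
    refine squeeze_zero_norm' (a := fun N : ℕ => C / N) ?_ (tendsto_const_div_atTop_nhds_zero_nat C)
    filter_upwards [hWR, hBR, eventually_gt_atTop 0] with N h1 h2 hN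
    have hN' : (0 : ℝ) < N := by exact_mod_cast hN
    rw [Real.norm_eq_abs, abs_div, abs_of_pos hN']
    gcongr
    exact hC N _ _ (hu N hN) (h1.trans (by linarith)) h2
  have := (hT p).add hd
  rw [add_zero] at this
  refine this.congr fun N => ?_
  ring

/-- The truncated generating function `∑_{j ≤ K} q ^ j U_{j-1}` of the Chebyshev polynomials. -/
def chebGen (q : ℝ) (K : ℕ) : ℝ[X] := ∑ j ∈ Finset.Icc 1 K, C (q ^ j) * chebSeq X j

lemma chebGen_succ (q : ℝ) (K : ℕ) :
    chebGen q (K + 1) = chebGen q K + C (q ^ (K + 1)) * chebSeq X (K + 1) :=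
  Finset.sum_Icc_succ_top (by omega) _

/-- Up to boundary terms, `chebGen q K` is an eigenvector of multiplication by `2 X`. -/
lemma two_mul_X_mul_chebGen {q : ℝ} (hq : q ≠ 0) (K : ℕ) :
    2 * X * chebGen q K = C (q⁻¹ + q) * chebGen q K + C (q ^ K) * chebSeq X (K + 1) -
      C (q ^ (K + 1)) * chebSeq X K - 1 := by
  induction K with
  | zero => simp [chebGen]
  | succ K ih =>
    have h := two_mul_mul_chebSeq (X : ℝ[X]) K
    have e : C (q⁻¹ + q) * (C (q ^ (K + 1)) : ℝ[X]) = C (q ^ K) + C (q ^ (K + 2)) := by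
      rw [← C_mul, ← C_add]
      congr 1
      field_simp
      ring
    rw [chebGen_succ, mul_add, ih, mul_add (C (q⁻¹ + q)), ← mul_assoc (C (q⁻¹ + q)), e]
    linear_combination C (q ^ (K + 1)) * h

lemma integral_chebSeq_mul_chebGen (q : ℝ) {i : ℕ} (hi : i ≠ 0) (K : ℕ) :
    ∫ t, (chebSeq X i * chebGen q K).eval t * semicircleDensity t = if i ≤ K then q ^ i else 0 := by
  induction K with
  | zero => simp [chebGen, hi]
  | succ K ih =>
    have e : ∀ t, (chebSeq X i * chebGen q (K + 1)).eval t * semicircleDensity t =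
        (chebSeq X i * chebGen q K).eval t * semicircleDensity t +
        q ^ (K + 1) * (chebSeq t i * chebSeq t (K + 1) * semicircleDensity t) := by
      intro t
      rw [chebGen_succ]
      simp only [eval_mul, eval_add, eval_C, eval_chebSeq]
      ring
    have hi2 : Integrable (fun t => q ^ (K + 1) *
        (chebSeq t i * chebSeq t (K + 1) * semicircleDensity t)) := by
      refine Integrable.const_mul (integrable_mul_semicircleDensity ?_) _
      simp_rw [← eval_chebSeq]
      fun_prop
    simp_rw [e]
    rw [integral_add (integrable_mul_semicircleDensity (by fun_prop)) hi2, ih, integral_const_mul,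
      integral_chebSeq_mul_chebSeq hi K.succ_ne_zero]
    rcases lt_trichotomy i (K + 1) with h | h | h
    · simp [h.ne, h.le, Nat.lt_succ_iff.1 h]
    · simp [h]
    · rw [if_neg (by omega), if_neg (by omega), if_neg (by omega)]; ring

lemma integral_chebGen_mul_chebGen (q : ℝ) (K : ℕ) :
    ∫ t, (chebGen q K * chebGen q K).eval t * semicircleDensity t =
      ∑ j ∈ Finset.Icc 1 K, (q ^ j) ^ 2 := by
  have e : ∀ t, (chebGen q K * chebGen q K).eval t * semicircleDensity t =
      ∑ j ∈ Finset.Icc 1 K, q ^ j * ((chebSeq X j * chebGen q K).eval t * semicircleDensity t) := by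
    intro t
    have h : (chebGen q K).eval t = ∑ j ∈ Finset.Icc 1 K, q ^ j * (chebSeq X j).eval t := by
      simp [chebGen, eval_finsetSum]
    rw [eval_mul]
    nth_rewrite 1 [h]
    rw [Finset.sum_mul, Finset.sum_mul]
    refine Finset.sum_congr rfl fun j _ => ?_
    rw [eval_mul]
    ring
  simp_rw [e]
  rw [integral_finsetSum _ fun j _ =>
    (integrable_mul_semicircleDensity (by fun_prop)).const_mul _]
  refine Finset.sum_congr rfl fun j hj => ?_
  rw [Finset.mem_Icc] at hj
  rw [integral_const_mul, integral_chebSeq_mul_chebGen q (by omega), if_pos hj.2, sq]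

/-- The quadratic form of `r(A)` at the vector `s(A) u`. -/
lemma dotProduct_aeval_mulVec {N : ℕ} {A : Matrix (Fin N) (Fin N) ℝ} (hA : A.IsSymm)
    (u : Fin N → ℝ) (s r : ℝ[X]) :
    u ⬝ᵥ aeval A (s * r * s) *ᵥ u = (aeval A s *ᵥ u) ⬝ᵥ (aeval A r *ᵥ (aeval A s *ᵥ u)) := by
  have hs : (aeval A s)ᵀ = aeval A s := by
    induction s using Polynomial.induction_on' with
    | add p q hp hq => rw [map_add, Matrix.transpose_add, hp, hq]
    | monomial k c =>
      rw [aeval_monomial, ← Algebra.smul_def, Matrix.transpose_smul, Matrix.transpose_pow, hA.eq]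
  rw [map_mul, map_mul, Matrix.mulVec_mulVec, mul_assoc, ← Matrix.mulVec_mulVec,
    Matrix.dotProduct_mulVec, ← Matrix.mulVec_transpose, hs]

/-- The lower bound for the outlier: the vector `∑_{j ≤ K} q ^ j U_{j-1}(W) u`, with
`q = 1 / (2 α)`, is an approximate eigenvector of `W + α u uᵀ`. -/
theorem eventually_lt_eig_zero (hW : ∀ N, (W N).IsSymm)
    (hX : ∀ p : ℝ[X], Tendsto (fun N => u N ⬝ᵥ aeval (W N) p *ᵥ u N) atTop
      (𝓝 (∫ t, p.eval t * semicircleDensity t))) {α : ℝ} (hα : 1 / 2 < α) {ε : ℝ} (hε : 0 < ε) :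
    ∀ᶠ N in atTop,
      α + 1 / (4 * α) - ε < eig (W N + α • Matrix.vecMulVec (u N) (u N)) 0 := by
  set q : ℝ := 1 / (2 * α) with hqdef
  set θ : ℝ := α + 1 / (4 * α) with hθ
  have hα0 : 0 < α := by linarith
  have hq0 : 0 < q := by positivity
  have hq1 : q < 1 := by rw [hqdef, div_lt_one (by positivity)]; linarith
  have hαq : α * q ^ 2 = q / 2 := by rw [hqdef]; field_simp
  have hθq : 2 * θ = q⁻¹ + q := by rw [hqdef, hθ]; field_simp; norm_num; ring
  -- the truncation at `K + 1` costs an error of at most `2 q ^ (2 K + 1)`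
  obtain ⟨K, hK⟩ : ∃ K : ℕ, 2 * q ^ (2 * K + 1) < ε := by
    obtain ⟨K, hK⟩ := exists_pow_lt_of_lt_one (by positivity : 0 < ε / 2) hq1
    refine ⟨K, ?_⟩
    have : q ^ (2 * K + 1) ≤ q ^ K := pow_le_pow_of_le_one hq0.le hq1.le (by omega)
    linarith
  set s := chebGen q (K + 1) with hs
  set S := ∑ j ∈ Finset.Icc 1 (K + 1), (q ^ j) ^ 2 with hS
  have hSq : q ^ 2 ≤ S := by
    have := Finset.single_le_sum (f := fun j => (q ^ j) ^ 2) (fun j _ => by positivity)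
      (Finset.mem_Icc.2 ⟨le_rfl, by omega⟩ : 1 ∈ Finset.Icc 1 (K + 1))
    simpa using this
  have h1 : Tendsto (fun N => u N ⬝ᵥ aeval (W N) s *ᵥ u N) atTop (𝓝 q) := by
    convert! hX s using 2
    have := integral_chebSeq_mul_chebGen q one_ne_zero (K + 1)
    simpa using this.symm
  have h2 : Tendsto (fun N => u N ⬝ᵥ aeval (W N) (s * 1 * s) *ᵥ u N) atTop (𝓝 S) := by
    convert! hX (s * 1 * s) using 2
    rw [mul_one, integral_chebGen_mul_chebGen]
  have h3 : Tendsto (fun N => u N ⬝ᵥ aeval (W N) (s * X * s) *ᵥ u N) atTop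
      (𝓝 (θ * S - q ^ (2 * K + 3) / 2 - q / 2)) := by
    convert! hX (s * X * s) using 2
    have hi : ∀ p : ℝ[X], Integrable fun t => p.eval t * semicircleDensity t := fun p =>
      integrable_mul_semicircleDensity (by fun_prop)
    have e : ∀ t, (s * X * s).eval t * semicircleDensity t =
        θ * ((s * s).eval t * semicircleDensity t) +
        q ^ (K + 1) / 2 * ((chebSeq X (K + 2) * s).eval t * semicircleDensity t) -
        q ^ (K + 2) / 2 * ((chebSeq X (K + 1) * s).eval t * semicircleDensity t) -
        1 / 2 * ((chebSeq X 1 * s).eval t * semicircleDensity t) := by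
      intro t
      have h := congrArg (eval t) (two_mul_X_mul_chebGen hq0.ne' (K + 1))
      simp only [eval_mul, eval_add, eval_sub, eval_C, eval_X, eval_one, eval_ofNat, ← hθq,
        chebSeq_one] at h ⊢
      linear_combination (s.eval t * semicircleDensity t / 2) * h
    simp_rw [e]
    have i1 := (hi (s * s)).const_mul θ
    have i2 := (hi (chebSeq X (K + 2) * s)).const_mul (q ^ (K + 1) / 2)
    have i3 := (hi (chebSeq X (K + 1) * s)).const_mul (q ^ (K + 2) / 2)
    have i4 := (hi (chebSeq X 1 * s)).const_mul (1 / 2)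
    have i12 : Integrable fun t => θ * ((s * s).eval t * semicircleDensity t) +
        q ^ (K + 1) / 2 * ((chebSeq X (K + 2) * s).eval t * semicircleDensity t) := i1.add i2
    have i123 : Integrable fun t => θ * ((s * s).eval t * semicircleDensity t) +
        q ^ (K + 1) / 2 * ((chebSeq X (K + 2) * s).eval t * semicircleDensity t) -
        q ^ (K + 2) / 2 * ((chebSeq X (K + 1) * s).eval t * semicircleDensity t) := i12.sub i3
    rw [integral_sub i123 i4, integral_sub i12 i3, integral_add i1 i2,
      integral_const_mul, integral_const_mul, integral_const_mul, integral_const_mul,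
      integral_chebGen_mul_chebGen, integral_chebSeq_mul_chebGen q (by omega),
      integral_chebSeq_mul_chebGen q (by omega), integral_chebSeq_mul_chebGen q (by omega),
      if_neg (by omega), if_pos le_rfl, if_pos (by omega)]
    ring
  -- the quadratic form of `W + α u uᵀ - θ` at the test vector
  have h4 : Tendsto (fun N => u N ⬝ᵥ aeval (W N) (s * X * s) *ᵥ u N +
      α * (u N ⬝ᵥ aeval (W N) s *ᵥ u N) ^ 2 - θ * (u N ⬝ᵥ aeval (W N) (s * 1 * s) *ᵥ u N)) atTop
      (𝓝 (-(q ^ (2 * K + 3) / 2))) := by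
    convert! (h3.add ((h1.pow 2).const_mul α)).sub (h2.const_mul θ) using 2
    rw [hαq]; ring
  have h5 := h4.eventually_const_lt
    (show -q ^ (2 * K + 3) < -(q ^ (2 * K + 3) / 2) by
      have : 0 < q ^ (2 * K + 3) := by positivity
      linarith)
  have h6 := h2.eventually_const_lt (show q ^ 2 / 2 < S by
    have : 0 < q ^ 2 := by positivity
    linarith)
  filter_upwards [h5, h6] with N h5 h6
  set w := aeval (W N) s *ᵥ u N with hw
  set B := W N + α • Matrix.vecMulVec (u N) (u N) with hB
  have h7 := dotProduct_mulVec_le_eig_zero (isSymm_add_vecMulVec (hW N) α (u N)) w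
  rw [dotProduct_add_vecMulVec_mulVec, ← hB] at h7
  rw [dotProduct_aeval_mulVec (hW N)] at h5 h6
  rw [dotProduct_aeval_mulVec (hW N)] at h5
  simp only [← hw, aeval_X, map_one, Matrix.one_mulVec] at h5 h6
  by_contra hcon
  rw [not_lt] at hcon
  have h8 : -q ^ (2 * K + 3) < (eig B 0 - θ) * (w ⬝ᵥ w) := by
    linarith
  have h9 : (eig B 0 - θ) * (w ⬝ᵥ w) ≤ -ε * (q ^ 2 / 2) := by
    nlinarith [mul_nonneg hε.le (sub_nonneg.2 h6.le), sq_nonneg q]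
  have h10 : q ^ (2 * K + 3) = q ^ 2 * q ^ (2 * K + 1) := by ring
  have h11 : q ^ 2 * (2 * q ^ (2 * K + 1)) < q ^ 2 * ε := by gcongr
  linarith

end Deterministic

/-! ### Almost sure behaviour of the rescaled GOE matrices -/

section AlmostSure

lemma unitOnes_dotProduct_self {N : ℕ} (hN : 0 < N) : unitOnes N ⬝ᵥ unitOnes N = 1 := by
  have hN' : (0 : ℝ) < N := by exact_mod_cast hN
  have hs : √(N : ℝ) * √N = N := Real.mul_self_sqrt hN'.le
  simp only [dotProduct, unitOnes, div_mul_div_comm, hs]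
  simp [hN'.ne']

lemma tendsto_zero_of_tendsto_ofReal_pow_four {x : ℕ → ℝ}
    (h : Tendsto (fun N => ENNReal.ofReal (x N ^ 4)) atTop (𝓝 0)) : Tendsto x atTop (𝓝 0) := by
  have h1 : Tendsto (fun N => x N ^ 4) atTop (𝓝 0) := by
    have := (ENNReal.tendsto_toReal ENNReal.zero_ne_top).comp h
    refine this.congr fun N => ?_
    exact ENNReal.toReal_ofReal (by positivity)
  rw [Metric.tendsto_atTop] at h1 ⊢
  intro ε hε
  obtain ⟨n, hn⟩ := h1 (ε ^ 4) (by positivity)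
  refine ⟨n, fun N hN => ?_⟩
  have h2 := hn N hN
  rw [Real.dist_eq, sub_zero, abs_pow] at h2
  rw [Real.dist_eq, sub_zero]
  exact lt_of_pow_lt_pow_left₀ 4 hε.le h2

variable {Ω : Type*} [MeasurableSpace Ω] {P : Measure Ω} [IsProbabilityMeasure P]
  {G : ∀ N : ℕ, Ω → Matrix (Fin N) (Fin N) ℝ}

lemma ae_tendsto_dotProduct_chebSeq (hG : ∀ N, IsGOE P (G N)) {k : ℕ} (hk : 2 ≤ k) :
    ∀ᵐ ω ∂P, Tendsto (fun N => unitOnes N ⬝ᵥ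
      chebSeq ((1 / √(2 * (N : ℝ))) • G N ω) k *ᵥ unitOnes N) atTop (𝓝 0) := by
  obtain ⟨C, hC, h⟩ := exists_integral_chebForm_pow_four_le k hk
  have := ae_tendsto_of_lintegral_le hG
    (fun N M => ENNReal.ofReal ((unitOnes N ⬝ᵥ chebSeq M k *ᵥ unitOnes N) ^ 4))
    (fun N => ((continuous_chebForm k (unitOnes N)).pow 4).measurable.ennreal_ofReal) (C := C)
    fun N hN => by
      have hu := unitOnes_dotProduct_self hN
      have h1 := h N hN _ hu
      change ∫⁻ a, ENNReal.ofReal (chebForm k (unitOnes N) a ^ 4)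
        ∂(stdGaussianPi (Fin N × Fin N)) ≤ _
      rw [← ofReal_integral_eq_lintegral_ofReal
        (((polyGrowth_chebForm k hu).pow 4).integrable (by fun_prop))
        (ae_of_all _ fun a => by simp only [Pi.zero_apply]; positivity)]
      exact ENNReal.ofReal_le_ofReal h1
  filter_upwards [this] with ω hω
  exact tendsto_zero_of_tendsto_ofReal_pow_four hω

lemma ae_tendsto_trace_chebSeq (hG : ∀ N, IsGOE P (G N)) {k : ℕ} (hk : 2 ≤ k) :
    ∀ᵐ ω ∂P, Tendsto (fun N : ℕ => (chebSeq ((1 / √(2 * (N : ℝ))) • G N ω) k).trace / N)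
      atTop (𝓝 0) := by
  obtain ⟨C, hC, h⟩ := exists_integral_chebForm_pow_four_le k hk
  have := ae_tendsto_of_lintegral_le hG
    (fun N M => ENNReal.ofReal (((chebSeq M k).trace / N) ^ 4))
    (fun N => ((continuous_chebTrace k).pow 4).measurable.ennreal_ofReal) (C := C)
    fun N hN => by
      have h1 := integral_chebTrace_pow_four_le hN (h N hN)
      change ∫⁻ a, ENNReal.ofReal (chebTrace k a ^ 4) ∂(stdGaussianPi (Fin N × Fin N)) ≤ _
      rw [← ofReal_integral_eq_lintegral_ofReal
        (((polyGrowth_chebTrace k).pow 4).integrable (by fun_prop))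
        (ae_of_all _ fun a => by simp only [Pi.zero_apply]; positivity)]
      exact ENNReal.ofReal_le_ofReal h1
  filter_upwards [this] with ω hω
  exact tendsto_zero_of_tendsto_ofReal_pow_four hω

open Polynomial in
/-- The semicircle law for the moments of the spectral measure at the vector `unitOnes N`. -/
theorem ae_tendsto_dotProduct_aeval (hG : ∀ N, IsGOE P (G N)) :
    ∀ᵐ ω ∂P, ∀ p : ℝ[X], Tendsto (fun N : ℕ => unitOnes N ⬝ᵥ
      aeval ((1 / √(2 * (N : ℝ))) • G N ω) p *ᵥ unitOnes N) atTop
      (𝓝 (∫ t, p.eval t * semicircleDensity t)) := by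
  have h := ae_all_iff.2 fun k : ℕ =>
    ae_tendsto_dotProduct_chebSeq hG (k := k + 2) (Nat.le_add_left 2 k)
  filter_upwards [h] with ω hω p
  refine tendsto_of_tendsto_chebSeq (fun N => (sandwich (unitOnes N) (unitOnes N)).toLinearMap ∘ₗ
    (aeval ((1 / √(2 * (N : ℝ))) • G N ω)).toLinearMap) (fun k hk => ?_) p
  match k, hk with
  | 1, _ =>
    refine tendsto_const_nhds.congr' ?_
    filter_upwards [eventually_gt_atTop 0] with N hN
    simp [sandwich_apply, unitOnes_dotProduct_self hN]
  | k + 2, _ =>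
    have := hω k
    simpa [sandwich_apply, aeval_chebSeq] using this

open Polynomial in
/-- The semicircle law for the moments of the empirical spectral measure. -/
theorem ae_tendsto_trace_aeval (hG : ∀ N, IsGOE P (G N)) :
    ∀ᵐ ω ∂P, ∀ p : ℝ[X], Tendsto (fun N : ℕ =>
      (aeval ((1 / √(2 * (N : ℝ))) • G N ω) p).trace / N) atTop
      (𝓝 (∫ t, p.eval t * semicircleDensity t)) := by
  have h := ae_all_iff.2 fun k : ℕ =>
    ae_tendsto_trace_chebSeq hG (k := k + 2) (Nat.le_add_left 2 k)
  filter_upwards [h] with ω hω p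
  have := tendsto_of_tendsto_chebSeq (l := atTop) (fun N : ℕ =>
    (N : ℝ)⁻¹ • (Matrix.traceLinearMap (Fin N) ℝ ℝ ∘ₗ
      (aeval ((1 / √(2 * (N : ℝ))) • G N ω)).toLinearMap)) (fun k hk => ?_) p
  · refine this.congr fun N => ?_
    simp [div_eq_inv_mul]
  match k, hk with
  | 1, _ =>
    refine tendsto_const_nhds.congr' ?_
    filter_upwards [eventually_gt_atTop 0] with N hN
    have hN' : (N : ℝ) ≠ 0 := by exact_mod_cast hN.ne'
    simp [hN']
  | k + 2, _ =>
    have := hω k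
    simpa [aeval_chebSeq, div_eq_inv_mul] using this

/-- The almost sure upper bound for quadratic forms of the perturbed matrices on the sphere. -/
theorem ae_eventually_quadratic_le (hG : ∀ N, IsGOE P (G N)) {β F : ℝ}
    (hF : ∀ y, 0 ≤ y → y ≤ 1 → y + β * (1 - y ^ 2) ≤ F) {σ : ℝ} (hσ : σ ^ 2 = 1) :
    ∀ᵐ ω ∂P, ∀ ε > 0, ∀ᶠ N : ℕ in atTop, ∀ v : Fin N → ℝ, v ⬝ᵥ v = 1 →
      σ * (v ⬝ᵥ ((1 / √(2 * (N : ℝ))) • G N ω) *ᵥ v) + β * (unitOnes N ⬝ᵥ v) ^ 2 ≤ F + ε := by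
  have key : ∀ m : ℕ, ∀ᵐ ω ∂P, ∀ᶠ N : ℕ in atTop, ∀ v : Fin N → ℝ, v ⬝ᵥ v = 1 →
      σ * (v ⬝ᵥ ((1 / √(2 * (N : ℝ))) • G N ω) *ᵥ v) + β * (unitOnes N ⬝ᵥ v) ^ 2 ≤
        F + 1 / (m + 1) := by
    intro m
    set c : ℝ := F + 1 / (m + 1) with hc
    have hFc : F < c := by
      have : (0 : ℝ) < 1 / (m + 1) := by positivity
      linarith
    obtain ⟨C, hC, h⟩ := exists_measure_sphere_le hF hFc hσ
    let S : ∀ N : ℕ, Set (Matrix (Fin N) (Fin N) ℝ) := fun N =>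
      {M | ∃ v : Fin N → ℝ, v ⬝ᵥ v = 1 ∧ c < σ * (v ⬝ᵥ M *ᵥ v) + β * (unitOnes N ⬝ᵥ v) ^ 2}
    have hS : ∀ N, MeasurableSet {a | wigner N a ∈ S N} := by
      intro N
      have : {a | wigner N a ∈ S N} = ⋃ v ∈ {v : Fin N → ℝ | v ⬝ᵥ v = 1},
          {a | c < σ * (v ⬝ᵥ wigner N a *ᵥ v) + β * (unitOnes N ⬝ᵥ v) ^ 2} := by
        ext a; simp [S]
      rw [this]
      refine (isOpen_biUnion fun v _ => isOpen_lt continuous_const ?_).measurableSet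
      exact ((((sandwich v v).continuous.comp continuous_wigner).const_mul σ)).add
        continuous_const
    -- indicator functions that tend to zero vanish eventually
    have hind := ae_tendsto_of_lintegral_le hG (fun N => (S N).indicator 1)
      (fun N => measurable_one.indicator (hS N)) (C := C) fun N hN => by
        have e : ∀ a, (S N).indicator (1 : Matrix (Fin N) (Fin N) ℝ → ENNReal) (wigner N a) =
            {a | wigner N a ∈ S N}.indicator 1 a := fun a => rfl
        simp_rw [e]
        rw [lintegral_indicator_one (hS N)]
        exact h N hN _ (unitOnes_dotProduct_self hN)
    filter_upwards [hind] with ω hω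
    filter_upwards [hω.eventually_lt_const one_pos] with N hN v hv
    by_contra hcon
    rw [not_le] at hcon
    rw [Set.indicator_of_mem (show _ ∈ S N from ⟨v, hv, hcon⟩)] at hN
    exact lt_irrefl _ hN
  filter_upwards [ae_all_iff.2 key] with ω hω ε hε
  obtain ⟨m, hm⟩ := exists_nat_one_div_lt hε
  filter_upwards [hω m] with N hN v hv
  exact (hN v hv).trans (by linarith)

omit [IsProbabilityMeasure P] in
lemma isSymm_rescaled (hG : ∀ N, IsGOE P (G N)) (ω : Ω) (N : ℕ) :
    ((1 / √(2 * (N : ℝ))) • G N ω).IsSymm := ((hG N).isSymm ω).smul _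

lemma ae_eventually_dotProduct_mulVec_le (hG : ∀ N, IsGOE P (G N)) :
    ∀ᵐ ω ∂P, ∀ ε > 0, ∀ᶠ N : ℕ in atTop, ∀ x : Fin N → ℝ,
      x ⬝ᵥ ((1 / √(2 * (N : ℝ))) • G N ω) *ᵥ x ≤ (1 + ε) * (x ⬝ᵥ x) := by
  have hF : ∀ y : ℝ, 0 ≤ y → y ≤ 1 → y + 0 * (1 - y ^ 2) ≤ 1 := fun y _ h => by linarith
  filter_upwards [ae_eventually_quadratic_le hG hF (one_pow 2)] with ω hω ε hε
  filter_upwards [hω ε hε] with N hN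
  refine dotProduct_mulVec_le_of_unit fun v hv => ?_
  have := hN v hv
  rwa [one_mul, zero_mul, add_zero] at this

lemma ae_eventually_le_dotProduct_mulVec (hG : ∀ N, IsGOE P (G N)) :
    ∀ᵐ ω ∂P, ∀ ε > 0, ∀ᶠ N : ℕ in atTop, ∀ x : Fin N → ℝ,
      -((1 + ε) * (x ⬝ᵥ x)) ≤ x ⬝ᵥ ((1 / √(2 * (N : ℝ))) • G N ω) *ᵥ x := by
  have hF : ∀ y : ℝ, 0 ≤ y → y ≤ 1 → y + 0 * (1 - y ^ 2) ≤ 1 := fun y _ h => by linarith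
  filter_upwards [ae_eventually_quadratic_le hG hF neg_one_sq] with ω hω ε hε
  filter_upwards [hω ε hε] with N hN x
  have := dotProduct_mulVec_le_of_unit (A := -((1 / √(2 * (N : ℝ))) • G N ω)) (c := 1 + ε)
    (fun v hv => by
      have := hN v hv
      rw [Matrix.neg_mulVec, dotProduct_neg]
      linarith) x
  rw [Matrix.neg_mulVec, dotProduct_neg] at this
  linarith

lemma ae_eventually_norm_le_two (hG : ∀ N, IsGOE P (G N)) :
    ∀ᵐ ω ∂P, ∀ᶠ N : ℕ in atTop, ‖(1 / √(2 * (N : ℝ))) • G N ω‖ ≤ 2 := by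
  filter_upwards [ae_eventually_dotProduct_mulVec_le hG, ae_eventually_le_dotProduct_mulVec hG] with
    ω h1 h2
  filter_upwards [h1 1 one_pos, h2 1 one_pos] with N h3 h4
  refine norm_le_of_abs_dotProduct_mulVec_le (isSymm_rescaled hG ω N) zero_le_two
    fun x => abs_le.2 ⟨?_, ?_⟩
  · have := h4 x; linarith
  · have := h3 x; linarith

lemma ae_hasLimitingDensity (hG : ∀ N, IsGOE P (G N)) (α : ℝ) :
    ∀ᵐ ω ∂P, HasLimitingDensity (fun N => eig (perturbed α (G N ω))) (fun N => Finset.range N)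
      semicircleDensity := by
  filter_upwards [ae_eventually_norm_le_two hG, ae_tendsto_trace_aeval hG] with ω h1 h2
  exact hasLimitingDensity_add_vecMulVec (isSymm_rescaled hG ω)
    (fun _ hN => unitOnes_dotProduct_self hN) h1 h2 α

lemma ae_eventually_le_eig (hG : ∀ N, IsGOE P (G N)) {α : ℝ} (hα : 0 ≤ α) :
    ∀ᵐ ω ∂P, ∀ ε > 0, ∀ᶠ N : ℕ in atTop, ∀ j < N, -1 - ε ≤ eig (perturbed α (G N ω)) j := by
  filter_upwards [ae_eventually_le_dotProduct_mulVec hG] with ω hω ε hε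
  filter_upwards [hω ε hε] with N hN j hj
  obtain ⟨v, hv, h⟩ := exists_eig_eq_dotProduct
    (isSymm_add_vecMulVec (isSymm_rescaled hG ω N) α (unitOnes N)) hj
  rw [perturbed, ← h, dotProduct_add_vecMulVec_mulVec]
  have h1 := hN v
  rw [hv] at h1
  nlinarith [mul_nonneg hα (sq_nonneg (unitOnes N ⬝ᵥ v))]

lemma ae_eventually_eig_le (hG : ∀ N, IsGOE P (G N)) {α F : ℝ}
    (hF : ∀ y, 0 ≤ y → y ≤ 1 → y + α * (1 - y ^ 2) ≤ F) :
    ∀ᵐ ω ∂P, ∀ ε > 0, ∀ᶠ N : ℕ in atTop, ∀ j < N, eig (perturbed α (G N ω)) j ≤ F + ε := by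
  filter_upwards [ae_eventually_quadratic_le hG hF (one_pow 2)] with ω hω ε hε
  filter_upwards [hω ε hε] with N hN j hj
  obtain ⟨v, hv, h⟩ := exists_eig_eq_dotProduct
    (isSymm_add_vecMulVec (isSymm_rescaled hG ω N) α (unitOnes N)) hj
  rw [perturbed, ← h, dotProduct_add_vecMulVec_mulVec]
  have h1 := hN v hv
  rw [one_mul] at h1
  linarith

end AlmostSure

end RankOneGOE

end

theorem proposition2p1 {Ω : Type*} [MeasurableSpace Ω] (P : Measure Ω) [IsProbabilityMeasure P]
    (G : ∀ N : ℕ, Ω → Matrix (Fin N) (Fin N) ℝ) (hG : ∀ N, RankOneGOE.IsGOE P (G N))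
    (α : ℝ) (hα : 0 < α) :
    (α ≤ 1 / 2 → ∀ᵐ ω ∂P,
      RankOneGOE.AsymptoticallySupportedOn
        (fun N => RankOneGOE.eig (RankOneGOE.perturbed α (G N ω))) (fun N => Finset.range N) (-1) 1 ∧
      RankOneGOE.HasLimitingDensity
        (fun N => RankOneGOE.eig (RankOneGOE.perturbed α (G N ω))) (fun N => Finset.range N)
        RankOneGOE.semicircleDensity) ∧
    (1 / 2 < α → ∀ᵐ ω ∂P,
      Tendsto (fun N => RankOneGOE.eig (RankOneGOE.perturbed α (G N ω)) 0) atTop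
        (𝓝 (α + 1 / (4 * α))) ∧
      RankOneGOE.AsymptoticallySupportedOn
        (fun N => RankOneGOE.eig (RankOneGOE.perturbed α (G N ω))) (fun N => Finset.Ico 1 N) (-1) 1 ∧
      RankOneGOE.HasLimitingDensity
        (fun N => RankOneGOE.eig (RankOneGOE.perturbed α (G N ω))) (fun N => Finset.Ico 1 N)
        RankOneGOE.semicircleDensity) := by
  have hdens := RankOneGOE.ae_hasLimitingDensity hG α
  have hge := RankOneGOE.ae_eventually_le_eig hG hα.le
  refine ⟨fun hα2 => ?_, fun hα2 => ?_⟩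
  · have hF : ∀ y, 0 ≤ y → y ≤ 1 → y + α * (1 - y ^ 2) ≤ 1 := fun y hy0 hy1 => by
      nlinarith [mul_nonneg (sub_nonneg.2 hy1) (sub_nonneg.2 hα2), mul_nonneg hα.le hy0,
        mul_nonneg (mul_nonneg hα.le (sub_nonneg.2 hy1)) (sub_nonneg.2 hy1)]
    filter_upwards [hdens, hge, RankOneGOE.ae_eventually_eig_le hG hF] with ω h1 h2 h3
    refine ⟨fun ε hε => ?_, h1⟩
    filter_upwards [h2 ε hε, h3 ε hε] with N h4 h5 j hj
    exact ⟨h4 j (Finset.mem_range.1 hj), h5 j (Finset.mem_range.1 hj)⟩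
  · -- the maximum of `y + α (1 - y²)` over `[0, 1]` is attained at `y = 1 / (2 α)`
    have hF : ∀ y, 0 ≤ y → y ≤ 1 → y + α * (1 - y ^ 2) ≤ α + 1 / (4 * α) := fun y _ _ => by
      have h : α + 1 / (4 * α) - (y + α * (1 - y ^ 2)) = α * (y - 1 / (2 * α)) ^ 2 := by
        field_simp
        ring
      have h0 : 0 ≤ α * (y - 1 / (2 * α)) ^ 2 := by positivity
      linarith
    filter_upwards [hdens, hge, RankOneGOE.ae_eventually_eig_le hG hF,
      RankOneGOE.ae_eventually_dotProduct_mulVec_le hG,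
      RankOneGOE.ae_tendsto_dotProduct_aeval hG] with ω h1 h2 h3 h4 h5
    refine ⟨?_, fun ε hε => ?_, h1.Ico_one⟩
    · rw [Metric.tendsto_nhds]
      intro ε hε
      filter_upwards [h3 (ε / 2) (by positivity),
        RankOneGOE.eventually_lt_eig_zero (RankOneGOE.isSymm_rescaled hG ω) h5 hα2 hε,
        eventually_gt_atTop 0] with N h6 h7 hN
      have h8 := h6 0 hN
      rw [Real.dist_eq, abs_lt]
      constructor
      · have h9 : α + 1 / (4 * α) - ε < RankOneGOE.eig (RankOneGOE.perturbed α (G N ω)) 0 := h7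
        linarith
      · linarith
    · filter_upwards [h2 ε hε, h4 ε hε] with N h6 h7 j hj
      rw [Finset.mem_Ico] at hj
      exact ⟨h6 j hj.2, RankOneGOE.eig_add_vecMulVec_le (RankOneGOE.isSymm_rescaled hG ω N) h7 α
        (RankOneGOE.unitOnes N) (by omega) hj.2⟩
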